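/- Let $\xi_0,\xi_1,\dots$ be i.i.d. complex random variables, nondegenerate (not almost surely constant), with $\mathbb P(\xi_0=0)=0$ and $\mathbb E\log(1+|\xi_0|)<\infty$. Let $K_n(z)=\sum_{k=0}^n\xi_kz^k$, let $0\le N_n\le n$ be integers, put $D_n=n-N_n$, and assume $D_n\to\infty$ as $n\to\infty$. Let $\mu_{D_n}^K=\sum_{z:\,K_n^{(N_n)}(z)=0}\delta_z$ be the zero measure of the $N_n$-th derivative of $K_n$, zeros being counted with multiplicity. Write $\mathbb D_r=\{z\in\mathbb C:|z|<r\}$. Random measures $\nu_n$ on $\mathbb C$ are said to converge in probability to a deterministic measure $\nu$ if $\int\varphi\,d\nu_n\to\int\varphi\,d\nu$ in probability for every smooth compactly supported $\varphi$. (1) If $N_n/n\to0$, then $\frac1{D_n}\mu_{D_n}^K$ converges in probability to the uniform probability measure on the unit circle, i.e. the unique rotationally invariant measure $\mu$ with $\mu(\mathbb D_r)=0$ for $0<r\le1$ and $\mu(\mathbb D_r)=1$ for $r>1$. (2) If $N_n/n\to a\in(0,1)$, then $\frac1{D_n}\mu_{D_n}^K$ converges in probability to the unique rotationally invariant measure $\mu_a^K$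 on $\mathbb C$ with $$\mu_a^K(\mathbb D_r)=\begin{cases}\dfrac{ar}{(1-a)(1-r)}&0<r<1-a,\\[1ex]1&r\ge1-a.\end{cases}$$ (3) If $N_n/n\to1$, then $\frac1{D_n}\mu_{D_n}^K$ converges in probability to $\delta_0$. Moreover, let $R_n=n/D_n$ (for $D_n>0$), let $\tilde K_n(z)=K_n^{(N_n)}(z/R_n)$, and let $\mu^{\tilde K}_{D_n}$ be the zero measure of $\tilde K_n$. Then $\mu^{\tilde K}_{D_n}=\mathcal S_{R_n}(\mu_{D_n}^K)$, where $(\mathcal S_h\nu)(B)=\nu(B/h)$ for Borel $B\subset\mathbb C$, and $\frac1{D_n}\mu^{\tilde K}_{D_n}$ converges in probability to the unique rotationally invariant measure $\tilde\mu^K$ with $\tilde\mu^K(\mathbb D_r)=r$ for $0<r<1$ and $\tilde\mu^K(\mathbb D_r)=1$ for $r\ge1$. The measure $\tilde\mu^K$ has density $\frac1{2\pi|z|}\mathbf 1_{|z|\le1}$ with respect to Lebesgue measure on $\mathbb C$. -/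

import Mathlib

open MeasureTheory ProbabilityTheory Filter Topology
open scoped ENNReal

noncomputable section

namespace KacZeros

/-- The Kac polynomial `∑_{k=0}^n c_k z^k` with coefficient sequence `c`. -/
def kac (c : ℕ → ℂ) (n : ℕ) : Polynomial ℂ :=
  ∑ k ∈ Finset.range (n + 1), Polynomial.C (c k) * Polynomial.X ^ k

/-- The `N`-th derivative of the Kac polynomial. -/
def kacDeriv (c : ℕ → ℂ) (n N : ℕ) : Polynomial ℂ :=
  Polynomial.derivative^[N] (kac c n)

/-- The zero measure `∑ δ_z` of a polynomial, zeros counted with multiplicity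
(the zero polynomial is given the zero measure). -/
def zeroMeasure (p : Polynomial ℂ) : Measure ℂ :=
  (p.roots.map fun z => Measure.dirac z).sum

/-- The polynomial `z ↦ p (z / R)`. -/
def rescalePoly (R : ℝ) (p : Polynomial ℂ) : Polynomial ℂ :=
  p.comp (Polynomial.C ((R : ℂ)⁻¹) * Polynomial.X)

/-- The scaling operator `(S_h ν)(B) = ν(B / h)`, for `h > 0`: the image of `ν` under `z ↦ h z`. -/
def scaleMeasure (h : ℝ) (ν : Measure ℂ) : Measure ℂ :=
  ν.map fun z => (h : ℂ) * z

/-- Convergence in probability of random measures `ν n` to a deterministic measure `μ`: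
`∫ φ dν_n → ∫ φ dμ` in probability, for each smooth compactly supported test function `φ`. -/
def ConvergesInProbability {Ω : Type*} [MeasurableSpace Ω] (P : Measure Ω)
    (ν : ℕ → Ω → Measure ℂ) (μ : Measure ℂ) : Prop :=
  ∀ φ : ℂ → ℝ, ContDiff ℝ ((⊤ : ℕ∞) : WithTop ℕ∞) φ → HasCompactSupport φ →
    TendstoInMeasure P (fun n ω => ∫ z, φ z ∂(ν n ω)) atTop (fun _ => ∫ z, φ z ∂μ)

/-- `μ` is rotationally invariant with `μ(D_r) = F r` for all `r > 0`, where `D_r` is the open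
disk of radius `r` about the origin. -/
def IsRadialWithProfile (μ : Measure ℂ) (F : ℝ → ℝ) : Prop :=
  (∀ u : ℂ, ‖u‖ = 1 → μ.map (fun z => u * z) = μ) ∧
    ∀ r : ℝ, 0 < r → μ (Metric.ball 0 r) = ENNReal.ofReal (F r)

/-- `μ` is the one and only rotationally invariant measure with `μ(D_r) = F r` for `r > 0`. -/
def IsTheRadialMeasure (μ : Measure ℂ) (F : ℝ → ℝ) : Prop :=
  IsRadialWithProfile μ F ∧ ∀ ν : Measure ℂ, IsRadialWithProfile ν F → ν = μ

/-- The uniform probability measure on the unit circle: the law of `e^{iθ}` with `θ` uniform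
on `(0, 2π]`. -/
def circleUniform : Measure ℂ :=
  (ENNReal.ofReal (2 * Real.pi))⁻¹ •
    (volume.restrict (Set.Ioc 0 (2 * Real.pi))).map (circleMap 0 1)

/-- `r ↦ μ(D_r)` for the uniform measure on the unit circle. -/
def circleProfile (r : ℝ) : ℝ := if r ≤ 1 then 0 else 1

/-- `r ↦ μ(D_r)` for the limit in the regime `N_n / n → a ∈ (0, 1)`. -/
def midProfile (a r : ℝ) : ℝ :=
  if r < 1 - a then a * r / ((1 - a) * (1 - r)) else 1

/-- `r ↦ μ(D_r)` for the rescaled limit in the regime `N_n / n → 1`. -/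
def diskProfile (r : ℝ) : ℝ := if r < 1 then r else 1

/-- The density `1 / (2π|z|)` on the closed unit disk. -/
def diskDensity (z : ℂ) : ℝ := if ‖z‖ ≤ 1 then 1 / (2 * Real.pi * ‖z‖) else 0

end KacZeros

end

namespace KacZeros

/-! ### The uniform measure on the circle -/

/-! Put D = n - N and rescale by n/D. Up to the factor N!, the derivative becomes p(z) = ∑_{k≤D} w_k
ξ_{N+k} z^k with w_k = C(N+k,k)(D/n)^k. The ratio w_{k-1}/w_k is exactly R_α(k/D) with α = N/n and
R_a(t) = t/(a + t(1-a)) (`weight_succ`). Hence (1/D) log|w_k z^k| equals, up to an error uniform in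
k, the profile H(k/D), where H(s) = ∫_0^s (log|z| - log R_a(t)) dt.

The random sum has the exponential size of its largest coefficient: off one circle, (1/D) log|p(z)|
tends to max H in probability (`tendstoInMeasure_log_norm_sum`). From above, the logarithmic moment
keeps all D+1 variables below e^{δD}. From below, continuity of H supplies M coefficients of
exponentially separated sizes just under the maximum; revealing their variables one at a time, each
leaves the partial sum small with conditional probability at most some q < 1, so the sum is small
with probability at most q^M plus the tail. As R_a is nondecreasing, max H = ∫ (log|z| - log R_a)^+,
which up to a constant is the logarithmic potential of the law of R_a(s)e^{iθ}, with s and θ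
uniform.

Zeros are recovered from potentials without distributional Laplacians. By Jensen's formula the mean
over the unit circle of log|c+2εx-w| - log|c+εx-w| is a nonnegative compactly supported kernel in
c-w. Testing this difference of log|p| against φ(c) gives the sum over the zeros of a mollified φ.
The difference is bounded in L² uniformly in w, so convergence in probability at almost every point
becomes convergence in mean, with no control on where the zeros lie
(`tendstoInMeasure_integral_zeroMeasure`).

The original zeros are the rescaled ones times D/n → 1-a, so their limit is the law of
(1-a)R_a(s)e^{iθ}: the circle law for a = 0, δ_0 for a = 1. A rotationally invariant measure with
bounded profile is determined by its values on disks, which identifies the limits. -/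

lemma ofReal_two_pi_pos : 0 < ENNReal.ofReal (2 * Real.pi) := by
  simpa using Real.pi_pos

instance : IsProbabilityMeasure circleUniform where
  measure_univ := by
    rw [circleUniform, Measure.smul_apply, Measure.map_apply (by fun_prop) MeasurableSet.univ]
    simp only [Set.preimage_univ, Measure.restrict_apply_univ, Real.volume_Ioc, sub_zero,
      smul_eq_mul]
    exact ENNReal.inv_mul_cancel ofReal_two_pi_pos.ne' ENNReal.ofReal_ne_top

lemma ae_circleUniform_norm : ∀ᵐ x ∂circleUniform, ‖x‖ = 1 := by
  refine Measure.ae_smul_measure ?_ _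
  refine (ae_map_iff (by fun_prop) (measurableSet_eq_fun (by fun_prop) (by fun_prop))).2 ?_
  exact Eventually.of_forall fun θ => by simp

lemma integral_circleUniform {f : ℂ → ℝ} (hf : Measurable f) (c : ℂ) (r : ℝ) :
    ∫ x, f (c + r * x) ∂circleUniform = Real.circleAverage f c r := by
  have hm : Measurable fun x : ℂ => f (c + r * x) := hf.comp (by fun_prop)
  rw [circleUniform, integral_smul_measure, integral_map (by fun_prop)
    hm.aestronglyMeasurable, Real.circleAverage_def,
    intervalIntegral.integral_of_le (by positivity), ENNReal.toReal_inv,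
    ENNReal.toReal_ofReal (by positivity)]
  simp [circleMap]

lemma integrable_circleUniform {f : ℂ → ℝ} (hf : Measurable f) (c : ℂ) (r : ℝ)
    (h : CircleIntegrable f c r) : Integrable (fun x => f (c + r * x)) circleUniform := by
  rw [circleUniform]
  refine Integrable.smul_measure ?_ (by simpa using ofReal_two_pi_pos.ne')
  have hm : Measurable fun x : ℂ => f (c + r * x) := hf.comp (by fun_prop)
  rw [integrable_map_measure hm.aestronglyMeasurable (by fun_prop)]
  have := (intervalIntegrable_iff_integrableOn_Ioc_of_le (by positivity)).1 h
  refine this.congr (Eventually.of_forall fun θ => ?_)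
  simp [circleMap]

lemma map_mul_circleUniform {u : ℂ} (hu : ‖u‖ = 1) :
    circleUniform.map (fun z => u * z) = circleUniform := by
  have : IsProbabilityMeasure (circleUniform.map (fun z => u * z)) :=
    Measure.isProbabilityMeasure_map (by fun_prop)
  refine ext_of_forall_integral_eq_of_IsFiniteMeasure fun f => ?_
  rw [integral_map (by fun_prop) f.continuous.aestronglyMeasurable]
  have h1 := integral_circleUniform (f := fun z => f (u * z)) (by fun_prop) 0 1
  have h2 := integral_circleUniform (f := f) (by fun_prop) 0 1
  simp only [zero_add, Complex.ofReal_one, one_mul] at h1 h2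
  rw [h1, h2, Real.circleAverage_eq_integral_add (f := f) (Complex.arg u), Real.circleAverage_def]
  have hu' : Complex.exp (Complex.arg u * Complex.I) = u := by
    simpa [hu] using Complex.norm_mul_exp_arg_mul_I u
  congr 2
  ext θ
  congr 1
  simp only [circleMap, Complex.ofReal_add, add_mul, Complex.exp_add, hu', zero_add,
    Complex.ofReal_one, one_mul]
  ring

/-! ### Rotationally invariant measures -/

/-- Average the invariance over a uniform rotation and exchange the integrals: the phase of z is
absorbed by the uniform factor, so only the law of the modulus remains. -/
lemma measure_eq_lintegral_circleUniform {ν : Measure ℂ} [IsFiniteMeasure ν]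
    (hν : ∀ u : ℂ, ‖u‖ = 1 → ν.map (fun z => u * z) = ν) {A : Set ℂ} (hA : MeasurableSet A) :
    ν A = ∫⁻ r, circleUniform {x | x * (r : ℂ) ∈ A} ∂(ν.map norm) := by
  have hmeas : MeasurableSet {p : ℂ × ℂ | p.1 * p.2 ∈ A} :=
    (measurable_fst.mul measurable_snd) hA
  have h1 : ν A = ∫⁻ x, ν {z | x * z ∈ A} ∂circleUniform := by
    have : ∀ᵐ x ∂circleUniform, ν {z | x * z ∈ A} = ν A := by
      filter_upwards [ae_circleUniform_norm] with x hx
      conv_rhs => rw [← hν x hx, Measure.map_apply (by fun_prop) hA]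
      rfl
    rw [lintegral_congr_ae this]
    simp
  have h2 : ∀ z : ℂ, circleUniform {x | x * z ∈ A} = circleUniform {x | x * (‖z‖ : ℂ) ∈ A} := by
    intro z
    have hu : ‖Complex.exp (Complex.arg z * Complex.I)‖ = 1 := Complex.norm_exp_ofReal_mul_I _
    conv_rhs => rw [← map_mul_circleUniform hu]
    have hm : MeasurableSet {x : ℂ | x * (‖z‖ : ℂ) ∈ A} :=
      (measurable_id.mul_const (‖z‖ : ℂ)) hA
    rw [Measure.map_apply (by fun_prop) hm]
    congr 1
    ext x
    simp only [Set.mem_ofPred_eq, Set.mem_preimage]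
    conv_lhs => rw [← Complex.norm_mul_exp_arg_mul_I z]
    ring_nf
  have hm : Measurable fun z : ℂ => circleUniform {x | x * z ∈ A} :=
    measurable_measure_prodMk_right hmeas
  have hm' : Measurable fun r : ℝ => circleUniform {x | x * (r : ℂ) ∈ A} :=
    hm.comp Complex.measurable_ofReal
  rw [lintegral_map hm' measurable_norm, h1]
  calc ∫⁻ x, ν {z | x * z ∈ A} ∂circleUniform
      = (circleUniform.prod ν) {p : ℂ × ℂ | p.1 * p.2 ∈ A} := (Measure.prod_apply hmeas).symm
    _ = ∫⁻ z, circleUniform {x | x * z ∈ A} ∂ν := Measure.prod_apply_symm hmeas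
    _ = _ := lintegral_congr h2

lemma measure_univ_eq_iSup_ball (ν : Measure ℂ) :
    ν Set.univ = ⨆ n : ℕ, ν (Metric.ball 0 (n + 1 : ℝ)) := by
  have hU : (Set.univ : Set ℂ) = ⋃ n : ℕ, Metric.ball 0 (n + 1 : ℝ) := by
    symm
    rw [Set.eq_univ_iff_forall]
    intro z
    obtain ⟨n, hn⟩ := exists_nat_gt ‖z‖
    exact Set.mem_iUnion.2 ⟨n, by simpa using hn.trans (lt_add_one _)⟩
  have hmono : Monotone fun n : ℕ => Metric.ball (0 : ℂ) (n + 1 : ℝ) := by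
    intro a b hab
    exact Metric.ball_subset_ball (by gcongr)
  rw [hU, hmono.measure_iUnion]

lemma measure_univ_le_of_profile {ν : Measure ℂ} {F : ℝ → ℝ} (hν : IsRadialWithProfile ν F)
    (hF : ∀ r, 0 < r → F r ≤ 1) : ν Set.univ ≤ 1 := by
  rw [measure_univ_eq_iSup_ball]
  refine iSup_le fun n => ?_
  rw [hν.2 _ (by positivity)]
  exact ENNReal.ofReal_le_one.2 (hF _ (by positivity))

/-- A rotationally invariant measure is determined by its values on disks. -/
theorem IsRadialWithProfile.isTheRadialMeasure {μ : Measure ℂ} {F : ℝ → ℝ}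
    (hμ : IsRadialWithProfile μ F) (hF : ∀ r, 0 < r → F r ≤ 1) : IsTheRadialMeasure μ F := by
  refine ⟨hμ, fun ν hν => ?_⟩
  have fin : ∀ {ν : Measure ℂ}, IsRadialWithProfile ν F → IsFiniteMeasure ν := fun h =>
    ⟨(measure_univ_le_of_profile h hF).trans_lt ENNReal.one_lt_top⟩
  have := fin hμ
  have := fin hν
  have key : ν.map norm = μ.map norm := by
    have huniv : ν Set.univ = μ Set.univ := by
      rw [measure_univ_eq_iSup_ball, measure_univ_eq_iSup_ball]
      refine iSup_congr fun n => ?_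
      rw [hν.2 _ (by positivity), hμ.2 _ (by positivity)]
    -- Closed half-lines pull back to complements of open disks, so finite and equal total masses
    -- are needed besides the profile.
    refine Measure.ext_of_Ici _ _ fun r => ?_
    rw [Measure.map_apply measurable_norm measurableSet_Ici,
      Measure.map_apply measurable_norm measurableSet_Ici]
    have hc : (norm ⁻¹' Set.Ici r : Set ℂ) = (Metric.ball 0 r)ᶜ := by
      ext z; simp
    rw [hc, measure_compl measurableSet_ball (measure_ne_top _ _),
      measure_compl measurableSet_ball (measure_ne_top _ _), huniv]
    rcases le_or_gt r 0 with h | h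
    · simp [Metric.ball_eq_empty.2 h]
    · rw [hν.2 r h, hμ.2 r h]
  ext A hA
  rw [measure_eq_lintegral_circleUniform hν.1 hA, measure_eq_lintegral_circleUniform hμ.1 hA, key]

/-- The law of `R(s) e^{iθ}` with `s` uniform on `(0, 1]` and `θ` an independent uniform angle. -/
noncomputable def radialMeasure (R : ℝ → ℝ) : Measure ℂ :=
  ((volume.restrict (Set.Ioc (0 : ℝ) 1)).prod circleUniform).map fun p => (R p.1 : ℂ) * p.2

instance : IsProbabilityMeasure (volume.restrict (Set.Ioc (0 : ℝ) 1)) :=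
  ⟨by simp⟩

lemma isProbabilityMeasure_radialMeasure {R : ℝ → ℝ} (hR : Measurable R) :
    IsProbabilityMeasure (radialMeasure R) :=
  Measure.isProbabilityMeasure_map (by fun_prop)

lemma map_mul_radialMeasure {R : ℝ → ℝ} (hR : Measurable R) {u : ℂ} (hu : ‖u‖ = 1) :
    (radialMeasure R).map (fun z => u * z) = radialMeasure R := by
  rw [radialMeasure, Measure.map_map (by fun_prop) (by fun_prop)]
  conv_rhs => rw [← map_mul_circleUniform hu, ← Measure.map_id (μ := volume.restrict _),
    Measure.map_prod_map _ _ (by fun_prop) (by fun_prop), Measure.map_map (by fun_prop)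
      (by fun_prop)]
  congr 1
  ext p
  simp only [Function.comp_apply, Prod.map_fst, Prod.map_snd, id_eq]
  ring

lemma radialMeasure_ball {R : ℝ → ℝ} (hR : Measurable R) (r : ℝ) :
    radialMeasure R (Metric.ball 0 r) = volume (Set.Ioc (0 : ℝ) 1 ∩ {s | |R s| < r}) := by
  rw [radialMeasure, Measure.map_apply (by fun_prop) measurableSet_ball]
  have h : (fun p : ℝ × ℂ => (R p.1 : ℂ) * p.2) ⁻¹' Metric.ball 0 r =ᵐ[
      (volume.restrict (Set.Ioc (0 : ℝ) 1)).prod circleUniform] {s | |R s| < r} ×ˢ Set.univ := by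
    have : ∀ᵐ p ∂((volume.restrict (Set.Ioc (0 : ℝ) 1)).prod circleUniform), ‖p.2‖ = 1 :=
      Measure.quasiMeasurePreserving_snd.ae ae_circleUniform_norm
    filter_upwards [this] with p hp
    refine propext ?_
    change (R p.1 : ℂ) * p.2 ∈ Metric.ball 0 r ↔ p ∈ {s | |R s| < r} ×ˢ Set.univ
    simp [hp]
  have hm : MeasurableSet {s | |R s| < r} := measurableSet_lt (by fun_prop) (by fun_prop)
  rw [measure_congr h, Measure.prod_prod, measure_univ, mul_one, Measure.restrict_apply hm,
    Set.inter_comm]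

lemma radialMeasure_isRadialWithProfile {R F : ℝ → ℝ} (hR : Measurable R)
    (h : ∀ r, 0 < r → volume (Set.Ioc (0 : ℝ) 1 ∩ {s | |R s| < r}) = ENNReal.ofReal (F r)) :
    IsRadialWithProfile (radialMeasure R) F :=
  ⟨fun _ hu => map_mul_radialMeasure hR hu, fun r hr => by rw [radialMeasure_ball hR, h r hr]⟩

lemma circleUniform_isRadialWithProfile : IsRadialWithProfile circleUniform circleProfile := by
  refine ⟨fun _ hu => map_mul_circleUniform hu, fun r hr => ?_⟩
  unfold circleProfile
  split_ifs with h
  · rw [ENNReal.ofReal_zero]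
    refine measure_mono_null ?_ (ae_iff.1 ae_circleUniform_norm)
    intro z hz hz1
    simp only [Metric.mem_ball, dist_zero_right] at hz
    linarith
  · rw [ENNReal.ofReal_one, prob_compl_eq_zero_iff measurableSet_ball |>.1]
    refine measure_mono_null ?_ (ae_iff.1 ae_circleUniform_norm)
    intro z hz hz1
    simp only [Set.mem_compl_iff, Metric.mem_ball, dist_zero_right] at hz
    exact hz (by linarith)

lemma map_mul_volume {u : ℂ} (hu : ‖u‖ = 1) :
    (volume : Measure ℂ).map (fun z => u * z) = volume := by
  have := (rotation ⟨u, mem_sphere_zero_iff_norm.2 hu⟩).measurePreserving.map_eq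
  exact this

/-- Rotations preserve area. In polar coordinates the Jacobian cancels 1/|z|, leaving the constant
1/(2π) on a rectangle of width min(r, 1) and height 2π. -/
lemma withDensity_diskDensity_isRadialWithProfile :
    IsRadialWithProfile (volume.withDensity fun z => ENNReal.ofReal (diskDensity z))
      diskProfile := by
  have hmd : Measurable diskDensity := by
    unfold diskDensity
    exact Measurable.ite (measurableSet_le (by fun_prop) (by fun_prop)) (by fun_prop) (by fun_prop)
  refine ⟨fun u hu => ?_, fun r hr => ?_⟩
  · ext A hA
    have hA' : MeasurableSet ((fun z => u * z) ⁻¹' A) := (by fun_prop : Measurable fun z => u * z) hA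
    rw [Measure.map_apply (by fun_prop) hA, withDensity_apply _ hA, withDensity_apply _ hA',
      ← lintegral_indicator hA, ← lintegral_indicator hA']
    conv_rhs => rw [← map_mul_volume hu]
    rw [lintegral_map ((hmd.ennreal_ofReal).indicator hA) (by fun_prop)]
    refine lintegral_congr fun z => ?_
    have : diskDensity (u * z) = diskDensity z := by simp [diskDensity, hu]
    by_cases hz : u * z ∈ A <;> simp [Set.indicator, hz, this]
  · rw [withDensity_apply _ measurableSet_ball, ← lintegral_indicator measurableSet_ball,
      ← Complex.lintegral_comp_polarCoord_symm]
    have hval : ∀ p ∈ Set.Ioi (0 : ℝ) ×ˢ Set.Ioo (-Real.pi) Real.pi,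
        ENNReal.ofReal p.1 • (Metric.ball (0 : ℂ) r).indicator
          (fun z => ENNReal.ofReal (diskDensity z)) (Complex.polarCoord.symm p) =
        (({x : ℝ | x < r ∧ x ≤ 1}) ×ˢ (Set.univ : Set ℝ)).indicator
          (fun _ => ENNReal.ofReal (1 / (2 * Real.pi))) p := by
      rintro ⟨x, t⟩ ⟨hx, -⟩
      simp only [Set.mem_Ioi] at hx
      have hn : ‖Complex.polarCoord.symm (x, t)‖ = x := by
        rw [Complex.norm_polarCoord_symm, abs_of_pos hx]
      by_cases h1 : x < r
      · by_cases h2 : x ≤ 1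
        · rw [Set.indicator_of_mem (by rw [mem_ball_zero_iff, hn]; exact h1), Set.indicator_of_mem (by simp [h1, h2]),
            smul_eq_mul, ← ENNReal.ofReal_mul hx.le, diskDensity, if_pos (by rwa [hn]), hn]
          congr 1
          field_simp
        · rw [Set.indicator_of_mem (by rw [mem_ball_zero_iff, hn]; exact h1), Set.indicator_of_notMem (by simp [h2]),
            diskDensity, if_neg (by rwa [hn])]
          simp
      · rw [Set.indicator_of_notMem (by rw [mem_ball_zero_iff, hn]; exact h1),
          Set.indicator_of_notMem (by simp [h1])]
        simp
    have hms : MeasurableSet {x : ℝ | x < r ∧ x ≤ 1} :=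
      (measurableSet_lt measurable_id measurable_const).inter
        (measurableSet_le measurable_id measurable_const)
    have hpos : {x : ℝ | x < r ∧ x ≤ 1} ∩ Set.Ioi 0 =
        if r < 1 then Set.Ioo 0 r else if r = 1 then Set.Ioo 0 1 else Set.Ioc 0 1 := by
      split_ifs with h h'
      · ext x; simp only [Set.mem_inter_iff, Set.mem_ofPred_eq, Set.mem_Ioi, Set.mem_Ioo]
        constructor
        · rintro ⟨⟨a, b⟩, c⟩; exact ⟨c, a⟩
        · rintro ⟨a, b⟩; exact ⟨⟨b, by linarith⟩, a⟩
      · subst h'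
        ext x; simp only [Set.mem_inter_iff, Set.mem_ofPred_eq, Set.mem_Ioi, Set.mem_Ioo]
        constructor
        · rintro ⟨⟨a, b⟩, c⟩; exact ⟨c, a⟩
        · rintro ⟨a, b⟩; exact ⟨⟨b, b.le⟩, a⟩
      · have : 1 < r := lt_of_le_of_ne (not_lt.1 h) (Ne.symm h')
        ext x; simp only [Set.mem_inter_iff, Set.mem_ofPred_eq, Set.mem_Ioi, Set.mem_Ioc]
        constructor
        · rintro ⟨⟨a, b⟩, c⟩; exact ⟨c, b⟩
        · rintro ⟨a, b⟩; exact ⟨⟨by linarith, b⟩, a⟩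
    have hvol : volume ({x : ℝ | x < r ∧ x ≤ 1} ∩ Set.Ioi 0) = ENNReal.ofReal (diskProfile r) := by
      rw [hpos, diskProfile]
      split_ifs <;> simp
    have htm : MeasurableSet (Set.Ioi (0 : ℝ) ×ˢ Set.Ioo (-Real.pi) Real.pi) :=
      measurableSet_Ioi.prod measurableSet_Ioo
    rw [polarCoord_target, setLIntegral_congr_fun htm hval,
      lintegral_indicator (hms.prod MeasurableSet.univ),
      setLIntegral_const, Measure.restrict_apply (hms.prod MeasurableSet.univ), Set.prod_inter_prod,
      Measure.volume_eq_prod, Measure.prod_prod, hvol, Set.univ_inter, Real.volume_Ioo, mul_comm,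
      mul_assoc, ← ENNReal.ofReal_mul (by linarith [Real.pi_pos])]
    have : (Real.pi - -Real.pi) * (1 / (2 * Real.pi)) = 1 := by
      have := Real.pi_pos
      field_simp
      ring
    rw [this, ENNReal.ofReal_one, mul_one]

/-! ### Logarithmic kernels -/

lemma log_radius_add_posLog {r a : ℝ} (hr : 0 < r) (ha : 0 ≤ a) :
    Real.log r + Real.posLog (r⁻¹ * a) = Real.log (max r a) := by
  rw [Real.posLog_eq_log_max_one (by positivity), ← Real.log_mul hr.ne' (by positivity)]
  congr 1
  rw [mul_max_of_nonneg _ _ hr.le, mul_one, mul_inv_cancel_left₀ hr.ne']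

lemma measurable_log_norm_sub (w : ℂ) : Measurable fun z : ℂ => Real.log ‖z - w‖ := by
  fun_prop

/-- Jensen's formula for a linear factor; the kernels and potentials below all come from it. -/
lemma integral_log_norm_circleUniform {r : ℝ} (hr : 0 < r) (c w : ℂ) :
    ∫ x, Real.log ‖c + r * x - w‖ ∂circleUniform = Real.log (max r ‖c - w‖) := by
  have h := integral_circleUniform (measurable_log_norm_sub w) c r
  rw [h, circleAverage_log_norm_sub_const_eq_log_radius_add_posLog hr.ne',
    log_radius_add_posLog hr (norm_nonneg _)]

lemma integrable_log_norm_circleUniform (r : ℝ) (c w : ℂ) :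
    Integrable (fun x => Real.log ‖c + r * x - w‖) circleUniform :=
  integrable_circleUniform (measurable_log_norm_sub w) c r
    (circleIntegrable_log_norm_sub_const r)

lemma log_one_add_sq_le {t : ℝ} (ht : 0 ≤ t) : Real.log (1 + t) ^ 2 ≤ 4 * t := by
  have h1 : 1 + t ≤ (1 + √t) ^ 2 := by nlinarith [Real.sq_sqrt ht, Real.sqrt_nonneg t]
  have h2 : Real.log (1 + t) ≤ 2 * √t := by
    calc Real.log (1 + t) ≤ Real.log ((1 + √t) ^ 2) := Real.log_le_log (by linarith) h1
      _ = 2 * Real.log (1 + √t) := by rw [Real.log_pow]; norm_num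
      _ ≤ 2 * √t := by
        have := Real.log_le_sub_one_of_pos (show 0 < 1 + √t by positivity)
        linarith
  have h0 : 0 ≤ Real.log (1 + t) := Real.log_nonneg (by linarith)
  nlinarith [Real.sq_sqrt ht, Real.sqrt_nonneg t]

/-- Since log(1+t) ≤ 2√t, squaring turns the logarithmic singularity into an inverse-distance one,
which is locally integrable in the plane and easy to bound uniformly. -/
lemma sq_log_sub_log_le {a b e : ℝ} (ha : 0 < a) (hb : 0 < b) (hab : |a - b| ≤ e) :
    (Real.log a - Real.log b) ^ 2 ≤ 4 * e * (a⁻¹ + b⁻¹) := by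
  wlog h : b ≤ a generalizing a b
  · have := this hb ha (by rwa [abs_sub_comm]) (le_of_not_ge h)
    rw [add_comm b⁻¹] at this
    calc _ = (Real.log b - Real.log a) ^ 2 := by ring
      _ ≤ _ := this
  have he : 0 ≤ e := (abs_nonneg _).trans hab
  have h1 : a ≤ b * (1 + e / b) := by
    rw [mul_add, mul_one, mul_div_cancel₀ _ hb.ne']
    linarith [le_abs_self (a - b)]
  have h2 : Real.log a - Real.log b ≤ Real.log (1 + e / b) := by
    have := Real.log_le_log ha h1
    rw [Real.log_mul hb.ne' (by positivity)] at this
    linarith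
  have h3 : 0 ≤ Real.log a - Real.log b := sub_nonneg.2 (Real.log_le_log hb h)
  calc (Real.log a - Real.log b) ^ 2 ≤ Real.log (1 + e / b) ^ 2 := by gcongr
    _ ≤ 4 * (e / b) := log_one_add_sq_le (by positivity)
    _ = 4 * e * b⁻¹ := by ring
    _ ≤ 4 * e * (a⁻¹ + b⁻¹) := by
      gcongr
      have : 0 < a⁻¹ := by positivity
      linarith

lemma lintegral_inv_norm_ball_lt_top :
    ∫⁻ z in Metric.ball (0 : ℂ) 1, ENNReal.ofReal ‖z‖⁻¹ < ⊤ := by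
  have h : IntegrableOn (fun z : ℂ => ‖z‖⁻¹) (Metric.ball 0 1) := by
    refine integrableOn_ball_of_norm_le_rpow (C := 1) (α := 1) (by simp) (by simp) ?_
      (by fun_prop)
    refine Eventually.of_forall fun z => ?_
    simp [Real.rpow_neg_one]
  have := h.lintegral_lt_top
  exact this

/-- The part where `z + v` lies in the unit ball is bounded by translation invariance, the rest by 1
times the area; neither bound sees v. -/
lemma exists_lintegral_inv_norm_add_le (ρ : ℝ) :
    ∃ C : ℝ≥0∞, C ≠ ⊤ ∧ ∀ v : ℂ,
      ∫⁻ z in Metric.ball (0 : ℂ) ρ, ENNReal.ofReal ‖z + v‖⁻¹ ≤ C := by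
  refine ⟨(∫⁻ z in Metric.ball (0 : ℂ) 1, ENNReal.ofReal ‖z‖⁻¹) + volume (Metric.ball (0 : ℂ) ρ),
    ENNReal.add_ne_top.2 ⟨lintegral_inv_norm_ball_lt_top.ne, measure_ball_lt_top.ne⟩, fun v => ?_⟩
  have hle : ∀ z : ℂ, ENNReal.ofReal ‖z + v‖⁻¹ ≤
      (Metric.ball (0 : ℂ) 1).indicator (fun y => ENNReal.ofReal ‖y‖⁻¹) (z + v) + 1 := by
    intro z
    by_cases hz : z + v ∈ Metric.ball (0 : ℂ) 1
    · rw [Set.indicator_of_mem hz]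
      exact le_self_add
    · rw [Set.indicator_of_notMem hz, zero_add]
      refine ENNReal.ofReal_le_one.2 (inv_le_one_of_one_le₀ ?_)
      simpa using hz
  have hm : Measurable ((Metric.ball (0 : ℂ) 1).indicator fun y => ENNReal.ofReal ‖y‖⁻¹) :=
    Measurable.indicator (by fun_prop) measurableSet_ball
  calc ∫⁻ z in Metric.ball (0 : ℂ) ρ, ENNReal.ofReal ‖z + v‖⁻¹
      ≤ ∫⁻ z in Metric.ball (0 : ℂ) ρ,
        ((Metric.ball (0 : ℂ) 1).indicator (fun y => ENNReal.ofReal ‖y‖⁻¹) (z + v) + 1) :=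
        lintegral_mono hle
    _ = (∫⁻ z in Metric.ball (0 : ℂ) ρ,
        (Metric.ball (0 : ℂ) 1).indicator (fun y => ENNReal.ofReal ‖y‖⁻¹) (z + v)) +
        volume (Metric.ball (0 : ℂ) ρ) := by
        rw [lintegral_add_right _ measurable_const]; simp
    _ ≤ (∫⁻ z, (Metric.ball (0 : ℂ) 1).indicator (fun y => ENNReal.ofReal ‖y‖⁻¹) (z + v)) +
        volume (Metric.ball (0 : ℂ) ρ) := by
        gcongr
        exact Measure.restrict_le_self
    _ = _ := by
        rw [lintegral_add_right_eq_self
          (fun z => (Metric.ball (0 : ℂ) 1).indicator (fun y => ENNReal.ofReal ‖y‖⁻¹) z) v,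
          lintegral_indicator measurableSet_ball]

/-- The reference measure: a uniform point `c` of a disk and an independent uniform direction. -/
noncomputable def diskCircle (ρ : ℝ) : Measure (ℂ × ℂ) :=
  (volume.restrict (Metric.ball (0 : ℂ) ρ)).prod circleUniform

instance (ρ : ℝ) : IsFiniteMeasure (volume.restrict (Metric.ball (0 : ℂ) ρ)) :=
  isFiniteMeasure_restrict.2 measure_ball_lt_top.ne

instance (ρ : ℝ) : IsFiniteMeasure (diskCircle ρ) := by
  unfold diskCircle; infer_instance

/-- For each fixed direction the map is a translation in the base point. This transfers statements
true for almost every z to the random sampling points. -/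
lemma quasiMeasurePreserving_add_mul (ρ : ℝ) (t : ℂ) :
    Measure.QuasiMeasurePreserving (fun p : ℂ × ℂ => p.1 + t * p.2) (diskCircle ρ) volume := by
  refine ⟨by fun_prop, Measure.AbsolutelyContinuous.mk fun S hS h0 => ?_⟩
  rw [Measure.map_apply (by fun_prop) hS, diskCircle, Measure.prod_apply_symm
    ((by fun_prop : Measurable fun p : ℂ × ℂ => p.1 + t * p.2) hS)]
  refine (lintegral_congr fun x => ?_).trans lintegral_zero
  refine measure_mono_null ?_ (Measure.absolutelyContinuous_of_le Measure.restrict_le_self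
    (show volume ((fun c : ℂ => c + t * x) ⁻¹' S) = 0 by rw [measure_preimage_add_right, h0]))
  intro c hc
  exact hc

/-- The difference of logarithmic kernels at the points `c + 2εx` and `c + εx`. -/
noncomputable def logDiff (e : ℝ) (w : ℂ) (p : ℂ × ℂ) : ℝ :=
  Real.log ‖p.1 + (2 * e : ℝ) * p.2 - w‖ - Real.log ‖p.1 + e * p.2 - w‖

@[fun_prop]
lemma measurable_logDiff (e : ℝ) (w : ℂ) : Measurable (logDiff e w) := by
  unfold logDiff; fun_prop

lemma ae_add_mul_ne (ρ : ℝ) (t w : ℂ) : ∀ᵐ p ∂(diskCircle ρ), p.1 + t * p.2 ≠ w :=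
  (quasiMeasurePreserving_add_mul ρ t).ae (p := fun z => z ≠ w) (by simp [ae_iff])

/-- Uniformity in w is the reason for working with a difference: a single logarithm grows as w goes
to infinity, while the two sampling points stay at distance e from each other. -/
lemma exists_lintegral_logDiff_sq_le (ρ : ℝ) {e : ℝ} (he : 0 < e) :
    ∃ C : ℝ≥0∞, C ≠ ⊤ ∧ ∀ w, ∫⁻ p, ENNReal.ofReal (logDiff e w p ^ 2) ∂(diskCircle ρ) ≤ C := by
  obtain ⟨C, hC, hCb⟩ := exists_lintegral_inv_norm_add_le ρ
  refine ⟨ENNReal.ofReal (4 * e) * (C + C), ENNReal.mul_ne_top ENNReal.ofReal_ne_top (by simp [hC]),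
    fun w => ?_⟩
  have hpt : ∀ᵐ p ∂(diskCircle ρ), ENNReal.ofReal (logDiff e w p ^ 2) ≤
      ENNReal.ofReal (4 * e) * (ENNReal.ofReal ‖p.1 + ((2 * e : ℝ) * p.2 - w)‖⁻¹ +
        ENNReal.ofReal ‖p.1 + (e * p.2 - w)‖⁻¹) := by
    have hx : ∀ᵐ p ∂(diskCircle ρ), ‖p.2‖ = 1 :=
      Measure.quasiMeasurePreserving_snd.ae ae_circleUniform_norm
    filter_upwards [ae_add_mul_ne ρ (2 * e : ℝ) w, ae_add_mul_ne ρ e w, hx] with p h1 h2 hx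
    rw [← ENNReal.ofReal_add (by positivity) (by positivity), ← ENNReal.ofReal_mul (by positivity),
      ← add_sub_assoc, ← add_sub_assoc]
    refine ENNReal.ofReal_le_ofReal (sq_log_sub_log_le (norm_pos_iff.2 (sub_ne_zero.2 h1))
      (norm_pos_iff.2 (sub_ne_zero.2 h2)) ?_)
    refine (abs_norm_sub_norm_le _ _).trans (le_of_eq ?_)
    have : p.1 + ((2 * e : ℝ) : ℂ) * p.2 - w - (p.1 + e * p.2 - w) = e * p.2 := by
      push_cast; ring
    rw [this, norm_mul, hx, mul_one, Complex.norm_real, Real.norm_of_nonneg he.le]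
  have hb : ∀ t : ℂ, ∫⁻ p, ENNReal.ofReal ‖p.1 + (t * p.2 - w)‖⁻¹ ∂(diskCircle ρ) ≤ C := by
    intro t
    rw [diskCircle, lintegral_prod_symm _ (by fun_prop)]
    calc _ ≤ ∫⁻ _, C ∂circleUniform := lintegral_mono fun x => hCb (t * x - w)
      _ = C := by simp
  refine (lintegral_mono_ae hpt).trans ?_
  rw [lintegral_const_mul _ (by fun_prop), lintegral_add_left (by fun_prop)]
  gcongr
  · exact hb _
  · exact hb _

lemma eLpNorm_logDiff_le (ρ : ℝ) {e : ℝ} (he : 0 < e) :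
    ∃ C : ℝ≥0∞, C ≠ ⊤ ∧ ∀ w, eLpNorm (logDiff e w) 2 (diskCircle ρ) ≤ C := by
  obtain ⟨C, hC, hCb⟩ := exists_lintegral_logDiff_sq_le ρ he
  refine ⟨C ^ (1 / 2 : ℝ), ENNReal.rpow_ne_top_of_nonneg (by norm_num) hC, fun w => ?_⟩
  rw [eLpNorm_eq_lintegral_rpow_enorm_toReal (by norm_num) (by norm_num)]
  simp only [ENNReal.toReal_ofNat]
  gcongr
  refine le_trans (le_of_eq (lintegral_congr fun p => ?_)) (hCb w)
  rw [← ofReal_norm, Real.norm_eq_abs, ENNReal.ofReal_rpow_of_nonneg (abs_nonneg _)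
    (by norm_num)]
  simp

lemma memLp_logDiff (ρ : ℝ) {e : ℝ} (he : 0 < e) (w : ℂ) :
    MemLp (logDiff e w) 2 (diskCircle ρ) := by
  obtain ⟨C, hC, hCb⟩ := eLpNorm_logDiff_le ρ he
  exact ⟨(measurable_logDiff e w).aestronglyMeasurable, (hCb w).trans_lt hC.lt_top⟩

lemma eLpNorm_multiset_sum_le {X : Type*} [MeasurableSpace X] {κ : Measure X} {ι : Type*}
    {f : ι → X → ℝ} {C : ℝ≥0∞} (hf : ∀ i, AEStronglyMeasurable (f i) κ)
    (hC : ∀ i, eLpNorm (f i) 2 κ ≤ C) (m : Multiset ι) :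
    eLpNorm (fun x => (m.map fun i => f i x).sum) 2 κ ≤ m.card * C := by
  have hmeas : ∀ m : Multiset ι, AEStronglyMeasurable (fun x => (m.map fun i => f i x).sum) κ := by
    intro m
    induction m using Multiset.induction_on with
    | empty => simpa using aestronglyMeasurable_const
    | cons a m ih =>
      simp only [Multiset.map_cons, Multiset.sum_cons]
      exact (hf a).add ih
  induction m using Multiset.induction_on with
  | empty => simp
  | cons a m ih =>
    simp only [Multiset.map_cons, Multiset.sum_cons, Multiset.card_cons, Nat.cast_add,
      Nat.cast_one, add_mul, one_mul]
    refine (eLpNorm_add_le (hf a) (hmeas m) (by norm_num)).trans ?_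
    rw [add_comm]
    exact add_le_add ih (hC a)

lemma log_norm_eval {p : Polynomial ℂ} {z : ℂ} (h : p.eval z ≠ 0) :
    Real.log ‖p.eval z‖ =
      Real.log ‖p.leadingCoeff‖ + (p.roots.map fun w => Real.log ‖z - w‖).sum := by
  have hp : p ≠ 0 := by rintro rfl; simp at h
  have key : ∀ m : Multiset ℂ, (∀ w ∈ m, z ≠ w) →
      (m.map fun w => z - w).prod ≠ 0 ∧ Real.log ‖(m.map fun w => z - w).prod‖ =
        (m.map fun w => Real.log ‖z - w‖).sum := by
    intro m
    induction m using Multiset.induction_on with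
    | empty => simp
    | cons a m ih =>
      intro hm
      obtain ⟨h1, h2⟩ := ih fun w hw => hm w (Multiset.mem_cons_of_mem hw)
      have ha : z - a ≠ 0 := sub_ne_zero.2 (hm a (Multiset.mem_cons_self a m))
      simp only [Multiset.map_cons, Multiset.prod_cons, Multiset.sum_cons]
      refine ⟨mul_ne_zero ha h1, ?_⟩
      rw [norm_mul, Real.log_mul (norm_ne_zero_iff.2 ha) (norm_ne_zero_iff.2 h1), h2]
  have hroots : ∀ w ∈ p.roots, z ≠ w := by
    rintro w hw rfl
    exact h (Polynomial.isRoot_of_mem_roots hw)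
  obtain ⟨h1, h2⟩ := key p.roots hroots
  have he : p.eval z = p.leadingCoeff * (p.roots.map fun w => z - w).prod := by
    conv_lhs => rw [(IsAlgClosed.splits p).eq_prod_roots]
    simp [Polynomial.eval_multiset_prod, Multiset.map_map]
  rw [he, norm_mul, Real.log_mul (norm_ne_zero_iff.2 (Polynomial.leadingCoeff_ne_zero.2 hp))
    (norm_ne_zero_iff.2 h1), h2]

/-- The difference of `log |p|` at the points `c + 2εx` and `c + εx`. -/
noncomputable def polyLogDiff (e : ℝ) (p : Polynomial ℂ) (y : ℂ × ℂ) : ℝ :=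
  Real.log ‖p.eval (y.1 + (2 * e : ℝ) * y.2)‖ - Real.log ‖p.eval (y.1 + e * y.2)‖

/-- The leading coefficient cancels in the difference, so its size never matters. For p = 0 both
sides vanish because `Real.log 0 = 0` and there are no roots. -/
lemma polyLogDiff_ae_eq (ρ e : ℝ) (p : Polynomial ℂ) :
    polyLogDiff e p =ᵐ[diskCircle ρ] fun y => (p.roots.map fun w => logDiff e w y).sum := by
  by_cases hp : p = 0
  · subst hp
    exact Eventually.of_forall fun y => by simp [polyLogDiff]
  have hz : ∀ t : ℂ, ∀ᵐ y ∂(diskCircle ρ), p.eval (y.1 + t * y.2) ≠ 0 := by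
    intro t
    refine (quasiMeasurePreserving_add_mul ρ t).ae (p := fun z => p.eval z ≠ 0) ?_
    rw [ae_iff]
    simp only [ne_eq, not_not]
    exact (Polynomial.finite_setOfPred_isRoot hp).measure_zero _
  filter_upwards [hz (2 * e : ℝ), hz e] with y h1 h2
  rw [polyLogDiff, log_norm_eval h1, log_norm_eval h2]
  simp only [logDiff, Multiset.sum_map_sub]
  ring

/-! ### Mollification -/

/-- The radial kernel `log max(2ε, |y|) - log max(ε, |y|)`, supported in the disk of radius `2ε`. -/
noncomputable def bumpKernel (e : ℝ) (y : ℂ) : ℝ :=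
  Real.log (max (2 * e) ‖y‖) - Real.log (max e ‖y‖)

lemma continuous_bumpKernel {e : ℝ} (he : 0 < e) : Continuous (bumpKernel e) := by
  unfold bumpKernel
  refine Continuous.sub (Continuous.log (by fun_prop) fun y => ?_)
    (Continuous.log (by fun_prop) fun y => ?_)
  · exact (lt_max_of_lt_left (by linarith)).ne'
  · exact (lt_max_of_lt_left he).ne'

lemma bumpKernel_nonneg {e : ℝ} (he : 0 < e) (y : ℂ) : 0 ≤ bumpKernel e y :=
  sub_nonneg.2 (Real.log_le_log (lt_max_of_lt_left he) (max_le_max_right _ (by linarith)))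

lemma bumpKernel_le {e : ℝ} (he : 0 < e) (y : ℂ) : bumpKernel e y ≤ Real.log 2 := by
  have h : max (2 * e) ‖y‖ ≤ 2 * max e ‖y‖ := by
    refine max_le (by gcongr; exact le_max_left _ _) ?_
    have := le_max_right e ‖y‖
    linarith [norm_nonneg y]
  have := Real.log_le_log (lt_max_of_lt_left (by linarith)) h
  rw [Real.log_mul (by norm_num) (lt_max_of_lt_left he).ne'] at this
  unfold bumpKernel
  linarith

lemma abs_bumpKernel_le {e : ℝ} (he : 0 < e) (y : ℂ) : |bumpKernel e y| ≤ Real.log 2 := by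
  rw [abs_of_nonneg (bumpKernel_nonneg he y)]
  exact bumpKernel_le he y

lemma bumpKernel_eq_zero {e : ℝ} (he : 0 < e) {y : ℂ} (hy : 2 * e < ‖y‖) : bumpKernel e y = 0 := by
  rw [bumpKernel, max_eq_right hy.le, max_eq_right (by linarith), sub_self]

lemma hasCompactSupport_bumpKernel {e : ℝ} (he : 0 < e) : HasCompactSupport (bumpKernel e) := by
  refine HasCompactSupport.intro (isCompact_closedBall (0 : ℂ) (2 * e)) fun y hy => ?_
  exact bumpKernel_eq_zero he (by simpa using hy)

lemma integral_bumpKernel_pos {e : ℝ} (he : 0 < e) : 0 < ∫ y, bumpKernel e y := by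
  refine (continuous_bumpKernel he).integral_pos_of_hasCompactSupport_nonneg_nonzero
    (hasCompactSupport_bumpKernel he) (bumpKernel_nonneg he) (x := 0) ?_
  have : Real.log e < Real.log (2 * e) := Real.log_lt_log he (by linarith)
  simp only [bumpKernel, norm_zero, max_eq_left he.le, max_eq_left (show 0 ≤ 2 * e by linarith)]
  linarith

lemma integral_logDiff_circleUniform {e : ℝ} (he : 0 < e) (c w : ℂ) :
    ∫ x, logDiff e w (c, x) ∂circleUniform = bumpKernel e (c - w) := by
  unfold logDiff
  rw [integral_sub (integrable_log_norm_circleUniform (2 * e) c w)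
    (integrable_log_norm_circleUniform e c w),
    integral_log_norm_circleUniform (by linarith) c w, integral_log_norm_circleUniform he c w]
  rfl

/-- The mollification (up to a constant factor) of `φ` by the kernel. -/
noncomputable def mollify (e ρ : ℝ) (φ : ℂ → ℝ) (w : ℂ) : ℝ :=
  ∫ c in Metric.ball (0 : ℂ) ρ, φ c * bumpKernel e (c - w)

lemma integrable_mul_logDiff {e : ℝ} (he : 0 < e) (ρ : ℝ) {φ : ℂ → ℝ} (hφ : Measurable φ) {M : ℝ}
    (hM : ∀ z, |φ z| ≤ M) (w : ℂ) :
    Integrable (fun y : ℂ × ℂ => φ y.1 * logDiff e w y) (diskCircle ρ) :=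
  ((memLp_logDiff ρ he w).integrable (by norm_num)).bdd_mul
    (hφ.comp measurable_fst).aestronglyMeasurable (Eventually.of_forall fun y => hM y.1)

lemma integral_mul_logDiff {e : ℝ} (he : 0 < e) (ρ : ℝ) {φ : ℂ → ℝ} (hφ : Measurable φ) {M : ℝ}
    (hM : ∀ z, |φ z| ≤ M) (w : ℂ) :
    ∫ y, φ y.1 * logDiff e w y ∂(diskCircle ρ) = mollify e ρ φ w := by
  have hi := integrable_mul_logDiff he ρ hφ hM w
  unfold diskCircle at hi ⊢
  rw [integral_prod _ hi, mollify]
  refine integral_congr_ae (Eventually.of_forall fun c => ?_)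
  simp only
  rw [integral_const_mul, integral_logDiff_circleUniform he]

/-- The substitute for testing the Laplacian of log|p|: Jensen's formula in the direction variable
turns each root into a copy of the kernel. -/
lemma integral_mul_polyLogDiff {e : ℝ} (he : 0 < e) (ρ : ℝ) {φ : ℂ → ℝ} (hφ : Measurable φ) {M : ℝ}
    (hM : ∀ z, |φ z| ≤ M) (p : Polynomial ℂ) :
    ∫ y, φ y.1 * polyLogDiff e p y ∂(diskCircle ρ) = (p.roots.map (mollify e ρ φ)).sum := by
  have key : ∀ m : Multiset ℂ,
      Integrable (fun y : ℂ × ℂ => φ y.1 * (m.map fun w => logDiff e w y).sum) (diskCircle ρ) ∧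
      ∫ y, φ y.1 * (m.map fun w => logDiff e w y).sum ∂(diskCircle ρ) =
        (m.map (mollify e ρ φ)).sum := by
    intro m
    induction m using Multiset.induction_on with
    | empty => simp
    | cons a m ih =>
      simp only [Multiset.map_cons, Multiset.sum_cons, mul_add]
      refine ⟨(integrable_mul_logDiff he ρ hφ hM a).add ih.1, ?_⟩
      rw [integral_add (integrable_mul_logDiff he ρ hφ hM a) ih.1,
        integral_mul_logDiff he ρ hφ hM a, ih.2]
  rw [← (key p.roots).2]
  refine integral_congr_ae ?_
  filter_upwards [polyLogDiff_ae_eq ρ e p] with y hy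
  rw [hy]

/-- As φ is supported in the ball of radius ρ, the integral extends to the whole plane and becomes a
convolution; the kernel only sees displacements up to 2e. -/
lemma abs_mollify_sub_le {e ρ η : ℝ} (he : 0 < e) {φ : ℂ → ℝ} (hφ : Continuous φ)
    (hρ : Function.support φ ⊆ Metric.ball 0 ρ) (hη : ∀ w y : ℂ, ‖y‖ ≤ 2 * e → |φ (y + w) - φ w| ≤ η)
    (w : ℂ) :
    |mollify e ρ φ w - (∫ y, bumpKernel e y) * φ w| ≤ (∫ y, bumpKernel e y) * η := by
  have h1 : mollify e ρ φ w = ∫ y, φ (y + w) * bumpKernel e y := by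
    rw [mollify, setIntegral_eq_integral_of_forall_compl_eq_zero, ← integral_add_right_eq_self
      (fun c => φ c * bumpKernel e (c - w)) w]
    · simp
    · intro x hx
      have : φ x = 0 := by
        by_contra h
        exact hx (hρ h)
      rw [this, zero_mul]
  have hi : Integrable (bumpKernel e) := (continuous_bumpKernel he).integrable_of_hasCompactSupport
    (hasCompactSupport_bumpKernel he)
  have hi2 : Integrable fun y => φ (y + w) * bumpKernel e y := by
    refine Continuous.integrable_of_hasCompactSupport
      ((hφ.comp (by fun_prop)).mul (continuous_bumpKernel he)) ?_
    exact (hasCompactSupport_bumpKernel he).mul_left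
  rw [h1, ← integral_mul_const, ← integral_mul_const, ← integral_sub hi2 (hi.mul_const _)]
  refine abs_integral_le_integral_abs.trans
    (integral_mono (hi2.sub (hi.mul_const _)).abs (hi.mul_const _) fun y => ?_)
  have h3 : φ (y + w) * bumpKernel e y - bumpKernel e y * φ w =
    bumpKernel e y * (φ (y + w) - φ w) := by ring
  simp only [h3, abs_mul, abs_of_nonneg (bumpKernel_nonneg he y)]
  rcases le_or_gt ‖y‖ (2 * e) with h | h
  · exact mul_le_mul_of_nonneg_left (hη w y h) (bumpKernel_nonneg he y)
  · simp [bumpKernel_eq_zero he h]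

lemma continuous_mollify {e : ℝ} (he : 0 < e) (ρ : ℝ) {φ : ℂ → ℝ} (hφ : Measurable φ) {M : ℝ}
    (hM : ∀ z, |φ z| ≤ M) : Continuous (mollify e ρ φ) := by
  unfold mollify
  refine continuous_of_dominated (bound := fun _ => M * Real.log 2) (fun w => ?_)
    (fun w => Eventually.of_forall fun c => ?_) (integrable_const _)
    (Eventually.of_forall fun c => ?_)
  · exact (hφ.mul ((continuous_bumpKernel he).measurable.comp (by fun_prop))).aestronglyMeasurable
  · rw [norm_mul]
    exact mul_le_mul (hM c) (abs_bumpKernel_le he _) (norm_nonneg _)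
      ((abs_nonneg _).trans (hM c))
  · exact continuous_const.mul ((continuous_bumpKernel he).comp (by fun_prop))

lemma abs_mollify_le {e : ℝ} (he : 0 < e) (ρ : ℝ) {φ : ℂ → ℝ} {M : ℝ}
    (hM : ∀ z, |φ z| ≤ M) (w : ℂ) :
    |mollify e ρ φ w| ≤ M * Real.log 2 * volume.real (Metric.ball (0 : ℂ) ρ) := by
  unfold mollify
  rw [← Real.norm_eq_abs]
  refine norm_setIntegral_le_of_norm_le_const measure_ball_lt_top fun c _ => ?_
  rw [norm_mul]
  exact mul_le_mul (hM c) (abs_bumpKernel_le he _) (norm_nonneg _) ((abs_nonneg _).trans (hM c))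

/-! ### The potential of a radial measure -/

/-- Up to an additive constant the logarithmic potential of `radialMeasure R`. -/
noncomputable def radialPotential (R : ℝ → ℝ) (z : ℂ) : ℝ :=
  ∫ s in Set.Ioc (0 : ℝ) 1, Real.log (max ‖z‖ (R s))

/-- The logarithm is bounded above here, so its absolute value is at most a constant minus itself;
Jensen's formula evaluates the inner integral of that and bounds it uniformly. -/
lemma integrable_log_norm_two_circles {r t : ℝ} (hr : 0 < r) (ht : 0 < t) (c : ℂ) :
    Integrable (fun p : ℂ × ℂ => Real.log ‖c + r * p.1 - t * p.2‖)
      (circleUniform.prod circleUniform) := by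
  have hm : Measurable fun p : ℂ × ℂ => Real.log ‖c + r * p.1 - t * p.2‖ := by fun_prop
  have hin : ∀ x : ℂ, Integrable (fun y => Real.log ‖c + r * x - t * y‖) circleUniform := by
    intro x
    refine (integrable_log_norm_circleUniform t 0 (c + r * x)).congr
      (Eventually.of_forall fun y => ?_)
    simp only [zero_add, norm_sub_rev]
  have hval : ∀ x : ℂ, ∫ y, Real.log ‖c + r * x - t * y‖ ∂circleUniform =
      Real.log (max t ‖c + r * x‖) := by
    intro x
    have := integral_log_norm_circleUniform ht 0 (c + r * x)
    simpa only [zero_add, zero_sub, norm_neg, norm_sub_rev] using this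
  refine (integrable_prod_iff hm.aestronglyMeasurable).2 ⟨Eventually.of_forall hin, ?_⟩
  set K : ℝ := ‖c‖ + r + t with hK
  refine Integrable.of_bound (C := 2 * Real.posLog K + |Real.log t| + Real.posLog K)
    (hm.norm.stronglyMeasurable.integral_prod_right).aestronglyMeasurable ?_
  filter_upwards [ae_circleUniform_norm] with x hx
  have hcx : ‖c + r * x‖ ≤ ‖c‖ + r := by
    refine (norm_add_le _ _).trans ?_
    rw [norm_mul, hx, Complex.norm_real, Real.norm_of_nonneg hr.le, mul_one]
  have hK1 : 0 ≤ Real.posLog K := Real.posLog_nonneg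
  have hle : ∀ᵐ y ∂circleUniform, ‖Real.log ‖c + r * x - t * y‖‖ ≤
      2 * Real.posLog K - Real.log ‖c + r * x - t * y‖ := by
    filter_upwards [ae_circleUniform_norm] with y hy
    have hn : ‖c + r * x - t * y‖ ≤ K := by
      refine (norm_sub_le _ _).trans ?_
      rw [norm_mul, hy, Complex.norm_real, Real.norm_of_nonneg ht.le, mul_one]
      linarith
    have h1 : Real.log ‖c + r * x - t * y‖ ≤ Real.posLog K :=
      (le_max_right _ _).trans (Real.posLog_le_posLog (norm_nonneg _) hn)
    rw [Real.norm_eq_abs, abs_le]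
    constructor <;> linarith
  have hnn : 0 ≤ ∫ y, ‖Real.log ‖c + r * x - t * y‖‖ ∂circleUniform :=
    integral_nonneg fun y => norm_nonneg _
  rw [Real.norm_of_nonneg hnn]
  refine (integral_mono_ae (hin x).norm ((integrable_const _).sub (hin x)) hle).trans ?_
  rw [integral_sub' (integrable_const _) (hin x), hval, integral_const]
  simp only [probReal_univ, one_smul]
  have : -|Real.log t| ≤ Real.log (max t ‖c + r * x‖) :=
    (neg_abs_le _).trans (Real.log_le_log ht (le_max_left _ _))
  linarith

/-- Both sides are the same double circle integral of log|c + rx - ty|, with Jensen's formula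
applied to one variable or to the other. -/
lemma integral_log_max_two_circles {r t : ℝ} (hr : 0 < r) (ht : 0 < t) (c : ℂ) :
    ∫ x, Real.log (max ‖c + r * x‖ t) ∂circleUniform =
      ∫ y, Real.log (max r ‖c - t * y‖) ∂circleUniform := by
  have hswap := integral_integral_swap (μ := circleUniform) (ν := circleUniform)
    (f := fun x y => Real.log ‖c + r * x - t * y‖) (integrable_log_norm_two_circles hr ht c)
  have h1 : ∀ x : ℂ, ∫ y, Real.log ‖c + r * x - t * y‖ ∂circleUniform =
      Real.log (max ‖c + r * x‖ t) := by
    intro x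
    have := integral_log_norm_circleUniform ht 0 (c + r * x)
    simpa only [zero_add, zero_sub, norm_neg, norm_sub_rev, max_comm] using this
  have h2 : ∀ y : ℂ, ∫ x, Real.log ‖c + r * x - t * y‖ ∂circleUniform =
      Real.log (max r ‖c - t * y‖) := fun y => integral_log_norm_circleUniform hr c (t * y)
  simp only [h1, h2] at hswap
  exact hswap

lemma abs_log_max_le {R : ℝ} (hR : 0 < R) (hR1 : R ≤ 1) (z : ℂ) :
    |Real.log (max ‖z‖ R)| ≤ ‖z‖ + |Real.log R| := by
  have h0 : 0 < max ‖z‖ R := lt_max_of_lt_right hR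
  have h1 : Real.log R ≤ Real.log (max ‖z‖ R) := Real.log_le_log hR (le_max_right _ _)
  have h2 : Real.log (max ‖z‖ R) ≤ ‖z‖ := by
    have : max ‖z‖ R ≤ 1 + ‖z‖ := max_le (by linarith) (by linarith [norm_nonneg z])
    have h3 := Real.log_le_log h0 this
    have := Real.log_le_sub_one_of_pos (show 0 < 1 + ‖z‖ by positivity)
    linarith
  rw [abs_le]
  constructor
  · linarith [neg_abs_le (Real.log R), norm_nonneg z]
  · linarith [abs_nonneg (Real.log R)]

lemma measurable_radialPotential {R : ℝ → ℝ} (hR : Measurable R) : Measurable (radialPotential R) := by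
  have : Measurable fun p : ℂ × ℝ => Real.log (max ‖p.1‖ (R p.2)) := by fun_prop
  exact (this.stronglyMeasurable.integral_prod_right).measurable

lemma integrable_log_max {R : ℝ → ℝ} (hR : Measurable R) (hR0 : ∀ s ∈ Set.Ioc (0 : ℝ) 1, 0 < R s)
    (hR1 : ∀ s ∈ Set.Ioc (0 : ℝ) 1, R s ≤ 1)
    (hlog : IntegrableOn (fun s => Real.log (R s)) (Set.Ioc 0 1))
    (z : ℂ) :
    Integrable (fun s => Real.log (max ‖z‖ (R s))) (volume.restrict (Set.Ioc (0 : ℝ) 1)) := by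
  refine Integrable.mono' ((integrable_const ‖z‖).add hlog.abs)
    (by fun_prop : Measurable fun s => Real.log (max ‖z‖ (R s))).aestronglyMeasurable ?_
  filter_upwards [ae_restrict_mem measurableSet_Ioc] with s hs
  exact abs_log_max_le (hR0 s hs) (hR1 s hs) z

lemma abs_radialPotential_le {R : ℝ → ℝ} (hR : Measurable R) (hR0 : ∀ s ∈ Set.Ioc (0 : ℝ) 1, 0 < R s)
    (hR1 : ∀ s ∈ Set.Ioc (0 : ℝ) 1, R s ≤ 1)
    (hlog : IntegrableOn (fun s => Real.log (R s)) (Set.Ioc 0 1))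
    (z : ℂ) :
    |radialPotential R z| ≤ ‖z‖ + ∫ s in Set.Ioc (0 : ℝ) 1, |Real.log (R s)| := by
  refine abs_integral_le_integral_abs.trans ?_
  have : ∫ s in Set.Ioc (0 : ℝ) 1, (‖z‖ + |Real.log (R s)|) =
      ‖z‖ + ∫ s in Set.Ioc (0 : ℝ) 1, |Real.log (R s)| := by
    rw [integral_add (integrable_const _) hlog.abs]
    simp
  rw [← this]
  refine integral_mono_ae (integrable_log_max hR hR0 hR1 hlog z).abs
    ((integrable_const _).add hlog.abs) ?_
  filter_upwards [ae_restrict_mem measurableSet_Ioc] with s hs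
  exact abs_log_max_le (hR0 s hs) (hR1 s hs) z

lemma integrable_radialPotential_circle {R : ℝ → ℝ} (hR : Measurable R) (hR0 : ∀ s ∈ Set.Ioc (0 : ℝ) 1, 0 < R s)
    (hR1 : ∀ s ∈ Set.Ioc (0 : ℝ) 1, R s ≤ 1)
    (hlog : IntegrableOn (fun s => Real.log (R s)) (Set.Ioc 0 1))
    {r : ℝ} (hr : 0 < r) (c : ℂ) :
    Integrable (fun x => radialPotential R (c + r * x)) circleUniform := by
  refine Integrable.of_bound
    (C := ‖c‖ + r + ∫ s in Set.Ioc (0 : ℝ) 1, |Real.log (R s)|)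
    ((measurable_radialPotential hR).comp (by fun_prop)).aestronglyMeasurable ?_
  filter_upwards [ae_circleUniform_norm] with x hx
  refine (abs_radialPotential_le hR hR0 hR1 hlog _).trans ?_
  gcongr
  refine (norm_add_le _ _).trans ?_
  rw [norm_mul, hx, Complex.norm_real, Real.norm_of_nonneg hr.le, mul_one]

lemma integral_radialPotential_circle {R : ℝ → ℝ} (hR : Measurable R) (hR0 : ∀ s ∈ Set.Ioc (0 : ℝ) 1, 0 < R s)
    (hR1 : ∀ s ∈ Set.Ioc (0 : ℝ) 1, R s ≤ 1)
    (hlog : IntegrableOn (fun s => Real.log (R s)) (Set.Ioc 0 1))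
    {r : ℝ} (hr : 0 < r) (c : ℂ) :
    ∫ x, radialPotential R (c + r * x) ∂circleUniform =
      ∫ s in Set.Ioc (0 : ℝ) 1, ∫ y, Real.log (max r ‖c - R s * y‖) ∂circleUniform := by
  have hfint : Integrable (fun p : ℂ × ℝ => Real.log (max ‖c + r * p.1‖ (R p.2)))
      (circleUniform.prod (volume.restrict (Set.Ioc (0 : ℝ) 1))) := by
    refine Integrable.mono' (g := fun p => (‖c‖ + r) + |Real.log (R p.2)|) ?_ (by fun_prop :
      Measurable fun p : ℂ × ℝ => Real.log (max ‖c + r * p.1‖ (R p.2))).aestronglyMeasurable ?_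
    · exact (integrable_const _).add (Integrable.comp_snd hlog.abs circleUniform)
    · have h1 : ∀ᵐ p ∂(circleUniform.prod (volume.restrict (Set.Ioc (0 : ℝ) 1))), ‖p.1‖ = 1 :=
        Measure.quasiMeasurePreserving_fst.ae ae_circleUniform_norm
      have h2 : ∀ᵐ p ∂(circleUniform.prod (volume.restrict (Set.Ioc (0 : ℝ) 1))),
          p.2 ∈ Set.Ioc (0 : ℝ) 1 :=
        Measure.quasiMeasurePreserving_snd.ae (ae_restrict_mem measurableSet_Ioc)
      filter_upwards [h1, h2] with p hp1 hp2
      refine (abs_log_max_le (hR0 _ hp2) (hR1 _ hp2) _).trans ?_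
      gcongr
      refine (norm_add_le _ _).trans ?_
      rw [norm_mul, hp1, Complex.norm_real, Real.norm_of_nonneg hr.le, mul_one]
  unfold radialPotential
  rw [integral_integral_swap hfint]
  refine integral_congr_ae ?_
  filter_upwards [ae_restrict_mem measurableSet_Ioc] with s hs
  exact integral_log_max_two_circles hr (hR0 s hs) c

lemma integrable_log_max_two_circles {R : ℝ → ℝ} (hR : Measurable R) (hR0 : ∀ s ∈ Set.Ioc (0 : ℝ) 1, 0 < R s)
    (hR1 : ∀ s ∈ Set.Ioc (0 : ℝ) 1, R s ≤ 1)
    {r : ℝ} (hr : 0 < r) (c : ℂ) :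
    Integrable (fun p : ℝ × ℂ => Real.log (max r ‖c - R p.1 * p.2‖))
      ((volume.restrict (Set.Ioc (0 : ℝ) 1)).prod circleUniform) := by
  refine Integrable.of_bound (C := r + (‖c‖ + 1) + |Real.log r|) (by fun_prop :
      Measurable fun p : ℝ × ℂ => Real.log (max r ‖c - R p.1 * p.2‖)).aestronglyMeasurable ?_
  have h1 : ∀ᵐ p ∂((volume.restrict (Set.Ioc (0 : ℝ) 1)).prod circleUniform), ‖p.2‖ = 1 :=
    Measure.quasiMeasurePreserving_snd.ae ae_circleUniform_norm
  have h2 : ∀ᵐ p ∂((volume.restrict (Set.Ioc (0 : ℝ) 1)).prod circleUniform),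
      p.1 ∈ Set.Ioc (0 : ℝ) 1 :=
    Measure.quasiMeasurePreserving_fst.ae (ae_restrict_mem measurableSet_Ioc)
  filter_upwards [h1, h2] with p hp1 hp2
  have hn : ‖c - R p.1 * p.2‖ ≤ ‖c‖ + 1 := by
    refine (norm_sub_le _ _).trans ?_
    rw [norm_mul, hp1, Complex.norm_real, Real.norm_of_nonneg (hR0 _ hp2).le, mul_one]
    linarith [hR1 _ hp2]
  have hpos : 0 < max r ‖c - R p.1 * p.2‖ := lt_max_of_lt_left hr
  have hup : Real.log (max r ‖c - R p.1 * p.2‖) ≤ r + (‖c‖ + 1) := by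
    have h3 := Real.log_le_sub_one_of_pos hpos
    have : max r ‖c - R p.1 * p.2‖ ≤ r + (‖c‖ + 1) :=
      max_le (by linarith [norm_nonneg c]) (by linarith)
    linarith
  have hlo : -|Real.log r| ≤ Real.log (max r ‖c - R p.1 * p.2‖) :=
    (neg_abs_le _).trans (Real.log_le_log hr (le_max_left _ _))
  rw [Real.norm_eq_abs, abs_le]
  constructor
  · linarith [norm_nonneg c]
  · linarith [abs_nonneg (Real.log r)]

/-- The analogue for the limit of `integral_logDiff_circleUniform`: the same averaging recovers
`radialMeasure R` from its potential, smeared by the kernel. -/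
lemma integral_radialPotential_sub {R : ℝ → ℝ} (hR : Measurable R) (hR0 : ∀ s ∈ Set.Ioc (0 : ℝ) 1, 0 < R s)
    (hR1 : ∀ s ∈ Set.Ioc (0 : ℝ) 1, R s ≤ 1)
    (hlog : IntegrableOn (fun s => Real.log (R s)) (Set.Ioc 0 1))
    {e : ℝ} (he : 0 < e) (c : ℂ) :
    ∫ x, (radialPotential R (c + (2 * e : ℝ) * x) - radialPotential R (c + e * x)) ∂circleUniform =
      ∫ w, bumpKernel e (c - w) ∂(radialMeasure R) := by
  have h2e : 0 < 2 * e := by linarith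
  have hm : Measurable fun w => bumpKernel e (c - w) :=
    (continuous_bumpKernel he).measurable.comp (by fun_prop)
  have hi := fun {r : ℝ} (hr : 0 < r) => integrable_log_max_two_circles hR hR0 hR1 hr c
  have hB : Integrable (fun p : ℝ × ℂ => bumpKernel e (c - R p.1 * p.2))
      ((volume.restrict (Set.Ioc (0 : ℝ) 1)).prod circleUniform) := (hi h2e).sub (hi he)
  rw [integral_sub (integrable_radialPotential_circle hR hR0 hR1 hlog h2e c)
    (integrable_radialPotential_circle hR hR0 hR1 hlog he c),
    integral_radialPotential_circle hR hR0 hR1 hlog h2e,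
    integral_radialPotential_circle hR hR0 hR1 hlog he, radialMeasure,
    integral_map (by fun_prop) hm.aestronglyMeasurable]
  rw [← integral_prod _ (hi h2e), ← integral_prod _ (hi he), ← integral_sub (hi h2e) (hi he)]
  rfl

lemma norm_radialPotential_sub_le {R : ℝ → ℝ} (hR : Measurable R) (hR0 : ∀ s ∈ Set.Ioc (0 : ℝ) 1, 0 < R s)
    (hR1 : ∀ s ∈ Set.Ioc (0 : ℝ) 1, R s ≤ 1)
    (hlog : IntegrableOn (fun s => Real.log (R s)) (Set.Ioc 0 1)) {e : ℝ} (he : 0 < e) (ρ : ℝ) :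
    ∀ᵐ y ∂(diskCircle ρ), ‖radialPotential R (y.1 + (2 * e : ℝ) * y.2) -
        radialPotential R (y.1 + e * y.2)‖ ≤
      (ρ + 2 * e + ∫ s in Set.Ioc (0 : ℝ) 1, |Real.log (R s)|) +
        (ρ + e + ∫ s in Set.Ioc (0 : ℝ) 1, |Real.log (R s)|) := by
  have hx : ∀ᵐ p ∂(diskCircle ρ), ‖p.2‖ = 1 :=
    Measure.quasiMeasurePreserving_snd.ae ae_circleUniform_norm
  have hc : ∀ᵐ p ∂(diskCircle ρ), p.1 ∈ Metric.ball (0 : ℂ) ρ :=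
    Measure.quasiMeasurePreserving_fst.ae (ae_restrict_mem measurableSet_ball)
  filter_upwards [hx, hc] with y hx hc
  have hc' : ‖y.1‖ < ρ := by simpa using hc
  have hb : ∀ r : ℝ, 0 < r → |radialPotential R (y.1 + r * y.2)| ≤
      ρ + r + ∫ s in Set.Ioc (0 : ℝ) 1, |Real.log (R s)| := by
    intro r hr
    refine (abs_radialPotential_le hR hR0 hR1 hlog _).trans ?_
    gcongr
    refine (norm_add_le _ _).trans ?_
    rw [norm_mul, hx, Complex.norm_real, Real.norm_of_nonneg hr.le, mul_one]
    linarith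
  exact (norm_sub_le _ _).trans (add_le_add (hb _ (by linarith)) (hb _ he))

lemma integral_mul_radialPotential_sub {R : ℝ → ℝ} (hR : Measurable R) (hR0 : ∀ s ∈ Set.Ioc (0 : ℝ) 1, 0 < R s)
    (hR1 : ∀ s ∈ Set.Ioc (0 : ℝ) 1, R s ≤ 1)
    (hlog : IntegrableOn (fun s => Real.log (R s)) (Set.Ioc 0 1))
    {e : ℝ} (he : 0 < e) (ρ : ℝ) {φ : ℂ → ℝ}
    (hφ : Measurable φ) {M : ℝ} (hM : ∀ z, |φ z| ≤ M) :
    Integrable (fun y : ℂ × ℂ => φ y.1 * (radialPotential R (y.1 + (2 * e : ℝ) * y.2) -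
        radialPotential R (y.1 + e * y.2))) (diskCircle ρ) ∧
    ∫ y, φ y.1 * (radialPotential R (y.1 + (2 * e : ℝ) * y.2) -
        radialPotential R (y.1 + e * y.2)) ∂(diskCircle ρ) =
      ∫ w, mollify e ρ φ w ∂(radialMeasure R) := by
  have hmU := measurable_radialPotential hR
  have hpt := norm_radialPotential_sub_le hR hR0 hR1 hlog he ρ
  have hfint : Integrable (fun y : ℂ × ℂ => φ y.1 * (radialPotential R (y.1 + (2 * e : ℝ) * y.2) -
        radialPotential R (y.1 + e * y.2))) (diskCircle ρ) := by
    refine Integrable.bdd_mul (Integrable.of_bound ?_ _ hpt)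
      (hφ.comp measurable_fst).aestronglyMeasurable (Eventually.of_forall fun y => hM y.1)
    exact ((hmU.comp (by fun_prop)).sub (hmU.comp (by fun_prop))).aestronglyMeasurable
  refine ⟨hfint, ?_⟩
  have := isProbabilityMeasure_radialMeasure hR
  unfold diskCircle at hfint ⊢
  rw [integral_prod _ hfint]
  simp only [integral_const_mul]
  have h1 : ∀ c : ℂ, φ c * ∫ x, (radialPotential R (c + (2 * e : ℝ) * x) -
      radialPotential R (c + e * x)) ∂circleUniform =
      ∫ w, φ c * bumpKernel e (c - w) ∂(radialMeasure R) := by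
    intro c
    rw [integral_radialPotential_sub hR hR0 hR1 hlog he c, integral_const_mul]
  simp only [h1]
  rw [integral_integral_swap]
  · rfl
  · refine Integrable.of_bound (C := M * Real.log 2) ?_ (Eventually.of_forall fun p => ?_)
    · exact ((hφ.comp measurable_fst).mul
        ((continuous_bumpKernel he).measurable.comp (by fun_prop))).aestronglyMeasurable
    · simp only [Function.uncurry, norm_mul]
      exact mul_le_mul (hM _) (abs_bumpKernel_le he _) (norm_nonneg _)
        ((abs_nonneg _).trans (hM p.1))

/-! ### From potentials to zeros -/

lemma integral_zeroMeasure (D : ℕ) (p : Polynomial ℂ) (φ : ℂ → ℝ) :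
    ∫ z, φ z ∂((D : ℝ≥0∞)⁻¹ • zeroMeasure p) = (D : ℝ)⁻¹ * (p.roots.map φ).sum := by
  have key : ∀ m : Multiset ℂ, Integrable φ (m.map fun z => Measure.dirac z).sum ∧
      ∫ z, φ z ∂(m.map fun z => Measure.dirac z).sum = (m.map φ).sum := by
    intro m
    induction m using Multiset.induction_on with
    | empty => simp
    | cons a m ih =>
      simp only [Multiset.map_cons, Multiset.sum_cons]
      have ha : Integrable φ (Measure.dirac a) := integrable_dirac (by finiteness)
      refine ⟨ha.add_measure ih.1, ?_⟩
      rw [integral_add_measure ha ih.1, ih.2, integral_dirac]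
  rw [integral_smul_measure, zeroMeasure, (key p.roots).2]
  simp

lemma abs_inv_mul_roots_sum_le {D : ℕ} {p : Polynomial ℂ} (hp : p.natDegree ≤ D) {f : ℂ → ℝ} {η : ℝ}
    (hη : 0 ≤ η) (hf : ∀ z, |f z| ≤ η) : |(D : ℝ)⁻¹ * (p.roots.map f).sum| ≤ η := by
  have key : ∀ m : Multiset ℂ, |(m.map f).sum| ≤ m.card * η := by
    intro m
    induction m using Multiset.induction_on with
    | empty => simp
    | cons a m ih =>
      simp only [Multiset.map_cons, Multiset.sum_cons, Multiset.card_cons, Nat.cast_add,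
        Nat.cast_one, add_mul, one_mul]
      exact (abs_add_le _ _).trans (by linarith [hf a])
  have hc : (p.roots.card : ℝ) ≤ D := by exact_mod_cast (Polynomial.card_roots' p).trans hp
  rw [abs_mul, abs_of_nonneg (by positivity : (0 : ℝ) ≤ (D : ℝ)⁻¹)]
  calc (D : ℝ)⁻¹ * |(p.roots.map f).sum| ≤ (D : ℝ)⁻¹ * (D * η) := by
        gcongr
        exact (key _).trans (by gcongr)
    _ = ((D : ℝ)⁻¹ * D) * η := by ring
    _ ≤ 1 * η := by
        gcongr
        -- Only an inequality, since D may be zero.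
        exact inv_mul_le_one
    _ = η := one_mul η

/-- Convergence in probability in almost every fibre, with a uniform bound for the second moments
in the fibres, implies convergence in mean. -/
lemma tendsto_lintegral_enorm_of_tendstoInMeasure {Ω X : Type*} [MeasurableSpace Ω]
    [MeasurableSpace X] {P : Measure Ω} [IsProbabilityMeasure P] {κ : Measure X} [IsFiniteMeasure κ]
    {d : ℕ → Ω × X → ℝ} (hd : ∀ n, Measurable (d n)) {C : ℝ≥0∞} (hC : C ≠ ⊤)
    (hb : ∀ n ω, ∫⁻ x, ‖d n (ω, x)‖ₑ ^ 2 ∂κ ≤ C)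
    (hconv : ∀ᵐ x ∂κ, TendstoInMeasure P (fun n ω => d n (ω, x)) atTop (fun _ => 0)) :
    Tendsto (fun n => ∫⁻ ω, ∫⁻ x, ‖d n (ω, x)‖ₑ ∂κ ∂P) atTop (𝓝 0) := by
  have hprod : ∀ δ : ℝ≥0∞, 0 < δ →
      Tendsto (fun n => (P.prod κ) {y | δ ≤ ‖d n y‖ₑ}) atTop (𝓝 0) := by
    intro δ hδ
    have hms : ∀ n, MeasurableSet {y | δ ≤ ‖d n y‖ₑ} := fun n =>
      measurableSet_le measurable_const (hd n).enorm
    have : ∀ n, (P.prod κ) {y | δ ≤ ‖d n y‖ₑ} = ∫⁻ x, P {ω | δ ≤ ‖d n (ω, x)‖ₑ} ∂κ :=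
      fun n => Measure.prod_apply_symm (hms n)
    simp only [this]
    rw [show (0 : ℝ≥0∞) = ∫⁻ _, 0 ∂κ by simp]
    refine tendsto_lintegral_of_dominated_convergence (fun _ => 1)
      (fun n => measurable_measure_prodMk_right (hms n))
      (fun n => Eventually.of_forall fun x => prob_le_one) (by simp) ?_
    filter_upwards [hconv] with x hx
    have := hx δ hδ
    simpa [edist_zero_right] using this
  have hd2 : ∀ n, ∫⁻ y, ‖d n y‖ₑ ^ 2 ∂(P.prod κ) ≤ C := by
    intro n
    rw [lintegral_prod _ (by fun_prop)]
    calc _ ≤ ∫⁻ _, C ∂P := lintegral_mono fun ω => hb n ω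
      _ = C := by simp
  have heq : ∀ n, ∫⁻ ω, ∫⁻ x, ‖d n (ω, x)‖ₑ ∂κ ∂P = ∫⁻ y, ‖d n y‖ₑ ∂(P.prod κ) :=
    fun n => (lintegral_prod _ (hd n).enorm.aemeasurable).symm
  simp only [heq]
  -- Values below δ, between δ and K, and above K are bounded by δ, by K on the exceptional set, and
  -- by d²/K respectively.
  have hbound : ∀ (δ K : ℝ≥0∞), 0 < K → K ≠ ⊤ → ∀ n, ∫⁻ y, ‖d n y‖ₑ ∂(P.prod κ) ≤
      δ * κ Set.univ + K * (P.prod κ) {y | δ ≤ ‖d n y‖ₑ} + K⁻¹ * C := by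
    intro δ K hK hKt n
    have hms : MeasurableSet {y | δ ≤ ‖d n y‖ₑ} := measurableSet_le measurable_const (hd n).enorm
    calc ∫⁻ y, ‖d n y‖ₑ ∂(P.prod κ)
        ≤ ∫⁻ y, (δ + {y | δ ≤ ‖d n y‖ₑ}.indicator (fun _ => K) y + K⁻¹ * ‖d n y‖ₑ ^ 2)
          ∂(P.prod κ) := by
          refine lintegral_mono fun y => ?_
          rcases lt_or_ge ‖d n y‖ₑ δ with h | h
          · exact h.le.trans (le_add_right le_self_add)
          · have hmem : y ∈ {y | δ ≤ ‖d n y‖ₑ} := h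
            rw [Set.indicator_of_mem hmem]
            rcases le_total ‖d n y‖ₑ K with h' | h'
            · exact h'.trans (le_add_right le_add_self)
            · refine le_add_left ?_
              rw [sq, ← mul_assoc]
              calc ‖d n y‖ₑ = 1 * ‖d n y‖ₑ := (one_mul _).symm
                _ = K⁻¹ * K * ‖d n y‖ₑ := by rw [ENNReal.inv_mul_cancel hK.ne' hKt]
                _ ≤ _ := by gcongr
      _ = δ * κ Set.univ + K * (P.prod κ) {y | δ ≤ ‖d n y‖ₑ} +
          K⁻¹ * ∫⁻ y, ‖d n y‖ₑ ^ 2 ∂(P.prod κ) := by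
          rw [lintegral_add_left (by exact measurable_const.add (measurable_const.indicator hms)),
            lintegral_add_left measurable_const, lintegral_const, lintegral_indicator_const hms,
            lintegral_const_mul _ (by fun_prop), ← Set.univ_prod_univ, Measure.prod_prod,
            measure_univ, one_mul]
      _ ≤ _ := by gcongr; exact hd2 n
  rw [ENNReal.tendsto_nhds_zero]
  intro ε hε
  rcases eq_or_ne ε ⊤ with rfl | hεt
  · exact Eventually.of_forall fun n => le_top
  have hε3 : 0 < ε / 3 := ENNReal.div_pos hε.ne' (by norm_num)
  have hε3t : ε / 3 ≠ ⊤ := ENNReal.div_ne_top hεt (by norm_num)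
  obtain ⟨δ, hδ, hδ'⟩ : ∃ δ : ℝ≥0∞, 0 < δ ∧ δ * κ Set.univ ≤ ε / 3 := by
    have hk : κ Set.univ + 1 ≠ ⊤ := by simp
    -- The added 1 avoids division by zero when κ has no mass; likewise for C below.
    refine ⟨(ε / 3) / (κ Set.univ + 1), ENNReal.div_pos hε3.ne' hk, ?_⟩
    calc _ ≤ (ε / 3) / (κ Set.univ + 1) * (κ Set.univ + 1) := by gcongr; exact le_self_add
      _ ≤ ε / 3 := (ENNReal.div_mul_cancel (by simp) hk).le
  obtain ⟨K, hK, hKt, hK'⟩ : ∃ K : ℝ≥0∞, 0 < K ∧ K ≠ ⊤ ∧ K⁻¹ * C ≤ ε / 3 := by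
    refine ⟨(C + 1) / (ε / 3), ENNReal.div_pos (by simp) hε3t,
      ENNReal.div_ne_top (by simp [hC]) hε3.ne', ?_⟩
    rw [ENNReal.inv_div (Or.inl hε3t) (Or.inl hε3.ne')]
    calc _ ≤ ε / 3 / (C + 1) * (C + 1) := by gcongr; exact le_self_add
      _ ≤ ε / 3 := (ENNReal.div_mul_cancel (by simp) (by simp [hC])).le
  have hlim : Tendsto (fun n => K * (P.prod κ) {y | δ ≤ ‖d n y‖ₑ}) atTop (𝓝 0) := by
    have := ENNReal.Tendsto.const_mul (a := K) (hprod δ hδ) (Or.inr hKt)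
    simpa using this
  filter_upwards [(ENNReal.tendsto_nhds_zero.1 hlim) (ε / 3) hε3] with n hn
  calc _ ≤ _ := hbound δ K hK hKt n
    _ ≤ ε / 3 + ε / 3 + ε / 3 := by gcongr
    _ = ε := ENNReal.add_thirds ε

lemma TendstoInMeasure.sub_of_const {Ω : Type*} [MeasurableSpace Ω] {P : Measure Ω}
    {f g : ℕ → Ω → ℝ} {a b : ℝ} (hf : TendstoInMeasure P f atTop fun _ => a)
    (hg : TendstoInMeasure P g atTop fun _ => b) :
    TendstoInMeasure P (fun n ω => (f n ω - g n ω) - (a - b)) atTop fun _ => 0 := by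
  rw [tendstoInMeasure_iff_norm] at hf hg ⊢
  intro ε hε
  have h := (hf (ε / 2) (by linarith)).add (hg (ε / 2) (by linarith))
  rw [add_zero] at h
  refine tendsto_of_tendsto_of_tendsto_of_le_of_le tendsto_const_nhds h (fun _ => zero_le) fun n => ?_
  refine (measure_mono ?_).trans (measure_union_le _ _)
  intro ω hω
  by_contra hcon
  simp only [Set.mem_union, Set.mem_ofPred_eq, not_or, not_le] at hcon hω
  have h3 : f n ω - g n ω - (a - b) - 0 = (f n ω - a) - (g n ω - b) := by ring
  rw [h3] at hω
  have := norm_sub_le (f n ω - a) (g n ω - b)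
  linarith [hcon.1, hcon.2]

/-- If the normalised logarithms of random polynomials converge in probability, at almost every
point, to the potential of a radial measure, then the normalised zero measures converge in
probability to that measure. -/
theorem tendstoInMeasure_integral_zeroMeasure {Ω : Type*} [MeasurableSpace Ω] {P : Measure Ω}
    [IsProbabilityMeasure P] {p : ℕ → Ω → Polynomial ℂ} {D : ℕ → ℕ}
    (hdeg : ∀ n ω, (p n ω).natDegree ≤ D n)
    (hmeas : ∀ n, Measurable fun y : Ω × ℂ => (p n y.1).eval y.2)
    {R : ℝ → ℝ} (hR : Measurable R) (hR0 : ∀ s ∈ Set.Ioc (0 : ℝ) 1, 0 < R s)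
    (hR1 : ∀ s ∈ Set.Ioc (0 : ℝ) 1, R s ≤ 1)
    (hlog : IntegrableOn (fun s => Real.log (R s)) (Set.Ioc 0 1)) (b : ℝ)
    (hconv : ∀ᵐ z : ℂ, TendstoInMeasure P
      (fun n ω => (D n : ℝ)⁻¹ * Real.log ‖(p n ω).eval z‖) atTop
      (fun _ => radialPotential R z + b))
    {φ : ℂ → ℝ} (hφ : Continuous φ) (hφc : HasCompactSupport φ) :
    TendstoInMeasure P (fun n ω => ∫ z, φ z ∂((D n : ℝ≥0∞)⁻¹ • zeroMeasure (p n ω))) atTop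
      (fun _ => ∫ z, φ z ∂(radialMeasure R)) := by
  have hprob := isProbabilityMeasure_radialMeasure hR
  obtain ⟨M, hM⟩ := hφ.bounded_above_of_compact_support hφc
  have hM0 : 0 ≤ M := (norm_nonneg _).trans (hM 0)
  obtain ⟨ρ, hρ⟩ : ∃ ρ : ℝ, Function.support φ ⊆ Metric.ball 0 ρ := by
    obtain ⟨ρ, hρ⟩ := hφc.isCompact.isBounded.subset_ball (0 : ℂ)
    exact ⟨ρ, (subset_tsupport φ).trans hρ⟩
  rw [tendstoInMeasure_iff_norm]
  intro δ hδ
  obtain ⟨e, he, hη⟩ : ∃ e : ℝ, 0 < e ∧ ∀ w y : ℂ, ‖y‖ ≤ 2 * e → |φ (y + w) - φ w| ≤ δ / 4 := by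
    obtain ⟨a, ha, h⟩ := Metric.uniformContinuous_iff.1
      (hφc.uniformContinuous_of_continuous hφ) (δ / 4) (by linarith)
    -- The kernel reaches distance 2e, so e = a/4 keeps displacements strictly below the modulus a.
    refine ⟨a / 4, by linarith, fun w y hy => ?_⟩
    have := h (a := y + w) (b := w) (by simp [dist_eq_norm]; linarith)
    rw [Real.dist_eq] at this
    exact this.le
  set m := ∫ y, bumpKernel e y with hm
  have hmpos : 0 < m := integral_bumpKernel_pos he
  set g : ℂ × ℂ → ℝ := fun y => radialPotential R (y.1 + (2 * e : ℝ) * y.2) -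
    radialPotential R (y.1 + e * y.2) with hg
  have hmU := measurable_radialPotential hR
  have hgm : Measurable g := (hmU.comp (by fun_prop)).sub (hmU.comp (by fun_prop))
  -- The discrepancy between the polynomial and the limit. Being a difference over two sampling
  -- points, it does not involve the unknown constant b.
  set d : ℕ → Ω × (ℂ × ℂ) → ℝ := fun n y => (D n : ℝ)⁻¹ * polyLogDiff e (p n y.1) y.2 - g y.2 with hd
  have hdm : ∀ n, Measurable (d n) := by
    intro n
    have h1 : ∀ t : ℂ, Measurable fun y : Ω × (ℂ × ℂ) =>
        Real.log ‖(p n y.1).eval (y.2.1 + t * y.2.2)‖ := fun t =>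
      Real.measurable_log.comp ((hmeas n).comp (by fun_prop :
        Measurable fun y : Ω × (ℂ × ℂ) => (y.1, y.2.1 + t * y.2.2))).norm
    exact (measurable_const.mul ((h1 _).sub (h1 _))).sub (hgm.comp measurable_snd)
  obtain ⟨hgi, hgv⟩ := integral_mul_radialPotential_sub hR hR0 hR1 hlog he ρ hφ.measurable hM
  obtain ⟨C, hC, hCb⟩ := eLpNorm_logDiff_le ρ he
  have hgL2 : eLpNorm g 2 (diskCircle ρ) ≠ ⊤ := by
    have hpt := norm_radialPotential_sub_le hR hR0 hR1 hlog he ρ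
    exact (MemLp.of_bound hgm.aestronglyMeasurable _ hpt).2.ne
  have hpoly : ∀ n ω, eLpNorm (fun y => (D n : ℝ)⁻¹ * polyLogDiff e (p n ω) y) 2 (diskCircle ρ)
      ≤ C := by
    intro n ω
    have h1 : eLpNorm (polyLogDiff e (p n ω)) 2 (diskCircle ρ) ≤ D n * C := by
      rw [eLpNorm_congr_ae (polyLogDiff_ae_eq ρ e (p n ω))]
      refine (eLpNorm_multiset_sum_le (fun w => (measurable_logDiff e w).aestronglyMeasurable) hCb
        (p n ω).roots).trans ?_
      gcongr
      exact_mod_cast (Polynomial.card_roots' _).trans (hdeg n ω)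
    have h2 : (fun y => (D n : ℝ)⁻¹ * polyLogDiff e (p n ω) y) =
      (D n : ℝ)⁻¹ • polyLogDiff e (p n ω) := rfl
    rw [h2, eLpNorm_const_smul]
    rcases Nat.eq_zero_or_pos (D n) with h0 | h0
    · simp [h0]
    calc ‖(D n : ℝ)⁻¹‖ₑ * eLpNorm (polyLogDiff e (p n ω)) 2 (diskCircle ρ)
        ≤ ‖(D n : ℝ)⁻¹‖ₑ * (D n * C) := by gcongr
      _ = C := by
        rw [enorm_inv (by positivity), ← mul_assoc]
        have : ‖(D n : ℝ)‖ₑ = D n := by simp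
        rw [this, ENNReal.inv_mul_cancel (by exact_mod_cast h0.ne') (by simp), one_mul]
  have hb : ∀ n ω, ∫⁻ y, ‖d n (ω, y)‖ₑ ^ 2 ∂(diskCircle ρ) ≤
      (C + eLpNorm g 2 (diskCircle ρ)) ^ 2 := by
    intro n ω
    have hmd : Measurable fun y => (D n : ℝ)⁻¹ * polyLogDiff e (p n ω) y := by
      have h1 : Measurable fun y => d n (ω, y) + g y :=
        ((hdm n).comp measurable_prodMk_left).add hgm
      simpa [hd] using h1
    have h1 : eLpNorm (fun y => d n (ω, y)) 2 (diskCircle ρ) ≤ C + eLpNorm g 2 (diskCircle ρ) :=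
      (eLpNorm_sub_le hmd.aestronglyMeasurable hgm.aestronglyMeasurable (by norm_num)).trans
        (by gcongr; exact hpoly n ω)
    rw [eLpNorm_eq_lintegral_rpow_enorm_toReal (by norm_num) (by norm_num)] at h1
    simp only [ENNReal.toReal_ofNat, ENNReal.rpow_ofNat] at h1
    calc _ = ((∫⁻ y, ‖d n (ω, y)‖ₑ ^ 2 ∂(diskCircle ρ)) ^ (1 / 2 : ℝ)) ^ 2 := by
          rw [← ENNReal.rpow_natCast, ← ENNReal.rpow_mul]; simp
      _ ≤ _ := by gcongr
  have hcv : ∀ᵐ y ∂(diskCircle ρ), TendstoInMeasure P (fun n ω => d n (ω, y)) atTop fun _ => 0 := by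
    filter_upwards [(quasiMeasurePreserving_add_mul ρ (2 * e : ℝ)).ae hconv,
      (quasiMeasurePreserving_add_mul ρ e).ae hconv] with y h1 h2
    have h3 := TendstoInMeasure.sub_of_const h1 h2
    refine h3.congr_left fun n => Eventually.of_forall fun ω => ?_
    simp only [hd, hg, polyLogDiff]
    ring
  have hL1 := tendsto_lintegral_enorm_of_tendstoInMeasure hdm
    (ENNReal.pow_ne_top (ENNReal.add_ne_top.2 ⟨hC, hgL2⟩)) hb hcv
  -- Replacing φ by its normalised mollification costs δ/4 on each side; what remains is φ tested
  -- against d, divided by the kernel mass m.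
  have hcmp : ∀ n ω, ‖(∫ z, φ z ∂((D n : ℝ≥0∞)⁻¹ • zeroMeasure (p n ω))) -
      ∫ z, φ z ∂(radialMeasure R)‖ₑ ≤ ENNReal.ofReal (δ / 2) +
        ENNReal.ofReal (M / m) * ∫⁻ y, ‖d n (ω, y)‖ₑ ∂(diskCircle ρ) := by
    intro n ω
    have hpi : Integrable (fun y : ℂ × ℂ => φ y.1 * ((D n : ℝ)⁻¹ * polyLogDiff e (p n ω) y))
        (diskCircle ρ) := by
      have hmd : Measurable fun y => (D n : ℝ)⁻¹ * polyLogDiff e (p n ω) y := by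
        have h1 : Measurable fun y => d n (ω, y) + g y :=
          ((hdm n).comp measurable_prodMk_left).add hgm
        simpa [hd] using h1
      have : MemLp (fun y => (D n : ℝ)⁻¹ * polyLogDiff e (p n ω) y) 2 (diskCircle ρ) :=
        ⟨hmd.aestronglyMeasurable, (hpoly n ω).trans_lt hC.lt_top⟩
      exact (this.integrable (by norm_num)).bdd_mul
        (hφ.measurable.comp measurable_fst).aestronglyMeasurable
        (Eventually.of_forall fun y => hM y.1)
    have hA : ∫ y, φ y.1 * ((D n : ℝ)⁻¹ * polyLogDiff e (p n ω) y) ∂(diskCircle ρ) =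
        (D n : ℝ)⁻¹ * ((p n ω).roots.map (mollify e ρ φ)).sum := by
      rw [← integral_mul_polyLogDiff he ρ hφ.measurable hM (p n ω), ← integral_const_mul]
      refine integral_congr_ae (Eventually.of_forall fun y => ?_)
      simp only
      ring
    have hdiff : (D n : ℝ)⁻¹ * ((p n ω).roots.map (mollify e ρ φ)).sum -
        ∫ w, mollify e ρ φ w ∂(radialMeasure R) = ∫ y, φ y.1 * d n (ω, y) ∂(diskCircle ρ) := by
      rw [← hA, ← hgv, ← integral_sub hpi hgi]
      refine integral_congr_ae (Eventually.of_forall fun y => ?_)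
      simp only [hd, hg]
      ring
    have herr := abs_mollify_sub_le he hφ hρ hη
    have hδ4 : ∀ w, |φ w - m⁻¹ * mollify e ρ φ w| ≤ δ / 4 := by
      intro w
      have h1 : φ w - m⁻¹ * mollify e ρ φ w = -(m⁻¹ * (mollify e ρ φ w - m * φ w)) := by
        field_simp
        ring
      rw [h1, abs_neg, abs_mul, abs_of_pos (inv_pos.2 hmpos)]
      calc m⁻¹ * |mollify e ρ φ w - m * φ w| ≤ m⁻¹ * (m * (δ / 4)) := by
            gcongr
            exact herr w
        _ = δ / 4 := by field_simp
    have hB : |(D n : ℝ)⁻¹ * ((p n ω).roots.map φ).sum -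
        m⁻¹ * ((D n : ℝ)⁻¹ * ((p n ω).roots.map (mollify e ρ φ)).sum)| ≤ δ / 4 := by
      have h1 := abs_inv_mul_roots_sum_le (hdeg n ω) (by linarith) hδ4
      simp only [Multiset.sum_map_sub, Multiset.sum_map_mul_left] at h1
      refine le_trans (le_of_eq ?_) h1
      congr 1
      ring
    have hmi : Integrable (mollify e ρ φ) (radialMeasure R) :=
      Integrable.of_bound (continuous_mollify he ρ hφ.measurable hM).aestronglyMeasurable _
        (Eventually.of_forall fun w => abs_mollify_le he ρ hM w)
    have hφi : Integrable φ (radialMeasure R) :=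
      Integrable.of_bound hφ.aestronglyMeasurable _ (Eventually.of_forall hM)
    have hE : |∫ w, φ w ∂(radialMeasure R) - m⁻¹ * ∫ w, mollify e ρ φ w ∂(radialMeasure R)|
        ≤ δ / 4 := by
      rw [← integral_const_mul, ← integral_sub hφi (hmi.const_mul _)]
      have := norm_integral_le_of_norm_le_const (μ := radialMeasure R)
        (Eventually.of_forall hδ4 : ∀ᵐ w ∂(radialMeasure R),
          ‖φ w - m⁻¹ * mollify e ρ φ w‖ ≤ δ / 4)
      simpa using this
    have hF : ‖∫ y, φ y.1 * d n (ω, y) ∂(diskCircle ρ)‖ₑ ≤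
        ENNReal.ofReal M * ∫⁻ y, ‖d n (ω, y)‖ₑ ∂(diskCircle ρ) := by
      refine (enorm_integral_le_lintegral_enorm _).trans ?_
      rw [← lintegral_const_mul _ (by exact ((hdm n).comp measurable_prodMk_left).enorm)]
      refine lintegral_mono fun y => ?_
      rw [enorm_mul]
      gcongr
      rw [← ofReal_norm]
      exact ENNReal.ofReal_le_ofReal (hM _)
    rw [integral_zeroMeasure]
    set A := (D n : ℝ)⁻¹ * ((p n ω).roots.map φ).sum
    set B := (D n : ℝ)⁻¹ * ((p n ω).roots.map (mollify e ρ φ)).sum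
    set A' := ∫ w, φ w ∂(radialMeasure R)
    set B' := ∫ w, mollify e ρ φ w ∂(radialMeasure R)
    have hAA : A - A' = ((A - m⁻¹ * B) - (A' - m⁻¹ * B')) + m⁻¹ * (B - B') := by ring
    rw [hAA]
    refine (enorm_add_le _ _).trans (add_le_add ?_ ?_)
    · rw [← ofReal_norm]
      refine ENNReal.ofReal_le_ofReal ((norm_sub_le _ _).trans ?_)
      rw [Real.norm_eq_abs, Real.norm_eq_abs]
      linarith
    · rw [enorm_mul, hdiff, div_eq_inv_mul, ENNReal.ofReal_mul (by positivity), mul_assoc]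
      gcongr
      rw [← ofReal_norm, Real.norm_of_nonneg (by positivity)]
  have hδ2 : 0 < ENNReal.ofReal (δ / 2) := ENNReal.ofReal_pos.2 (by linarith)
  have hlim : Tendsto (fun n => (ENNReal.ofReal (M / m) *
      ∫⁻ ω, ∫⁻ y, ‖d n (ω, y)‖ₑ ∂(diskCircle ρ) ∂P) / ENNReal.ofReal (δ / 2)) atTop (𝓝 0) := by
    have h1 := ENNReal.Tendsto.const_mul (a := ENNReal.ofReal (M / m)) hL1
      (Or.inr ENNReal.ofReal_ne_top)
    have h2 := ENNReal.Tendsto.div_const h1 (b := ENNReal.ofReal (δ / 2)) (Or.inr hδ2.ne')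
    simpa using h2
  refine tendsto_of_tendsto_of_tendsto_of_le_of_le tendsto_const_nhds hlim (fun _ => zero_le)
    fun n => ?_
  have hmi : Measurable fun ω => ∫⁻ y, ‖d n (ω, y)‖ₑ ∂(diskCircle ρ) :=
    (hdm n).enorm.lintegral_prod_right'
  rw [← lintegral_const_mul _ hmi]
  -- Markov's inequality: a deviation of at least δ forces the random term of `hcmp` to be at least
  -- δ/2.
  refine le_trans (measure_mono ?_) (meas_ge_le_lintegral_div (hmi.const_mul _).aemeasurable
    hδ2.ne' ENNReal.ofReal_ne_top)
  intro ω hω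
  simp only [Set.mem_ofPred_eq] at hω ⊢
  have h1 := hcmp n ω
  have h2 : ENNReal.ofReal (δ / 2) + ENNReal.ofReal (δ / 2) ≤ ENNReal.ofReal (δ / 2) +
      ENNReal.ofReal (M / m) * ∫⁻ y, ‖d n (ω, y)‖ₑ ∂(diskCircle ρ) := by
    refine le_trans ?_ h1
    rw [← ENNReal.ofReal_add (by linarith) (by linarith), add_halves, ← ofReal_norm]
    exact ENNReal.ofReal_le_ofReal hω
  exact (ENNReal.add_le_add_iff_left ENNReal.ofReal_ne_top).1 h2

/-! ### Anticoncentration -/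

/-- The support of a nondegenerate law has two distinct points, and a sufficiently small ball misses
a fixed neighbourhood of one of them. -/
lemma exists_concentration_lt_one {Ω : Type*} [MeasurableSpace Ω] {P : Measure Ω}
    [IsProbabilityMeasure P] {X : Ω → ℂ} (hX : Measurable X)
    (hnd : ¬ ∃ c : ℂ, ∀ᵐ ω ∂P, X ω = c) :
    ∃ τ : ℝ, 0 < τ ∧ ∃ q : ℝ≥0∞, q < 1 ∧ ∀ x, (P.map X) (Metric.closedBall x τ) ≤ q := by
  set ν := P.map X with hν
  have : IsProbabilityMeasure ν := Measure.isProbabilityMeasure_map hX.aemeasurable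
  obtain ⟨x₀, hx₀⟩ := Measure.nonempty_support (IsProbabilityMeasure.ne_zero ν)
  obtain ⟨y₀, hy₀, hne⟩ : ∃ y₀ ∈ ν.support, y₀ ≠ x₀ := by
    by_contra hcon
    push Not at hcon
    refine hnd ⟨x₀, ?_⟩
    have h1 : ∀ᵐ y ∂ν, y = x₀ := by
      filter_upwards [Measure.support_mem_ae (μ := ν)] with y hy using hcon y hy
    exact ae_of_ae_map hX.aemeasurable h1
  set d := dist y₀ x₀ with hd
  have hd0 : 0 < d := dist_pos.2 hne
  have hpos : ∀ x ∈ ν.support, 0 < ν (Metric.ball x (d / 4)) := fun x hx =>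
    (Measure.mem_support_iff_forall x).1 hx _ (Metric.ball_mem_nhds x (by linarith))
  set p := min (ν (Metric.ball x₀ (d / 4))) (ν (Metric.ball y₀ (d / 4))) with hp
  have hp0 : 0 < p := lt_min (hpos _ hx₀) (hpos _ hy₀)
  -- A closed ball of radius d/8 meeting both balls of radius d/4 would put x₀ and y₀ within 3d/4 of
  -- each other.
  refine ⟨d / 8, by linarith, 1 - p, ENNReal.sub_lt_self ENNReal.one_ne_top one_ne_zero hp0.ne',
    fun x => ?_⟩
  have key : ∀ z, Disjoint (Metric.closedBall x (d / 8)) (Metric.ball z (d / 4)) →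
      ν (Metric.closedBall x (d / 8)) ≤ 1 - ν (Metric.ball z (d / 4)) := by
    intro z hz
    rw [← prob_compl_eq_one_sub measurableSet_ball]
    exact measure_mono hz.subset_compl_right
  by_cases h : Disjoint (Metric.closedBall x (d / 8)) (Metric.ball x₀ (d / 4))
  · exact (key _ h).trans (tsub_le_tsub_left (min_le_left _ _) _)
  · refine (key y₀ ?_).trans (tsub_le_tsub_left (min_le_right _ _) _)
    obtain ⟨a, ha1, ha2⟩ := Set.not_disjoint_iff.1 h
    rw [Set.disjoint_left]
    intro c hc1 hc2
    simp only [Metric.mem_closedBall, Metric.mem_ball] at ha1 ha2 hc1 hc2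
    have h1 := dist_triangle4 y₀ c a x₀
    have h2 := dist_triangle_right c a x
    rw [dist_comm y₀ c] at h1
    linarith

/-- Given m, the event confines X to the ball of radius τ around -W/b, which has probability at most
q. -/
lemma measure_concentration_inter_le {Ω : Type*} {m : MeasurableSpace Ω} [m₀ : MeasurableSpace Ω]
    {P : Measure Ω} [IsProbabilityMeasure P] {X W : Ω → ℂ} (hX : Measurable X) (hm : m ≤ m₀)
    (hind : Indep (MeasurableSpace.comap X inferInstance) m P) (hW : Measurable[m] W) {B : Set Ω}
    (hB : MeasurableSet[m] B) {τ : ℝ} {q : ℝ≥0∞}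
    (hq : ∀ x, (P.map X) (Metric.closedBall x τ) ≤ q) {b : ℂ} (hb : b ≠ 0) :
    P ({ω | ‖b * X ω + W ω‖ ≤ τ * ‖b‖} ∩ B) ≤ q * P B := by
  -- Packing the indicator of B with W makes the conditioning an ordinary Fubini argument for the
  -- product law of X and Z.
  set Z : Ω → ℂ × ℝ := fun ω => (W ω, B.indicator (fun _ => (1 : ℝ)) ω) with hZ
  have hZm : Measurable[m] Z := hW.prodMk (measurable_const.indicator hB)
  have hZ0 : Measurable Z := hZm.mono hm le_rfl
  have hXZ : IndepFun X Z P := by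
    rw [IndepFun_iff_Indep]
    exact indep_of_indep_of_le_right hind hZm.comap_le
  have hmap := (indepFun_iff_map_prod_eq_prod_map_map hX.aemeasurable hZ0.aemeasurable).1 hXZ
  have hS₁ : MeasurableSet {y : ℂ × (ℂ × ℝ) | ‖b * y.1 + y.2.1‖ ≤ τ * ‖b‖} :=
    measurableSet_le (by fun_prop) (by fun_prop)
  have hS₂ : MeasurableSet {y : ℂ × (ℂ × ℝ) | y.2.2 = 1} :=
    measurableSet_eq_fun (by fun_prop) (by fun_prop)
  have hS : MeasurableSet {y : ℂ × (ℂ × ℝ) | ‖b * y.1 + y.2.1‖ ≤ τ * ‖b‖ ∧ y.2.2 = 1} :=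
    hS₁.inter hS₂
  have hT : MeasurableSet {z : ℂ × ℝ | z.2 = 1} := measurableSet_eq_fun (by fun_prop) (by fun_prop)
  have hBe : Z ⁻¹' {z : ℂ × ℝ | z.2 = 1} = B := by
    ext ω
    by_cases h : ω ∈ B <;> simp [hZ, h]
  have hev : {ω | ‖b * X ω + W ω‖ ≤ τ * ‖b‖} ∩ B =
      (fun ω => (X ω, Z ω)) ⁻¹' {y : ℂ × (ℂ × ℝ) | ‖b * y.1 + y.2.1‖ ≤ τ * ‖b‖ ∧ y.2.2 = 1} := by
    ext ω
    by_cases h : ω ∈ B <;> simp [hZ, h]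
  have hX1 : IsProbabilityMeasure (P.map X) := Measure.isProbabilityMeasure_map hX.aemeasurable
  have hZ1 : IsProbabilityMeasure (P.map Z) := Measure.isProbabilityMeasure_map hZ0.aemeasurable
  rw [hev, ← Measure.map_apply (hX.prodMk hZ0) hS, hmap, Measure.prod_apply_symm hS]
  calc _ ≤ ∫⁻ z, {z : ℂ × ℝ | z.2 = 1}.indicator (fun _ => q) z ∂(P.map Z) := by
        refine lintegral_mono fun z => ?_
        by_cases h : z.2 = 1
        · rw [Set.indicator_of_mem (by exact h)]
          refine (measure_mono ?_).trans (hq (-(z.1 / b)))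
          rintro x ⟨hx, -⟩
          simp only at hx
          rw [Metric.mem_closedBall, dist_eq_norm]
          have h1 : b * x + z.1 = b * (x - -(z.1 / b)) := by field_simp; ring
          rw [h1, norm_mul, mul_comm] at hx
          exact le_of_mul_le_mul_right hx (norm_pos_iff.2 hb)
        · rw [Set.indicator_of_notMem (by exact h)]
          simp [h]
    _ = q * P B := by
        rw [lintegral_indicator_const hT, Measure.map_apply hZ0 hT, hBe]

/-- Nested partial sums of independent variables, each new summand of which is spread out, are all
small with geometrically small probability. -/
lemma measure_forall_norm_sum_le {Ω : Type*} [m₀ : MeasurableSpace Ω] {P : Measure Ω}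
    [IsProbabilityMeasure P] {X : ℕ → Ω → ℂ} (hX : ∀ i, Measurable (X i)) (hind : iIndepFun X P)
    {τ : ℝ} {q : ℝ≥0∞} (hq : ∀ i x, (P.map (X i)) (Metric.closedBall x τ) ≤ q) {b : ℕ → ℂ}
    {k : ℕ → ℕ} {T : ℕ → Finset ℕ} {M : ℕ} (hT : ∀ j < M, T (j + 1) = insert (k j) (T j))
    (hk : ∀ j < M, k j ∉ T j) (hb : ∀ j < M, b (k j) ≠ 0) :
    P {ω | ∀ j < M, ‖∑ i ∈ T (j + 1), b i * X i ω‖ ≤ τ * ‖b (k j)‖} ≤ q ^ M := by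
  set F : Finset ℕ → MeasurableSpace Ω := fun S =>
    ⨆ i ∈ (S : Set ℕ), MeasurableSpace.comap (X i) inferInstance with hF
  have hFmono : ∀ {S S' : Finset ℕ}, S ⊆ S' → F S ≤ F S' := fun h =>
    biSup_mono fun i hi => h hi
  have hsum : ∀ S : Finset ℕ, Measurable[F S] fun ω => ∑ i ∈ S, b i * X i ω := by
    intro S
    refine Finset.measurable_fun_sum S fun i hi => ?_
    refine Measurable.const_mul (Measurable.mono (comap_measurable (X i)) ?_ le_rfl) _
    exact le_iSup₂_of_le i (by exact_mod_cast hi) le_rfl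
  have hle : ∀ S, F S ≤ m₀ := fun S => iSup₂_le fun i _ => (hX i).comap_le
  have hTmono : ∀ l ≤ M, ∀ j ≤ l, T j ⊆ T l := by
    intro l
    induction l with
    | zero => intro _ j hj; rw [Nat.le_zero.1 hj]
    | succ l ih =>
      intro hl j hj
      rcases Nat.lt_or_ge j (l + 1) with h | h
      · refine (ih (by omega) j (by omega)).trans ?_
        rw [hT l (by omega)]
        exact Finset.subset_insert _ _
      · rw [le_antisymm hj h]
  suffices h : ∀ l ≤ M, P {ω | ∀ j < l, ‖∑ i ∈ T (j + 1), b i * X i ω‖ ≤ τ * ‖b (k j)‖} ≤ q ^ l from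
    h M le_rfl
  intro l
  induction l with
  | zero => simp
  | succ l ih =>
    intro hl
    have hBm : MeasurableSet[F (T l)]
        {ω | ∀ j < l, ‖∑ i ∈ T (j + 1), b i * X i ω‖ ≤ τ * ‖b (k j)‖} := by
      have : {ω | ∀ j < l, ‖∑ i ∈ T (j + 1), b i * X i ω‖ ≤ τ * ‖b (k j)‖} =
          ⋂ j ∈ Set.Iio l, {ω | ‖∑ i ∈ T (j + 1), b i * X i ω‖ ≤ τ * ‖b (k j)‖} := by
        ext; simp
      rw [this]
      refine MeasurableSet.biInter (Set.to_countable _) fun j hj => ?_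
      have hj' : j < l := hj
      have := hsum (T (j + 1))
      refine hFmono (hTmono l (by omega) (j + 1) (by omega)) _ ?_
      exact measurableSet_le (@Measurable.norm _ _ _ _ _ (F (T (j + 1))) _ this)
        measurable_const
    -- The earlier conditions only involve variables indexed by `T l`, and the new index `k l` lies
    -- outside it.
    have hindep : Indep (MeasurableSpace.comap (X (k l)) inferInstance) (F (T l)) P := by
      have := indep_iSup_of_disjoint (fun i => (hX i).comap_le) hind.iIndep
        (S := {k l}) (T := (T l : Set ℕ)) (by simpa using hk l (by omega))
      simpa only [Set.mem_singleton_iff, iSup_iSup_eq_left] using this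
    have hstep := measure_concentration_inter_le (hX (k l)) (hle (T l)) hindep (hsum (T l)) hBm
      (hq (k l)) (hb l (by omega))
    calc _ ≤ P ({ω | ‖b (k l) * X (k l) ω + ∑ i ∈ T l, b i * X i ω‖ ≤ τ * ‖b (k l)‖} ∩
          {ω | ∀ j < l, ‖∑ i ∈ T (j + 1), b i * X i ω‖ ≤ τ * ‖b (k j)‖}) := by
          refine measure_mono fun ω hω => ⟨?_, fun j hj => hω j (by omega)⟩
          have := hω l (by omega)
          rwa [hT l (by omega), Finset.sum_insert (hk l (by omega))] at this
      _ ≤ q * q ^ l := hstep.trans (by gcongr; exact ih (by omega))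
      _ = q ^ (l + 1) := by rw [pow_succ, mul_comm]

/-- A sum of independent spread out variables with a lacunary family of `M` coefficients among its
coefficients is rarely small. -/
lemma measure_norm_sum_le_pow {Ω : Type*} [m₀ : MeasurableSpace Ω] {P : Measure Ω}
    [IsProbabilityMeasure P] {X : ℕ → Ω → ℂ} (hX : ∀ i, Measurable (X i)) (hind : iIndepFun X P)
    {τ : ℝ} {q : ℝ≥0∞} (hq : ∀ i x, (P.map (X i)) (Metric.closedBall x τ) ≤ q) {b : ℕ → ℂ}
    {S : Finset ℕ} {k : ℕ → ℕ} {M : ℕ} (hkS : ∀ i < M, k i ∈ S)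
    (hkinj : ∀ i < M, ∀ j < M, k i = k j → i = j) (hb : ∀ i < M, b (k i) ≠ 0) {A L : ℝ}
    (hlac : ∀ j < M, A + L * ∑ i ∈ Finset.Ico (j + 1) M, ‖b (k i)‖ ≤ τ * ‖b (k j)‖) :
    P {ω | ‖∑ i ∈ S, b i * X i ω‖ ≤ A ∧ ∀ i ∈ S, ‖X i ω‖ ≤ L} ≤ q ^ M := by
  -- All unselected variables are revealed first, then k 0, k 1, and so on. The sum over `T (j + 1)`
  -- is the full sum minus the terms selected later, which lacunarity makes small.
  set T : ℕ → Finset ℕ := fun j => S \ (Finset.Ico j M).image k with hTdef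
  have himg : ∀ j < M, (Finset.Ico j M).image k = insert (k j) ((Finset.Ico (j + 1) M).image k) := by
    intro j hj
    rw [← Finset.insert_Ico_add_one_left_eq_Ico hj, Finset.image_insert]
  have hnot : ∀ j < M, k j ∉ (Finset.Ico (j + 1) M).image k := by
    intro j hj hmem
    obtain ⟨i, hi, hij⟩ := Finset.mem_image.1 hmem
    rw [Finset.mem_Ico] at hi
    have := hkinj i hi.2 j hj hij
    omega
  have hT : ∀ j < M, T (j + 1) = insert (k j) (T j) := by
    intro j hj
    ext x
    simp only [hTdef, himg j hj, Finset.mem_sdiff, Finset.mem_insert]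
    constructor
    · rintro ⟨h1, h2⟩
      by_cases hx : x = k j
      · exact Or.inl hx
      · exact Or.inr ⟨h1, by tauto⟩
    · rintro (rfl | ⟨h1, h2⟩)
      · exact ⟨hkS j hj, hnot j hj⟩
      · exact ⟨h1, by tauto⟩
  have hk : ∀ j < M, k j ∉ T j := by
    intro j hj
    simp [hTdef, himg j hj]
  refine (measure_mono ?_).trans (measure_forall_norm_sum_le hX hind hq hT hk hb)
  rintro ω ⟨h1, h2⟩ j hj
  have hsub : (Finset.Ico (j + 1) M).image k ⊆ S := by
    intro x hx
    obtain ⟨i, hi, rfl⟩ := Finset.mem_image.1 hx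
    exact hkS i (Finset.mem_Ico.1 hi).2
  have hsplit : ∑ i ∈ T (j + 1), b i * X i ω = ∑ i ∈ S, b i * X i ω -
      ∑ i ∈ Finset.Ico (j + 1) M, b (k i) * X (k i) ω := by
    rw [eq_sub_iff_add_eq, ← Finset.sum_sdiff hsub]
    congr 1
    rw [Finset.sum_image]
    intro i hi i' hi' h
    simp only [Finset.coe_Ico, Set.mem_Ico] at hi hi'
    exact hkinj i hi.2 i' hi'.2 h
  rw [hsplit]
  refine (norm_sub_le _ _).trans (le_trans (add_le_add h1 ?_) (hlac j hj))
  refine (norm_sum_le _ _).trans ?_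
  rw [Finset.mul_sum]
  refine Finset.sum_le_sum fun i hi => ?_
  rw [norm_mul, mul_comm]
  gcongr
  exact h2 _ (hkS i (Finset.mem_Ico.1 hi).2)

/-- `x P(Y ≥ x) → 0` for integrable `Y`. -/
lemma tendsto_mul_measure_ge {Ω : Type*} [MeasurableSpace Ω] {P : Measure Ω}
    {Y : Ω → ℝ} (hYm : Measurable Y) (hY : Integrable Y P) {c : ℕ → ℝ}
    (hc : Tendsto c atTop atTop) :
    Tendsto (fun n => ENNReal.ofReal (c n) * P {ω | c n ≤ Y ω}) atTop (𝓝 0) := by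
  have hms : ∀ n, MeasurableSet {ω | c n ≤ Y ω} := fun n => measurableSet_le measurable_const hYm
  have hlim : Tendsto (fun n => ∫⁻ ω, {ω | c n ≤ Y ω}.indicator (fun ω => ‖Y ω‖ₑ) ω ∂P)
      atTop (𝓝 0) := by
    rw [show (0 : ℝ≥0∞) = ∫⁻ _, 0 ∂P by simp]
    refine tendsto_lintegral_of_dominated_convergence (fun ω => ‖Y ω‖ₑ)
      (fun n => hYm.enorm.indicator (hms n))
      (fun n => Eventually.of_forall fun ω => Set.indicator_le_self _ _ _) hY.2.ne ?_
    refine Eventually.of_forall fun ω => ?_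
    refine tendsto_const_nhds.congr' ?_
    filter_upwards [hc.eventually_gt_atTop (Y ω)] with n hn
    rw [Set.indicator_of_notMem (by simpa using hn)]
  refine tendsto_of_tendsto_of_tendsto_of_le_of_le tendsto_const_nhds hlim (fun _ => zero_le)
    fun n => ?_
  rw [← lintegral_indicator_const (hms n)]
  refine lintegral_mono fun ω => ?_
  refine Set.indicator_le_indicator' fun hω => ?_
  rw [← ofReal_norm]
  exact ENNReal.ofReal_le_ofReal (le_trans hω (le_abs_self _))

/-- A union bound over D+1 variables: integrability of Y = log(1+|ξ|) gives P(Y ≥ δD) = o(1/D). -/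
lemma tendsto_measure_exists_norm_gt {Ω : Type*} [MeasurableSpace Ω] {P : Measure Ω}
    [IsProbabilityMeasure P] {ξ : ℕ → Ω → ℂ} (hmeas : ∀ k, Measurable (ξ k))
    (hident : ∀ k, IdentDistrib (ξ k) (ξ 0) P P)
    (hlog : Integrable (fun ω => Real.log (1 + ‖ξ 0 ω‖)) P)
    (N D : ℕ → ℕ) (hDtop : Tendsto D atTop atTop) {δ : ℝ} (hδ : 0 < δ) :
    Tendsto (fun n => P {ω | ∃ k ≤ D n, Real.exp (δ * D n) < ‖ξ (N n + k) ω‖}) atTop (𝓝 0) := by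
  have hc : Tendsto (fun n => δ * (D n : ℝ)) atTop atTop :=
    (tendsto_natCast_atTop_atTop.comp hDtop).const_mul_atTop hδ
  have hm : Measurable fun ω => Real.log (1 + ‖ξ 0 ω‖) := by
    have := hmeas 0
    fun_prop
  have h1 := tendsto_mul_measure_ge hm hlog hc
  -- The factor is chosen so that D + 1 ≤ 2D = (2/δ)(δD) once D ≥ 1.
  have h2 := ENNReal.Tendsto.const_mul (a := ENNReal.ofReal (2 / δ)) h1
    (Or.inr ENNReal.ofReal_ne_top)
  rw [mul_zero] at h2
  refine tendsto_of_tendsto_of_tendsto_of_le_of_le' tendsto_const_nhds h2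
    (Eventually.of_forall fun _ => zero_le) ?_
  filter_upwards [hDtop.eventually_ge_atTop 1] with n hn
  have hsub : {ω | ∃ k ≤ D n, Real.exp (δ * D n) < ‖ξ (N n + k) ω‖} =
      ⋃ k ∈ Finset.range (D n + 1), {ω | Real.exp (δ * D n) < ‖ξ (N n + k) ω‖} := by
    ext ω; simp
  have hone : ∀ k, P {ω | Real.exp (δ * D n) < ‖ξ (N n + k) ω‖} ≤
      P {ω | δ * D n ≤ Real.log (1 + ‖ξ 0 ω‖)} := by
    intro k
    have hs : MeasurableSet {x : ℂ | Real.exp (δ * D n) < ‖x‖} :=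
      measurableSet_lt (by fun_prop) (by fun_prop)
    have := (hident (N n + k)).measure_mem_eq hs
    refine (le_of_eq this).trans (measure_mono fun ω hω => ?_)
    simp only [Set.mem_preimage, Set.mem_ofPred_eq] at hω ⊢
    rw [Real.le_log_iff_exp_le (by positivity)]
    linarith
  rw [hsub]
  refine (measure_biUnion_finset_le _ _).trans ?_
  refine (Finset.sum_le_sum fun k _ => hone k).trans ?_
  rw [Finset.sum_const, Finset.card_range, nsmul_eq_mul, ← mul_assoc,
    ← ENNReal.ofReal_mul (by positivity)]
  gcongr
  rw [← ENNReal.ofReal_natCast]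
  refine ENNReal.ofReal_le_ofReal ?_
  have : (1 : ℝ) ≤ D n := by exact_mod_cast hn
  rw [← mul_assoc, div_mul_cancel₀ _ hδ.ne']
  push_cast
  linarith

/-! ### Convergence of normalised logarithms -/

/-- By the intermediate value theorem a nonconstant H attains M equally spaced levels just below its
maximum; these produce the lacunary coefficients. -/
lemma exists_levels {H : ℝ → ℝ} (hH : ContinuousOn H (Set.Icc 0 1)) {m : ℝ}
    (hatt : ∃ s ∈ Set.Icc (0 : ℝ) 1, H s = m) (hnc : ∃ s ∈ Set.Icc (0 : ℝ) 1, H s < m)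
    {ε : ℝ} (hε : 0 < ε) (M : ℕ) :
    ∃ g : ℝ, 0 < g ∧ (M + 1) * g ≤ ε ∧
      ∀ i < M, ∃ s ∈ Set.Icc (0 : ℝ) 1, H s = m - (i + 1) * g := by
  obtain ⟨s₀, hs₀, h₀⟩ := hatt
  obtain ⟨s₁, hs₁, h₁⟩ := hnc
  have hmin : 0 < min ε (m - H s₁) := lt_min hε (by linarith)
  set g := min ε (m - H s₁) / (M + 1) with hg
  have hM : (0 : ℝ) < M + 1 := by positivity
  have hgM : (M + 1) * g = min ε (m - H s₁) := by rw [hg]; field_simp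
  have hg0 : 0 < g := div_pos hmin hM
  refine ⟨g, hg0, hgM ▸ min_le_left _ _, fun i hi => ?_⟩
  have hiM : ((i : ℝ) + 1) * g ≤ (M + 1) * g := by
    have : (i : ℝ) ≤ M := by exact_mod_cast hi.le
    gcongr
  have hmem : m - (i + 1) * g ∈ Set.Icc (H s₁) (H s₀) := by
    constructor
    · linarith [hgM ▸ min_le_right ε (m - H s₁)]
    · have : 0 < ((i : ℝ) + 1) * g := by positivity
      linarith
  obtain ⟨s, hs, h⟩ := isPreconnected_Icc.intermediate_value hs₁ hs₀ hH hmem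
  exact ⟨s, hs, h⟩

lemma tendsto_floor_mul_div {D : ℕ → ℕ} (hDtop : Tendsto D atTop atTop) {s : ℝ} (hs : 0 ≤ s) :
    Tendsto (fun n => (⌊s * D n⌋₊ : ℝ) / D n) atTop (𝓝 s) :=
  (tendsto_nat_floor_mul_div_atTop hs).comp (tendsto_natCast_atTop_atTop.comp hDtop)

lemma floor_mul_le {s : ℝ} (hs : s ≤ 1) (D : ℕ) : ⌊s * D⌋₊ ≤ D := by
  refine Nat.floor_le_of_le ?_
  have : (0 : ℝ) ≤ D := Nat.cast_nonneg D
  nlinarith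

section

variable {Ω : Type*} [MeasurableSpace Ω] {P : Measure Ω} [IsProbabilityMeasure P]
  {ξ : ℕ → Ω → ℂ}

/-- Lower bound: the sum is not exponentially smaller than its largest coefficient. -/
lemma eventually_measure_norm_sum_small_le (hmeas : ∀ k, Measurable (ξ k))
    (hindep : iIndepFun ξ P) {τ : ℝ} (hτ : 0 < τ) {q : ℝ≥0∞}
    (hq : ∀ k x, (P.map (ξ k)) (Metric.closedBall x τ) ≤ q)
    (N : ℕ → ℕ) {D : ℕ → ℕ} (hDtop : Tendsto D atTop atTop) {b : ℕ → ℕ → ℂ}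
    (hb0 : ∀ n, ∀ k ≤ D n, b n k ≠ 0) {H : ℝ → ℝ} (hH : ContinuousOn H (Set.Icc 0 1))
    (hbH : ∀ γ > 0, ∀ᶠ n in atTop, ∀ k ≤ D n,
      |(D n : ℝ)⁻¹ * Real.log ‖b n k‖ - H (k / D n)| ≤ γ) {m : ℝ}
    (hatt : ∃ s ∈ Set.Icc (0 : ℝ) 1, H s = m) (hnc : ∃ s ∈ Set.Icc (0 : ℝ) 1, H s < m)
    {ε : ℝ} (hε : 0 < ε) (M : ℕ) :
    ∃ δ : ℝ, 0 < δ ∧ δ ≤ ε ∧ ∀ᶠ n in atTop,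
      P {ω | ‖∑ k ∈ Finset.range (D n + 1), b n k * ξ (N n + k) ω‖ ≤ Real.exp (D n * (m - 4 * ε)) ∧
        ∀ k ∈ Finset.range (D n + 1), ‖ξ (N n + k) ω‖ ≤ Real.exp (δ * D n)} ≤ q ^ M := by
  obtain ⟨g, hg, hgε, hlev⟩ := exists_levels hH hatt hnc hε M
  have hgε' : g ≤ ε := by
    have : (0 : ℝ) ≤ M * g := by positivity
    nlinarith
  choose! s hs hHs using hlev
  -- Levels are g apart. Errors of g/8 in each of two coefficients and g/8 from the variables leave
  -- an exponential gap of 5g/8.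
  refine ⟨g / 8, by linarith, by linarith, ?_⟩
  have hDr : Tendsto (fun n => (D n : ℝ)) atTop atTop := tendsto_natCast_atTop_atTop.comp hDtop
  have hclose : ∀ᶠ n in atTop, ∀ i ∈ Finset.range M,
      |(D n : ℝ)⁻¹ * Real.log ‖b n ⌊s i * D n⌋₊‖ - (m - (i + 1) * g)| ≤ g / 8 := by
    rw [Filter.eventually_all_finset]
    intro i hi
    have hi' := Finset.mem_range.1 hi
    have hcont : Tendsto (fun n => H ((⌊s i * D n⌋₊ : ℝ) / D n)) atTop (𝓝 (H (s i))) := by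
      refine (hH (s i) (hs i hi')).tendsto.comp (tendsto_nhdsWithin_iff.2
        ⟨tendsto_floor_mul_div hDtop (hs i hi').1, Eventually.of_forall fun n => ⟨by positivity, ?_⟩⟩)
      refine div_le_one_of_le₀ ?_ (by positivity)
      exact_mod_cast floor_mul_le (hs i hi').2 (D n)
    rw [hHs i hi'] at hcont
    filter_upwards [hbH (g / 16) (by linarith),
      (Metric.tendsto_nhds.1 hcont) (g / 16) (by linarith)] with n h1 h2
    have h3 := h1 _ (floor_mul_le (hs i hi').2 (D n))
    rw [Real.dist_eq] at h2
    calc _ ≤ |(D n : ℝ)⁻¹ * Real.log ‖b n ⌊s i * D n⌋₊‖ - H (⌊s i * D n⌋₊ / D n)| +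
          |H (⌊s i * D n⌋₊ / D n) - (m - (i + 1) * g)| := abs_sub_le _ _ _
      _ ≤ g / 16 + g / 16 := add_le_add h3 h2.le
      _ = g / 8 := by ring
  have hsmall : ∀ᶠ n in atTop, (M + 1) * Real.exp (-(D n * (5 * g / 8))) ≤ τ := by
    have h1 : Tendsto (fun n => (M + 1) * Real.exp (-(D n * (5 * g / 8)))) atTop
        (𝓝 ((M + 1) * 0)) := by
      refine Tendsto.const_mul _ (Real.tendsto_exp_atBot.comp (tendsto_neg_atTop_atBot.comp ?_))
      exact hDr.atTop_mul_const (by linarith)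
    rw [mul_zero] at h1
    filter_upwards [h1.eventually_lt_const hτ] with n hn using hn.le
  filter_upwards [hclose, hsmall, hDtop.eventually_ge_atTop 1] with n hcl hsm hD1
  have hDpos : (0 : ℝ) < D n := by exact_mod_cast hD1
  set k : ℕ → ℕ := fun i => ⌊s i * D n⌋₊ with hk
  have hkle : ∀ i < M, k i ≤ D n := fun i hi => floor_mul_le (hs i hi).2 (D n)
  have hpos : ∀ i < M, 0 < ‖b n (k i)‖ := fun i hi => norm_pos_iff.2 (hb0 n _ (hkle i hi))
  have hlogs : ∀ i < M, D n * (m - (i + 1) * g - g / 8) ≤ Real.log ‖b n (k i)‖ ∧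
      Real.log ‖b n (k i)‖ ≤ D n * (m - (i + 1) * g + g / 8) := by
    intro i hi
    have h := abs_le.1 (hcl i (Finset.mem_range.2 hi))
    have he : Real.log ‖b n (k i)‖ = D n * ((D n : ℝ)⁻¹ * Real.log ‖b n (k i)‖) := by
      field_simp
    rw [he]
    constructor
    · refine mul_le_mul_of_nonneg_left ?_ hDpos.le
      linarith [h.1]
    · refine mul_le_mul_of_nonneg_left ?_ hDpos.le
      linarith [h.2]
  have hup : ∀ i < M, ‖b n (k i)‖ ≤ Real.exp (D n * (m - (i + 1) * g + g / 8)) := fun i hi =>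
    (Real.log_le_iff_le_exp (hpos i hi)).1 (hlogs i hi).2
  have hlo : ∀ i < M, Real.exp (D n * (m - (i + 1) * g - g / 8)) ≤ ‖b n (k i)‖ := fun i hi =>
    (Real.le_log_iff_exp_le (hpos i hi)).1 (hlogs i hi).1
  -- A common index would put one logarithm within g/8 of two levels at least g apart.
  have hstrict : ∀ i < M, ∀ j < M, i < j → k i ≠ k j := by
    intro i hi j hj hij heq
    have h1 := (hlogs i hi).1
    have h2 := (hlogs j hj).2
    rw [heq] at h1
    have h3 := le_of_mul_le_mul_left (h1.trans h2) hDpos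
    have h4 : (i : ℝ) + 1 ≤ j := by exact_mod_cast hij
    nlinarith
  refine measure_norm_sum_le_pow (X := fun i => ξ (N n + i)) (fun i => hmeas _)
    (hindep.precomp (g := fun i => N n + i) (add_right_injective (N n))) (fun i x => hq _ x)
    (k := k) (fun i hi => Finset.mem_range.2 (Nat.lt_succ_of_le (hkle i hi))) ?_
    (fun i hi => hb0 n _ (hkle i hi)) ?_
  · intro i hi j hj h
    rcases lt_trichotomy i j with hij | hij | hij
    · exact absurd h (hstrict i hi j hj hij)
    · exact hij
    · exact absurd h.symm (hstrict j hj i hi hij)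
  · intro j hj
    -- This bounds the assumed size of the full sum and each later selected term. There are at most
    -- M such terms, whence the factor M + 1 in `hsmall`.
    set B := Real.exp (D n * (m - (j + 1) * g - 3 * g / 4)) with hB
    have hjM : ((j : ℝ) + 1) * g ≤ M * g := by
      have : (j : ℝ) + 1 ≤ M := by exact_mod_cast hj
      gcongr
    have hfirst : Real.exp (D n * (m - 4 * ε)) ≤ B := by
      refine Real.exp_le_exp.2 (mul_le_mul_of_nonneg_left ?_ hDpos.le)
      nlinarith
    have hsec : ∀ i ∈ Finset.Ico (j + 1) M, Real.exp (g / 8 * D n) * ‖b n (k i)‖ ≤ B := by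
      intro i hi
      rw [Finset.mem_Ico] at hi
      calc Real.exp (g / 8 * D n) * ‖b n (k i)‖
          ≤ Real.exp (g / 8 * D n) * Real.exp (D n * (m - (i + 1) * g + g / 8)) := by
            gcongr
            exact hup i hi.2
        _ = Real.exp (D n * (m - (i + 1) * g + g / 4)) := by
            rw [← Real.exp_add]; ring_nf
        _ ≤ B := by
            refine Real.exp_le_exp.2 (mul_le_mul_of_nonneg_left ?_ hDpos.le)
            have h4 : (j : ℝ) + 1 ≤ i := by exact_mod_cast hi.1
            nlinarith
    rw [Finset.mul_sum]
    have hcard : ∑ i ∈ Finset.Ico (j + 1) M, Real.exp (g / 8 * D n) * ‖b n (k i)‖ ≤ M * B := by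
      refine (Finset.sum_le_card_nsmul _ _ _ hsec).trans ?_
      rw [nsmul_eq_mul]
      gcongr
      simp
    calc _ ≤ B + M * B := add_le_add hfirst hcard
      _ = ((M + 1) * Real.exp (-(D n * (5 * g / 8)))) *
          Real.exp (D n * (m - (j + 1) * g - g / 8)) := by
          rw [mul_assoc, ← Real.exp_add, hB]
          ring_nf
      _ ≤ τ * ‖b n (k j)‖ := by
          gcongr
          exact hlo j hj

/-- If the exponential profile of the coefficients converges to a nonconstant continuous function,
then the normalised logarithm of the random sum converges in probability to its maximum. -/
theorem tendstoInMeasure_log_norm_sum (hmeas : ∀ k, Measurable (ξ k))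
    (hindep : iIndepFun ξ P) (hident : ∀ k, IdentDistrib (ξ k) (ξ 0) P P)
    (hnondeg : ¬ ∃ c : ℂ, ∀ᵐ ω ∂P, ξ 0 ω = c)
    (hlog : Integrable (fun ω => Real.log (1 + ‖ξ 0 ω‖)) P)
    (N : ℕ → ℕ) {D : ℕ → ℕ} (hDtop : Tendsto D atTop atTop) {b : ℕ → ℕ → ℂ}
    (hb0 : ∀ n, ∀ k ≤ D n, b n k ≠ 0) {H : ℝ → ℝ} (hH : ContinuousOn H (Set.Icc 0 1))
    (hbH : ∀ γ > 0, ∀ᶠ n in atTop, ∀ k ≤ D n,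
      |(D n : ℝ)⁻¹ * Real.log ‖b n k‖ - H (k / D n)| ≤ γ) {m : ℝ}
    (hmax : ∀ s ∈ Set.Icc (0 : ℝ) 1, H s ≤ m)
    (hatt : ∃ s ∈ Set.Icc (0 : ℝ) 1, H s = m) (hnc : ∃ s ∈ Set.Icc (0 : ℝ) 1, H s < m) :
    TendstoInMeasure P (fun n ω => (D n : ℝ)⁻¹ *
      Real.log ‖∑ k ∈ Finset.range (D n + 1), b n k * ξ (N n + k) ω‖) atTop (fun _ => m) := by
  obtain ⟨τ, hτ, q, hq1, hq⟩ := exists_concentration_lt_one (hmeas 0) hnondeg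
  have hq' : ∀ k x, (P.map (ξ k)) (Metric.closedBall x τ) ≤ q := fun k x => by
    rw [(hident k).map_eq]; exact hq x
  have hDr : Tendsto (fun n => (D n : ℝ)) atTop atTop := tendsto_natCast_atTop_atTop.comp hDtop
  rw [tendstoInMeasure_iff_norm]
  intro ε' hε'
  -- The upper bound loses ε from the coefficients, δ ≤ ε from the variables and ε from the number
  -- of terms, in all less than 4ε.
  obtain ⟨ε, hε, rfl⟩ : ∃ ε : ℝ, 0 < ε ∧ ε' = 4 * ε := ⟨ε' / 4, by linarith, by ring⟩
  rw [ENNReal.tendsto_nhds_zero]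
  intro η hη
  have hη2 : 0 < η / 2 := ENNReal.div_pos hη.ne' (by norm_num)
  obtain ⟨M, hM⟩ : ∃ M : ℕ, q ^ M ≤ η / 2 := by
    have := ENNReal.tendsto_pow_atTop_nhds_zero_iff.2 hq1
    exact ((ENNReal.tendsto_nhds_zero.1 this) (η / 2) hη2).exists
  obtain ⟨δ, hδ, hδε, hlow⟩ := eventually_measure_norm_sum_small_le hmeas hindep hτ hq' N hDtop hb0 hH
    hbH hatt hnc hε M
  have htail := tendsto_measure_exists_norm_gt hmeas hident hlog N D hDtop hδ
  have hlogD : ∀ᶠ n in atTop, Real.log (D n + 1) ≤ ε * D n := by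
    have h1 : Tendsto (fun x : ℝ => Real.log (x + 1) / x) atTop (𝓝 0) := by
      have h2 := Real.isLittleO_log_id_atTop
      have h3 : (fun x : ℝ => Real.log (x + 1)) =o[atTop] fun x : ℝ => x + 1 :=
        h2.comp_tendsto (tendsto_atTop_add_const_right _ 1 tendsto_id)
      have h4 : (fun x : ℝ => x + 1) =O[atTop] fun x : ℝ => x := by
        refine Asymptotics.IsBigO.of_bound 2 ?_
        filter_upwards [eventually_ge_atTop 1] with x hx
        rw [Real.norm_of_nonneg (by linarith), Real.norm_of_nonneg (by linarith)]
        linarith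
      exact (h3.trans_isBigO h4).tendsto_div_nhds_zero
    filter_upwards [(h1.comp hDr).eventually_lt_const hε, hDtop.eventually_ge_atTop 1] with n hn hD1
    have hDpos : (0 : ℝ) < D n := by exact_mod_cast hD1
    exact ((div_lt_iff₀ hDpos).1 hn).le
  filter_upwards [hlow, (ENNReal.tendsto_nhds_zero.1 htail) (η / 2) hη2, hbH ε hε, hlogD,
    hDtop.eventually_ge_atTop 1] with n h1 h2 h3 h4 hD1
  have hDpos : (0 : ℝ) < D n := by exact_mod_cast hD1
  calc _ ≤ P ({ω | ‖∑ k ∈ Finset.range (D n + 1), b n k * ξ (N n + k) ω‖ ≤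
            Real.exp (D n * (m - 4 * ε)) ∧
          ∀ k ∈ Finset.range (D n + 1), ‖ξ (N n + k) ω‖ ≤ Real.exp (δ * D n)} ∪
        {ω | ∃ k ≤ D n, Real.exp (δ * D n) < ‖ξ (N n + k) ω‖}) := by
        refine measure_mono fun ω hω => ?_
        by_contra hcon
        simp only [Set.mem_union, Set.mem_ofPred_eq, not_or, not_and, not_exists, not_lt,
          Finset.mem_range, Nat.lt_succ_iff] at hcon hω
        obtain ⟨hc1, hc2⟩ := hcon
        set S := ∑ k ∈ Finset.range (D n + 1), b n k * ξ (N n + k) ω with hS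
        have hSlow : Real.exp (D n * (m - 4 * ε)) < ‖S‖ := by
          by_contra h
          exact hc1 (not_lt.1 h) hc2
        have hSpos : 0 < ‖S‖ := (Real.exp_pos _).trans hSlow
        have hL : D n * (m - 4 * ε) < Real.log ‖S‖ := (Real.lt_log_iff_exp_lt hSpos).2 hSlow
        have hbk : ∀ k ≤ D n, ‖b n k‖ ≤ Real.exp (D n * (m + ε)) := by
          intro k hk
          rw [← Real.log_le_iff_le_exp (norm_pos_iff.2 (hb0 n k hk))]
          have h5 := (abs_le.1 (h3 k hk)).2
          have h6 := hmax (k / D n) ⟨by positivity,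
            div_le_one_of_le₀ (by exact_mod_cast hk) hDpos.le⟩
          calc Real.log ‖b n k‖ = D n * ((D n : ℝ)⁻¹ * Real.log ‖b n k‖) := by field_simp
            _ ≤ _ := mul_le_mul_of_nonneg_left (by linarith) hDpos.le
        have hSup : ‖S‖ ≤ (D n + 1) * Real.exp (D n * (m + 2 * ε)) := by
          refine (norm_sum_le _ _).trans ((Finset.sum_le_card_nsmul _ _
            (Real.exp (D n * (m + 2 * ε))) fun k hk => ?_).trans ?_)
          · have hk' : k ≤ D n := Nat.lt_succ_iff.1 (Finset.mem_range.1 hk)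
            rw [norm_mul]
            calc _ ≤ Real.exp (D n * (m + ε)) * Real.exp (δ * D n) :=
                  mul_le_mul (hbk k hk') (hc2 k hk') (norm_nonneg _) (Real.exp_pos _).le
              _ ≤ _ := by
                  rw [← Real.exp_add, Real.exp_le_exp]
                  nlinarith
          · simp
        have hU : Real.log ‖S‖ ≤ ε * D n + D n * (m + 2 * ε) := by
          have := Real.log_le_log hSpos hSup
          rw [Real.log_mul (by positivity) (Real.exp_pos _).ne', Real.log_exp] at this
          linarith
        have hfin : ‖(D n : ℝ)⁻¹ * Real.log ‖S‖ - m‖ < 4 * ε := by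
          have he : Real.log ‖S‖ = D n * ((D n : ℝ)⁻¹ * Real.log ‖S‖) := by field_simp
          rw [he] at hU hL
          rw [Real.norm_eq_abs, abs_lt]
          constructor
          · have := lt_of_mul_lt_mul_left hL hDpos.le
            linarith
          · have : D n * ((D n : ℝ)⁻¹ * Real.log ‖S‖) ≤ D n * (m + 3 * ε) := by linarith
            have := le_of_mul_le_mul_left this hDpos
            linarith
        linarith
    _ ≤ q ^ M + η / 2 := (measure_union_le _ _).trans (add_le_add h1 h2)
    _ ≤ η / 2 + η / 2 := by gcongr
    _ = η := ENNReal.add_halves η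

end

/-! ### The limiting radii -/

/-- The radius of the rescaled limit at level `t ∈ (0, 1]`, where `a` is the limit of `N / n`. -/
noncomputable def limitRadius (a t : ℝ) : ℝ := t / (a + t * (1 - a))

lemma limitRadius_denom_pos {a t : ℝ} (ha : 0 ≤ a) (ha1 : a ≤ 1) (ht : 0 < t) :
    0 < a + t * (1 - a) := by
  rcases eq_or_lt_of_le ha1 with rfl | h
  · simp
  · have : 0 < t * (1 - a) := mul_pos ht (by linarith)
    linarith

/-- The lower bound does not depend on a, so -log t is an integrable majorant for all parameters at
once. -/
lemma le_limitRadius {a t : ℝ} (ha : 0 ≤ a) (ha1 : a ≤ 1) (ht : t ∈ Set.Ioc (0 : ℝ) 1) :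
    t ≤ limitRadius a t := by
  rw [limitRadius, le_div_iff₀ (limitRadius_denom_pos ha ha1 ht.1)]
  have h : a + t * (1 - a) ≤ 1 := by nlinarith [ht.2]
  nlinarith [ht.1]

lemma limitRadius_pos {a t : ℝ} (ha : 0 ≤ a) (ha1 : a ≤ 1) (ht : t ∈ Set.Ioc (0 : ℝ) 1) :
    0 < limitRadius a t := ht.1.trans_le (le_limitRadius ha ha1 ht)

lemma limitRadius_le_one {a t : ℝ} (ha : 0 ≤ a) (ha1 : a ≤ 1) (ht : t ∈ Set.Ioc (0 : ℝ) 1) :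
    limitRadius a t ≤ 1 := by
  rw [limitRadius, div_le_one (limitRadius_denom_pos ha ha1 ht.1)]
  nlinarith [ht.2]

@[fun_prop]
lemma measurable_limitRadius (a : ℝ) : Measurable (limitRadius a) := by
  unfold limitRadius; fun_prop

lemma abs_log_limitRadius_le {a t x : ℝ} (ha : 0 ≤ a) (ha1 : a ≤ 1) (ht : 0 < t) (htx : t ≤ x)
    (hx : x ≤ 1) : |Real.log (limitRadius a x)| ≤ -Real.log t := by
  have hx' : x ∈ Set.Ioc (0 : ℝ) 1 := ⟨ht.trans_le htx, hx⟩
  rw [abs_of_nonpos (Real.log_nonpos (limitRadius_pos ha ha1 hx').le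
    (limitRadius_le_one ha ha1 hx'))]
  exact neg_le_neg (Real.log_le_log ht (htx.trans (le_limitRadius ha ha1 hx')))

lemma integrableOn_neg_log : IntegrableOn (fun t : ℝ => -Real.log t) (Set.Ioc 0 1) :=
  ((intervalIntegrable_iff_integrableOn_Ioc_of_le zero_le_one).1
    intervalIntegral.intervalIntegrable_log').neg

lemma integrableOn_log_limitRadius {a : ℝ} (ha : 0 ≤ a) (ha1 : a ≤ 1) :
    IntegrableOn (fun t => Real.log (limitRadius a t)) (Set.Ioc 0 1) := by
  refine Integrable.mono' integrableOn_neg_log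
    (Real.measurable_log.comp (measurable_limitRadius a)).aestronglyMeasurable ?_
  filter_upwards [ae_restrict_mem measurableSet_Ioc] with t ht
  exact abs_log_limitRadius_le ha ha1 ht.1 le_rfl ht.2

/-- The limiting exponential profile of the coefficients at modulus `r`. -/
noncomputable def profile (a r s : ℝ) : ℝ :=
  ∫ t in (0 : ℝ)..s, (Real.log r - Real.log (limitRadius a t))

lemma integrableOn_profile_integrand {a : ℝ} (ha : 0 ≤ a) (ha1 : a ≤ 1) (r : ℝ) :
    IntegrableOn (fun t => Real.log r - Real.log (limitRadius a t)) (Set.Ioc 0 1) :=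
  (integrable_const _).sub (integrableOn_log_limitRadius ha ha1)

lemma continuousOn_profile {a : ℝ} (ha : 0 ≤ a) (ha1 : a ≤ 1) (r : ℝ) :
    ContinuousOn (profile a r) (Set.Icc 0 1) := by
  have := intervalIntegral.continuousOn_primitive_interval' (μ := volume) (a := 0) (b₁ := 0)
    (b₂ := 1) ((intervalIntegrable_iff_integrableOn_Ioc_of_le zero_le_one).2
      (integrableOn_profile_integrand ha ha1 r)) (by simp)
  rwa [Set.uIcc_of_le zero_le_one] at this

/-- Pointwise log max(r, R) - log R = (log r - log R)^+. This matches the potential with the maximum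
of the profile. -/
lemma radialPotential_sub_eq {a r : ℝ} (ha : 0 ≤ a) (ha1 : a ≤ 1) {z : ℂ} (hz : ‖z‖ = r)
    (hr : 0 < r) :
    radialPotential (limitRadius a) z - ∫ t in Set.Ioc (0 : ℝ) 1, Real.log (limitRadius a t) =
      ∫ t in Set.Ioc (0 : ℝ) 1, max (Real.log r - Real.log (limitRadius a t)) 0 := by
  rw [radialPotential, ← integral_sub (integrable_log_max (measurable_limitRadius a)
    (fun s hs => limitRadius_pos ha ha1 hs) (fun s hs => limitRadius_le_one ha ha1 hs)
    (integrableOn_log_limitRadius ha ha1) z) (integrableOn_log_limitRadius ha ha1)]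
  refine setIntegral_congr_fun measurableSet_Ioc fun t ht => ?_
  have hR := limitRadius_pos ha ha1 ht
  simp only [hz]
  rcases le_total r (limitRadius a t) with h | h
  · rw [max_eq_right h, max_eq_right (by linarith [Real.log_le_log hr h]), sub_self]
  · rw [max_eq_left h, max_eq_left (by linarith [Real.log_le_log hR h])]

lemma profile_le {a : ℝ} (ha : 0 ≤ a) (ha1 : a ≤ 1) (r : ℝ) {s : ℝ} (hs : s ∈ Set.Icc (0 : ℝ) 1) :
    profile a r s ≤
      ∫ t in Set.Ioc (0 : ℝ) 1, max (Real.log r - Real.log (limitRadius a t)) 0 := by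
  have hi := integrableOn_profile_integrand ha ha1 r
  have hsub : Set.Ioc (0 : ℝ) s ⊆ Set.Ioc 0 1 := Set.Ioc_subset_Ioc_right hs.2
  have hmi : IntegrableOn (fun t => max (Real.log r - Real.log (limitRadius a t)) 0)
      (Set.Ioc 0 1) := hi.pos_part
  rw [profile, intervalIntegral.integral_of_le hs.1]
  refine (setIntegral_mono (hi.mono_set hsub) (hmi.mono_set hsub) fun t => le_max_left _ _).trans ?_
  exact setIntegral_mono_set hmi (Eventually.of_forall fun t => le_max_right _ _) hsub.eventuallyLE

/-- The integrand of the profile passes from nonnegative to nonpositive at most once, and the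
primitive is maximal at the crossing. -/
lemma exists_profile_eq {a r : ℝ} (ha : 0 ≤ a) (ha1 : a ≤ 1) (hr : 0 < r) :
    ∃ s ∈ Set.Icc (0 : ℝ) 1, profile a r s =
      ∫ t in Set.Ioc (0 : ℝ) 1, max (Real.log r - Real.log (limitRadius a t)) 0 := by
  obtain ⟨s, hs, h1, h2⟩ : ∃ s ∈ Set.Icc (0 : ℝ) 1,
      (∀ t ∈ Set.Ioc (0 : ℝ) 1, t ≤ s → limitRadius a t ≤ r) ∧
      (∀ t ∈ Set.Ioc (0 : ℝ) 1, s < t → r ≤ limitRadius a t) := by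
    rcases le_or_gt 1 r with h | h
    · refine ⟨1, by simp, fun t ht _ => (limitRadius_le_one ha ha1 ht).trans h,
        fun t ht hlt => absurd ht.2 (not_le.2 hlt)⟩
    · have hd : 0 < 1 - r * (1 - a) := by nlinarith
      -- For a > 0 this is the solution of `limitRadius a s = r`; for a = 0 it is 0, and the radius
      -- is constantly 1 > r.
      refine ⟨r * a / (1 - r * (1 - a)), ⟨by positivity, ?_⟩, fun t ht hle => ?_, fun t ht hlt => ?_⟩
      · rw [div_le_one hd]; nlinarith
      · rw [limitRadius, div_le_iff₀ (limitRadius_denom_pos ha ha1 ht.1)]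
        rw [le_div_iff₀ hd] at hle
        nlinarith
      · rw [limitRadius, le_div_iff₀ (limitRadius_denom_pos ha ha1 ht.1)]
        rw [div_lt_iff₀ hd] at hlt
        nlinarith
  refine ⟨s, hs, ?_⟩
  have hi := integrableOn_profile_integrand ha ha1 r
  have hmi : IntegrableOn (fun t => max (Real.log r - Real.log (limitRadius a t)) 0)
      (Set.Ioc 0 1) := hi.pos_part
  rw [profile, intervalIntegral.integral_of_le hs.1, ← Set.Ioc_union_Ioc_eq_Ioc hs.1 hs.2,
    setIntegral_union (Set.Ioc_disjoint_Ioc_of_le le_rfl) measurableSet_Ioc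
      (hmi.mono_set (Set.Ioc_subset_Ioc_right hs.2)) (hmi.mono_set (Set.Ioc_subset_Ioc_left hs.1))]
  have hz : ∫ t in Set.Ioc s 1, max (Real.log r - Real.log (limitRadius a t)) 0 = 0 := by
    refine setIntegral_eq_zero_of_forall_eq_zero fun t ht => max_eq_right ?_
    have := Real.log_le_log hr (h2 t ⟨hs.1.trans_lt ht.1, ht.2⟩ ht.1)
    linarith
  rw [hz, add_zero]
  refine setIntegral_congr_fun measurableSet_Ioc fun t ht => ?_
  have ht' : t ∈ Set.Ioc (0 : ℝ) 1 := ⟨ht.1, ht.2.trans hs.2⟩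
  have := Real.log_le_log (limitRadius_pos ha ha1 ht') (h1 t ht' ht.2)
  exact (max_eq_left (by linarith)).symm

/-- If the profile never fell below its maximum, its values at 0 and 1 would agree, which pins r to
a single value. Excluding that circle costs only a null set. -/
lemma exists_profile_lt {a r : ℝ} (ha : 0 ≤ a) (ha1 : a ≤ 1) (hr : 0 < r)
    (hne : r ≠ Real.exp (∫ t in Set.Ioc (0 : ℝ) 1, Real.log (limitRadius a t))) :
    ∃ s ∈ Set.Icc (0 : ℝ) 1, profile a r s <
      ∫ t in Set.Ioc (0 : ℝ) 1, max (Real.log r - Real.log (limitRadius a t)) 0 := by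
  by_contra hcon
  push Not at hcon
  have h0 := le_antisymm (profile_le ha ha1 r (by simp)) (hcon 0 (by simp))
  have h1 := le_antisymm (profile_le ha ha1 r (by simp)) (hcon 1 (by simp))
  rw [← h0] at h1
  simp only [profile, intervalIntegral.integral_same] at h1
  rw [intervalIntegral.integral_of_le zero_le_one, integral_sub (integrable_const _)
    (integrableOn_log_limitRadius ha ha1)] at h1
  simp only [integral_const, probReal_univ, smul_eq_mul, one_mul] at h1
  refine hne ?_
  rw [← sub_eq_zero.1 h1, Real.exp_log hr]

/-! ### Coefficients of the rescaled derivative -/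

/-- The modulus of the `k`-th coefficient of the rescaled derivative, divided by `N !`. -/
noncomputable def weight (N D k : ℕ) : ℝ := (N + k).choose k * ((D : ℝ) / (N + D : ℕ)) ^ k

lemma weight_pos {N D : ℕ} (hD : 0 < D) (k : ℕ) : 0 < weight N D k := by
  have h1 : 0 < (N + k).choose k := Nat.choose_pos (by omega)
  have h2 : 0 < N + D := by omega
  unfold weight
  positivity

/-- The ratio of consecutive weights is (n/D)(k+1)/(N+k+1), with n = N + D. That this is
`limitRadius` exactly, at parameter N/n, makes Stirling's formula unnecessary. -/
lemma weight_succ {N D : ℕ} (hD : 0 < D) (k : ℕ) :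
    weight N D (k + 1) * limitRadius ((N : ℝ) / (N + D : ℕ)) ((k + 1 : ℕ) / D) = weight N D k := by
  have hn : (0 : ℝ) < (N + D : ℕ) := by exact_mod_cast (by omega : 0 < N + D)
  have hDr : (0 : ℝ) < D := by exact_mod_cast hD
  have hch : ((N + (k + 1)).choose (k + 1) : ℝ) * (k + 1) = (N + k).choose k * (N + k + 1) := by
    have := Nat.add_one_mul_choose_eq (N + k) k
    have h2 : ((N + k + 1 : ℕ) : ℝ) * (N + k).choose k = (N + k + 1).choose (k + 1) * (k + 1 : ℕ) := by
      exact_mod_cast this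
    push_cast at h2
    rw [← add_assoc N k 1, ← h2]
    ring
  have hR : limitRadius ((N : ℝ) / (N + D : ℕ)) ((k + 1 : ℕ) / D) =
      ((N + D : ℕ) / D) * ((k + 1) / (N + k + 1)) := by
    unfold limitRadius
    have hne : (N : ℝ) + k + 1 ≠ 0 := by positivity
    have h1 : (N : ℝ) / (N + D : ℕ) + ((k + 1 : ℕ) : ℝ) / D * (1 - (N : ℝ) / (N + D : ℕ)) =
        (N + k + 1) / (N + D : ℕ) := by
      have : (1 : ℝ) - (N : ℝ) / (N + D : ℕ) = D / (N + D : ℕ) := by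
        field_simp
        push_cast
        ring
      rw [this]
      field_simp
      push_cast
      ring
    rw [h1]
    field_simp
    push_cast
    ring
  rw [hR, weight, weight, pow_succ]
  have hne : (N : ℝ) + k + 1 ≠ 0 := by positivity
  have : ((N + (k + 1)).choose (k + 1) : ℝ) = (N + k).choose k * (N + k + 1) / (k + 1) := by
    rw [eq_div_iff (by positivity), hch]
  rw [this]
  field_simp

lemma div_mem_Ioc {N D : ℕ} : 0 ≤ (N : ℝ) / (N + D : ℕ) ∧ (N : ℝ) / (N + D : ℕ) ≤ 1 :=
  ⟨by positivity, div_le_one_of_le₀ (by push_cast; linarith [(Nat.cast_nonneg D : (0 : ℝ) ≤ D)])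
    (by positivity)⟩

lemma log_weight {N D : ℕ} (hD : 0 < D) {k : ℕ} (hk : k ≤ D) :
    Real.log (weight N D k) = -∑ j ∈ Finset.range k,
      Real.log (limitRadius ((N : ℝ) / (N + D : ℕ)) ((j + 1 : ℕ) / D)) := by
  induction k with
  | zero => simp [weight]
  | succ k ih =>
    have hDr : (0 : ℝ) < D := by exact_mod_cast hD
    have hmem : ((k + 1 : ℕ) : ℝ) / D ∈ Set.Ioc (0 : ℝ) 1 :=
      ⟨by positivity, div_le_one_of_le₀ (by exact_mod_cast hk) hDr.le⟩
    have hpos := limitRadius_pos (div_mem_Ioc (N := N) (D := D)).1 div_mem_Ioc.2 hmem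
    have h1 := ih (by omega)
    rw [← weight_succ hD k, Real.log_mul (weight_pos hD _).ne' hpos.ne'] at h1
    rw [Finset.sum_range_succ]
    linarith

/-- Turns the Riemann sum into an integral. Rounding up keeps the sampled argument at least t, so
the majorant -log t still applies. -/
lemma integral_ceil_step {D : ℕ} (hD : 0 < D) (f : ℝ → ℝ) (k : ℕ) :
    IntervalIntegrable (fun t : ℝ => f (⌈t * D⌉₊ / D)) volume 0 (k / D) ∧
    ∫ t in (0 : ℝ)..(k / D), f (⌈t * D⌉₊ / D) =
      (D : ℝ)⁻¹ * ∑ j ∈ Finset.range k, f ((j + 1 : ℕ) / D) := by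
  have hDr : (0 : ℝ) < D := by exact_mod_cast hD
  have hceil : ∀ j : ℕ, ∀ t ∈ Set.Ioc ((j : ℝ) / D) ((j + 1 : ℕ) / D), ⌈t * D⌉₊ = j + 1 := by
    intro j t ht
    rw [Nat.ceil_eq_iff (by omega)]
    have h1 := (div_lt_iff₀ hDr).1 ht.1
    have h2 := (le_div_iff₀ hDr).1 ht.2
    exact ⟨by simpa using h1, h2⟩
  have hle : ∀ j : ℕ, (j : ℝ) / D ≤ (j + 1 : ℕ) / D := fun j => by gcongr; simp
  have hfint : ∀ j : ℕ, IntervalIntegrable (fun t : ℝ => f (⌈t * D⌉₊ / D)) volume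
      ((j : ℝ) / D) ((j + 1 : ℕ) / D) := by
    intro j
    rw [intervalIntegrable_iff_integrableOn_Ioc_of_le (hle j)]
    refine (integrableOn_const (C := f ((j + 1 : ℕ) / D)) (by simp)).congr_fun (fun t ht => ?_)
      measurableSet_Ioc
    simp only
    rw [hceil j t ht]
  have hval : ∀ j : ℕ, ∫ t in ((j : ℝ) / D)..((j + 1 : ℕ) / D), f (⌈t * D⌉₊ / D) =
      (D : ℝ)⁻¹ * f ((j + 1 : ℕ) / D) := by
    intro j
    rw [intervalIntegral.integral_of_le (hle j), setIntegral_congr_fun measurableSet_Ioc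
      (g := fun _ => f ((j + 1 : ℕ) / D)) (fun t ht => by simp only; rw [hceil j t ht]),
      setIntegral_const]
    simp only [Real.volume_real_Ioc_of_le (hle j), smul_eq_mul]
    push_cast
    ring
  have h0 : ((0 : ℕ) : ℝ) / D = 0 := by simp
  constructor
  · have := IntervalIntegrable.trans_iterate (a := fun j : ℕ => (j : ℝ) / D) (n := k)
      (f := fun t : ℝ => f (⌈t * D⌉₊ / D)) (μ := volume) fun j _ => hfint j
    simpa using this
  · have := intervalIntegral.sum_integral_adjacent_intervals (a := fun j : ℕ => (j : ℝ) / D) (n := k)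
      (f := fun t : ℝ => f (⌈t * D⌉₊ / D)) (μ := volume) fun j _ => hfint j
    simp only [h0] at this
    rw [← this, Finset.mul_sum]
    exact Finset.sum_congr rfl fun j _ => hval j

lemma tendsto_ceil_mul_div {D : ℕ → ℕ} (hDtop : Tendsto D atTop atTop) {t : ℝ} (ht : 0 ≤ t) :
    Tendsto (fun n => (⌈t * D n⌉₊ : ℝ) / D n) atTop (𝓝 t) :=
  (tendsto_nat_ceil_mul_div_atTop ht).comp (tendsto_natCast_atTop_atTop.comp hDtop)

lemma ceil_div_mem {D : ℕ} (hD : 0 < D) {t : ℝ} (ht : t ∈ Set.Ioc (0 : ℝ) 1) :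
    t ≤ (⌈t * D⌉₊ : ℝ) / D ∧ (⌈t * D⌉₊ : ℝ) / D ≤ 1 := by
  have hDr : (0 : ℝ) < D := by exact_mod_cast hD
  refine ⟨(le_div_iff₀ hDr).2 (Nat.le_ceil _), div_le_one_of_le₀ ?_ hDr.le⟩
  have : ⌈t * D⌉₊ ≤ D := Nat.ceil_le.2 (by nlinarith [ht.2])
  exact_mod_cast this

section

variable {N D : ℕ → ℕ} {a : ℝ}

lemma tendsto_integral_abs_log_limitRadius_sub (hDtop : Tendsto D atTop atTop) (ha : 0 ≤ a)
    (ha1 : a ≤ 1) (hN : Tendsto (fun n => (N n : ℝ) / (N n + D n : ℕ)) atTop (𝓝 a)) :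
    Tendsto (fun n => ∫ t in Set.Ioc (0 : ℝ) 1,
      |Real.log (limitRadius ((N n : ℝ) / (N n + D n : ℕ)) (⌈t * D n⌉₊ / D n)) -
        Real.log (limitRadius a t)|) atTop (𝓝 0) := by
  suffices h : Tendsto (fun n => ∫ t in Set.Ioc (0 : ℝ) 1,
      |Real.log (limitRadius ((N n : ℝ) / (N n + D n : ℕ)) (⌈t * D n⌉₊ / D n)) -
        Real.log (limitRadius a t)|) atTop (𝓝 (∫ _ in Set.Ioc (0 : ℝ) 1, (0 : ℝ))) by
    rwa [integral_zero] at h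
  refine tendsto_integral_filter_of_dominated_convergence (fun t => -Real.log t + -Real.log t) ?_ ?_
    (integrableOn_neg_log.add integrableOn_neg_log) ?_
  · refine Eventually.of_forall fun n => Measurable.aestronglyMeasurable ?_
    have h1 : Measurable fun t : ℝ => (⌈t * D n⌉₊ : ℝ) / D n :=
      (measurable_from_nat.comp (Nat.measurable_ceil.comp (by fun_prop))).div_const _
    exact ((Real.measurable_log.comp ((measurable_limitRadius _).comp h1)).sub
      (Real.measurable_log.comp (measurable_limitRadius a))).norm
  · filter_upwards [hDtop.eventually_ge_atTop 1] with n hn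
    filter_upwards [ae_restrict_mem measurableSet_Ioc] with t ht
    rw [Real.norm_eq_abs, abs_abs]
    obtain ⟨h1, h2⟩ := ceil_div_mem hn ht
    exact (abs_sub _ _).trans (add_le_add
      (abs_log_limitRadius_le div_mem_Ioc.1 div_mem_Ioc.2 ht.1 h1 h2)
      (abs_log_limitRadius_le ha ha1 ht.1 le_rfl ht.2))
  · filter_upwards [ae_restrict_mem measurableSet_Ioc] with t ht
    have hden := limitRadius_denom_pos ha ha1 ht.1
    have h1 := tendsto_ceil_mul_div hDtop ht.1.le
    have h2 : Tendsto (fun n => limitRadius ((N n : ℝ) / (N n + D n : ℕ)) (⌈t * D n⌉₊ / D n)) atTop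
        (𝓝 (limitRadius a t)) :=
      h1.div (hN.add (h1.mul (tendsto_const_nhds.sub hN))) hden.ne'
    have h3 := (h2.log (limitRadius_pos ha ha1 ht).ne').sub_const (Real.log (limitRadius a t))
    rw [sub_self] at h3
    simpa using h3.abs

/-- Uniformity in k is free: every partial integral of the difference is bounded by its L¹ norm on
(0, 1], which tends to zero. -/
lemma eventually_abs_log_coeff_sub_profile_le (hDtop : Tendsto D atTop atTop) (ha : 0 ≤ a)
    (ha1 : a ≤ 1) (hN : Tendsto (fun n => (N n : ℝ) / (N n + D n : ℕ)) atTop (𝓝 a)) {z : ℂ}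
    (hz : z ≠ 0) {γ : ℝ} (hγ : 0 < γ) :
    ∀ᶠ n in atTop, ∀ k ≤ D n,
      |(D n : ℝ)⁻¹ * Real.log ‖(weight (N n) (D n) k : ℂ) * z ^ k‖ - profile a ‖z‖ (k / D n)| ≤
        γ := by
  filter_upwards [(tendsto_integral_abs_log_limitRadius_sub hDtop ha ha1 hN).eventually_lt_const hγ,
    hDtop.eventually_ge_atTop 1] with n hn hD1 k hk
  have hDr : (0 : ℝ) < D n := by exact_mod_cast hD1
  set α := (N n : ℝ) / (N n + D n : ℕ) with hα
  have hk1 : (k : ℝ) / D n ≤ 1 := div_le_one_of_le₀ (by exact_mod_cast hk) hDr.le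
  have hk0 : 0 ≤ (k : ℝ) / D n := by positivity
  have hsub : Set.Ioc (0 : ℝ) (k / D n) ⊆ Set.Ioc 0 1 := Set.Ioc_subset_Ioc_right hk1
  obtain ⟨-, hsv⟩ := integral_ceil_step hD1 (fun x => Real.log (limitRadius α x)) k
  have hs1 := (integral_ceil_step hD1 (fun x => Real.log (limitRadius α x)) (D n)).1
  rw [div_self hDr.ne', intervalIntegrable_iff_integrableOn_Ioc_of_le zero_le_one] at hs1
  have hRi := integrableOn_log_limitRadius ha ha1
  have hlogb : (D n : ℝ)⁻¹ * Real.log ‖(weight (N n) (D n) k : ℂ) * z ^ k‖ =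
      (k / D n) * Real.log ‖z‖ -
        ∫ t in (0 : ℝ)..(k / D n), Real.log (limitRadius α (⌈t * D n⌉₊ / D n)) := by
    rw [hsv, norm_mul, Complex.norm_real, Real.norm_of_nonneg (weight_pos hD1 k).le, norm_pow,
      Real.log_mul (weight_pos hD1 k).ne' (by positivity), Real.log_pow, log_weight hD1 hk]
    ring
  have hprof : profile a ‖z‖ (k / D n) = (k / D n) * Real.log ‖z‖ -
      ∫ t in (0 : ℝ)..(k / D n), Real.log (limitRadius a t) := by
    rw [profile, intervalIntegral.integral_sub (by simp)
      ((intervalIntegrable_iff_integrableOn_Ioc_of_le hk0).2 (hRi.mono_set hsub))]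
    simp
  have hdi : IntegrableOn (fun t : ℝ => Real.log (limitRadius α (⌈t * D n⌉₊ / D n)) -
      Real.log (limitRadius a t)) (Set.Ioc 0 1) := hs1.sub hRi
  have hdiff : (D n : ℝ)⁻¹ * Real.log ‖(weight (N n) (D n) k : ℂ) * z ^ k‖ -
      profile a ‖z‖ (k / D n) = -∫ t in Set.Ioc (0 : ℝ) (k / D n),
        (Real.log (limitRadius α (⌈t * D n⌉₊ / D n)) - Real.log (limitRadius a t)) := by
    rw [hlogb, hprof, integral_sub (hs1.mono_set hsub) (hRi.mono_set hsub),
      intervalIntegral.integral_of_le hk0, intervalIntegral.integral_of_le hk0]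
    ring
  rw [hdiff, abs_neg]
  refine (abs_integral_le_integral_abs).trans (le_trans ?_ hn.le)
  exact setIntegral_mono_set hdi.abs (Eventually.of_forall fun t => abs_nonneg _)
    hsub.eventuallyLE

end

/-! ### Rescaled derivatives of Kac polynomials -/

/-- The rescaled `N`-th derivative of the Kac polynomial of degree `N + D`, divided by `N !`. -/
noncomputable def scaledKac (c : ℕ → ℂ) (N D : ℕ) : Polynomial ℂ :=
  ∑ k ∈ Finset.range (D + 1), Polynomial.C ((weight N D k : ℂ) * c (N + k)) * Polynomial.X ^ k

lemma coeff_kac (c : ℕ → ℂ) (n k : ℕ) : (kac c n).coeff k = if k ≤ n then c k else 0 := by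
  simp [kac, Polynomial.coeff_X_pow]

lemma coeff_scaledKac (c : ℕ → ℂ) (N D k : ℕ) :
    (scaledKac c N D).coeff k = if k ≤ D then (weight N D k : ℂ) * c (N + k) else 0 := by
  simp only [scaledKac, Polynomial.finsetSum_coeff, Polynomial.coeff_C_mul, Polynomial.coeff_X_pow]
  simp

lemma rescalePoly_kacDeriv (c : ℕ → ℂ) (N D : ℕ) :
    rescalePoly (((N + D : ℕ) : ℝ) / D) (kacDeriv c (N + D) N) =
      Polynomial.C (N.factorial : ℂ) * scaledKac c N D := by
  ext k
  rw [rescalePoly, Polynomial.comp_C_mul_X_coeff, kacDeriv, Polynomial.coeff_iterate_derivative,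
    coeff_kac, Polynomial.coeff_C_mul, coeff_scaledKac]
  by_cases hk : k ≤ D
  · rw [if_pos (by omega), if_pos hk, Nat.descFactorial_eq_factorial_mul_choose, weight,
      Nat.add_comm k N, Nat.choose_symm_add]
    push_cast
    rw [nsmul_eq_mul]
    push_cast
    rw [inv_div]
    ring
  · rw [if_neg (by omega), if_neg hk]
    simp

lemma natDegree_scaledKac_le (c : ℕ → ℂ) (N D : ℕ) : (scaledKac c N D).natDegree ≤ D := by
  rw [Polynomial.natDegree_le_iff_coeff_eq_zero]
  intro k hk
  rw [coeff_scaledKac, if_neg (by omega)]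

lemma eval_scaledKac (c : ℕ → ℂ) (N D : ℕ) (z : ℂ) :
    (scaledKac c N D).eval z =
      ∑ k ∈ Finset.range (D + 1), ((weight N D k : ℂ) * z ^ k) * c (N + k) := by
  simp only [scaledKac, Polynomial.eval_finsetSum, Polynomial.eval_mul, Polynomial.eval_C,
    Polynomial.eval_pow, Polynomial.eval_X]
  exact Finset.sum_congr rfl fun k _ => by ring

lemma roots_rescalePoly {r : ℝ} (hr : r ≠ 0) (p : Polynomial ℂ) :
    (rescalePoly r p).roots = p.roots.map fun z => (r : ℂ) * z := by
  have hr' : (r : ℂ) ≠ 0 := Complex.ofReal_ne_zero.2 hr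
  have h := p.map_roots_comp_C_mul_X_add_C ((r : ℂ)⁻¹) 0 (isUnit_iff_ne_zero.2 (inv_ne_zero hr'))
  simp only [Polynomial.C_0, add_zero] at h
  conv_rhs => rw [← h]
  rw [Multiset.map_map, rescalePoly]
  simp [hr']

lemma zeroMeasure_rescalePoly {r : ℝ} (hr : r ≠ 0) (p : Polynomial ℂ) :
    zeroMeasure (rescalePoly r p) = scaleMeasure r (zeroMeasure p) := by
  rw [zeroMeasure, roots_rescalePoly hr, scaleMeasure, zeroMeasure]
  induction p.roots using Multiset.induction_on with
  | empty => simp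
  | cons a m ih =>
    simp only [Multiset.map_cons, Multiset.sum_cons] at ih ⊢
    rw [Measure.map_add _ _ (by fun_prop), ← ih, Measure.map_dirac' (by fun_prop)]

lemma zeroMeasure_rescalePoly_kacDeriv (c : ℕ → ℂ) (N D : ℕ) :
    zeroMeasure (rescalePoly (((N + D : ℕ) : ℝ) / D) (kacDeriv c (N + D) N)) =
      zeroMeasure (scaledKac c N D) := by
  rw [rescalePoly_kacDeriv, zeroMeasure, Polynomial.roots_C_mul _
    (Nat.cast_ne_zero.2 N.factorial_ne_zero), zeroMeasure]

lemma sum_map_roots_kacDeriv (c : ℕ → ℂ) (N : ℕ) {D : ℕ} (hD : 0 < D) (φ : ℂ → ℝ) :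
    ((kacDeriv c (N + D) N).roots.map φ).sum =
      ((scaledKac c N D).roots.map fun z => φ (((D : ℝ) / (N + D : ℕ) : ℝ) * z)).sum := by
  have hr : ((N + D : ℕ) : ℝ) / D ≠ 0 := by
    have : (0 : ℝ) < D := by exact_mod_cast hD
    positivity
  have h1 : (scaledKac c N D).roots =
      (kacDeriv c (N + D) N).roots.map fun z => ((((N + D : ℕ) : ℝ) / D : ℝ) : ℂ) * z := by
    rw [← roots_rescalePoly hr, rescalePoly_kacDeriv, Polynomial.roots_C_mul _
      (Nat.cast_ne_zero.2 N.factorial_ne_zero)]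
  rw [h1, Multiset.map_map]
  congr 1
  refine Multiset.map_congr rfl fun z _ => ?_
  simp only [Function.comp_apply]
  congr 1
  rw [← mul_assoc, ← Complex.ofReal_mul, div_mul_div_comm, mul_comm (D : ℝ), div_self, Complex.ofReal_one,
    one_mul]
  have : (0 : ℝ) < D := by exact_mod_cast hD
  positivity

/-- The zeros of the rescaled derivatives converge, for every continuous test function. -/
theorem tendstoInMeasure_scaledKac {Ω : Type*} [MeasurableSpace Ω] {P : Measure Ω}
    [IsProbabilityMeasure P] {ξ : ℕ → Ω → ℂ} (hmeas : ∀ k, Measurable (ξ k))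
    (hindep : iIndepFun ξ P) (hident : ∀ k, IdentDistrib (ξ k) (ξ 0) P P)
    (hnondeg : ¬ ∃ c : ℂ, ∀ᵐ ω ∂P, ξ 0 ω = c)
    (hlog : Integrable (fun ω => Real.log (1 + ‖ξ 0 ω‖)) P)
    {N D : ℕ → ℕ} (hDtop : Tendsto D atTop atTop) {a : ℝ} (ha : 0 ≤ a) (ha1 : a ≤ 1)
    (hN : Tendsto (fun n => (N n : ℝ) / (N n + D n : ℕ)) atTop (𝓝 a))
    {φ : ℂ → ℝ} (hφ : Continuous φ) (hφc : HasCompactSupport φ) :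
    TendstoInMeasure P (fun n ω => ∫ z, φ z ∂((D n : ℝ≥0∞)⁻¹ •
        zeroMeasure (scaledKac (fun k => ξ k ω) (N n) (D n)))) atTop
      (fun _ => ∫ z, φ z ∂(radialMeasure (limitRadius a))) := by
  -- Makes every weight nonzero for all n and not just eventually; the limit is unaffected.
  set D' : ℕ → ℕ := fun n => max (D n) 1 with hD'
  have hev : ∀ᶠ n in atTop, D' n = D n := by
    filter_upwards [hDtop.eventually_ge_atTop 1] with n hn using max_eq_left hn
  have hD'top : Tendsto D' atTop atTop := hDtop.congr' (hev.mono fun n h => h.symm)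
  have hN' : Tendsto (fun n => (N n : ℝ) / (N n + D' n : ℕ)) atTop (𝓝 a) :=
    hN.congr' (hev.mono fun n h => by simp only [h])
  have key : TendstoInMeasure P (fun n ω => ∫ z, φ z ∂((D' n : ℝ≥0∞)⁻¹ •
        zeroMeasure (scaledKac (fun k => ξ k ω) (N n) (D' n)))) atTop
      (fun _ => ∫ z, φ z ∂(radialMeasure (limitRadius a))) := by
    have hmeas' : ∀ n, Measurable fun y : Ω × ℂ =>
        (scaledKac (fun k => ξ k y.1) (N n) (D' n)).eval y.2 := by
      intro n
      simp only [eval_scaledKac]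
      refine Finset.measurable_fun_sum _ fun k _ => ?_
      exact (measurable_const.mul (measurable_snd.pow_const k)).mul
        ((hmeas _).comp measurable_fst)
    have hconv : ∀ᵐ z : ℂ, TendstoInMeasure P (fun n ω => (D' n : ℝ)⁻¹ *
        Real.log ‖(scaledKac (fun k => ξ k ω) (N n) (D' n)).eval z‖) atTop
        (fun _ => radialPotential (limitRadius a) z +
          -∫ t in Set.Ioc (0 : ℝ) 1, Real.log (limitRadius a t)) := by
      set ρ := Real.exp (∫ t in Set.Ioc (0 : ℝ) 1, Real.log (limitRadius a t)) with hρ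
      have h0 : ∀ᵐ z : ℂ, z ≠ 0 := by simp [ae_iff]
      have hs : ∀ᵐ z : ℂ, ‖z‖ ≠ ρ := by
        rw [ae_iff]
        refine measure_mono_null (fun z hz => ?_) (Measure.addHaar_sphere volume (0 : ℂ) ρ)
        simpa using hz
      filter_upwards [h0, hs] with z hz hzρ
      have hr : 0 < ‖z‖ := norm_pos_iff.2 hz
      rw [← sub_eq_add_neg, radialPotential_sub_eq ha ha1 rfl hr]
      simp only [eval_scaledKac]
      refine tendstoInMeasure_log_norm_sum hmeas hindep hident hnondeg hlog N hD'top
        (b := fun n k => (weight (N n) (D' n) k : ℂ) * z ^ k) (fun n k _ => ?_)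
        (continuousOn_profile ha ha1 ‖z‖)
        (fun γ hγ => eventually_abs_log_coeff_sub_profile_le hD'top ha ha1 hN' hz hγ)
        (fun s hs => profile_le ha ha1 _ hs) (exists_profile_eq ha ha1 hr)
        (exists_profile_lt ha ha1 hr hzρ)
      exact mul_ne_zero (Complex.ofReal_ne_zero.2
        (weight_pos (lt_max_of_lt_right one_pos) k).ne') (pow_ne_zero _ hz)
    exact tendstoInMeasure_integral_zeroMeasure
      (p := fun n ω => scaledKac (fun k => ξ k ω) (N n) (D' n))
      (fun n ω => natDegree_scaledKac_le _ _ _) hmeas' (measurable_limitRadius a)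
      (fun s hs => limitRadius_pos ha ha1 hs) (fun s hs => limitRadius_le_one ha ha1 hs)
      (integrableOn_log_limitRadius ha ha1) _ hconv hφ hφc
  intro ε hε
  refine (key ε hε).congr' (hev.mono fun n h => ?_)
  simp only [h]

/-! ### Varying the scale -/

/-- A continuous cutoff equal to one on the unit disk. -/
noncomputable def cutoff (z : ℂ) : ℝ := max 0 (min 1 (2 - ‖z‖))

lemma continuous_cutoff : Continuous cutoff := by unfold cutoff; fun_prop

lemma cutoff_nonneg (z : ℂ) : 0 ≤ cutoff z := le_max_left _ _

lemma cutoff_le_one (z : ℂ) : cutoff z ≤ 1 := max_le zero_le_one (min_le_left _ _)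

lemma cutoff_eq_one {z : ℂ} (hz : ‖z‖ ≤ 1) : cutoff z = 1 := by
  rw [cutoff, min_eq_left (by linarith), max_eq_right zero_le_one]

lemma cutoff_eq_zero {z : ℂ} (hz : 2 ≤ ‖z‖) : cutoff z = 0 := by
  rw [cutoff, max_eq_left ((min_le_right _ _).trans (by linarith))]

lemma hasCompactSupport_cutoff : HasCompactSupport cutoff := by
  refine HasCompactSupport.intro (isCompact_closedBall (0 : ℂ) 2) fun z hz => cutoff_eq_zero ?_
  have : 2 < ‖z‖ := by simpa using hz
  exact this.le

lemma ae_radialMeasure_norm_le {R : ℝ → ℝ} (hR : Measurable R)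
    (hR1 : ∀ s ∈ Set.Ioc (0 : ℝ) 1, |R s| ≤ 1) : ∀ᵐ z ∂(radialMeasure R), ‖z‖ ≤ 1 := by
  rw [radialMeasure, ae_map_iff (by fun_prop) (measurableSet_le (by fun_prop) (by fun_prop))]
  have h1 : ∀ᵐ p ∂((volume.restrict (Set.Ioc (0 : ℝ) 1)).prod circleUniform), ‖p.2‖ = 1 :=
    Measure.quasiMeasurePreserving_snd.ae ae_circleUniform_norm
  have h2 : ∀ᵐ p ∂((volume.restrict (Set.Ioc (0 : ℝ) 1)).prod circleUniform),
      p.1 ∈ Set.Ioc (0 : ℝ) 1 :=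
    Measure.quasiMeasurePreserving_fst.ae (ae_restrict_mem measurableSet_Ioc)
  filter_upwards [h1, h2] with p hp1 hp2
  rw [norm_mul, hp1, mul_one, Complex.norm_real]
  exact hR1 _ hp2

/-- Convergence of zero measures to a measure on the unit disk persists under convergent scalings. -/
lemma tendstoInMeasure_scaled_roots {Ω : Type*} [MeasurableSpace Ω] {P : Measure Ω}
    {p : ℕ → Ω → Polynomial ℂ} {D : ℕ → ℕ}
    (hdeg : ∀ n ω, (p n ω).natDegree ≤ D n) {μ : Measure ℂ} [IsProbabilityMeasure μ]
    (hμ : ∀ᵐ z ∂μ, ‖z‖ ≤ 1)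
    (hconv : ∀ φ : ℂ → ℝ, Continuous φ → HasCompactSupport φ →
      TendstoInMeasure P (fun n ω => ∫ z, φ z ∂((D n : ℝ≥0∞)⁻¹ • zeroMeasure (p n ω))) atTop
        (fun _ => ∫ z, φ z ∂μ))
    {s : ℕ → ℝ} {t : ℝ} (hs : Tendsto s atTop (𝓝 t)) {φ : ℂ → ℝ} (hφ : Continuous φ)
    (hφc : HasCompactSupport φ) :
    TendstoInMeasure P (fun n ω => (D n : ℝ)⁻¹ * ((p n ω).roots.map fun z => φ (s n * z)).sum) atTop
      (fun _ => ∫ z, φ (t * z) ∂μ) := by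
  obtain ⟨M, hM⟩ := hφ.bounded_above_of_compact_support hφc
  have hM0 : 0 ≤ M := (norm_nonneg _).trans (hM 0)
  -- For t = 0 the function φ(t·) need not have compact support, so it is cut off. Testing `cutoff`
  -- itself then bounds the mass lost: its limit is 1 and the total mass is at most 1.
  set ψ : ℂ → ℝ := fun z => φ (t * z) * cutoff z with hψ
  have hψc : Continuous ψ := (hφ.comp (by fun_prop)).mul continuous_cutoff
  have h1 := hconv ψ hψc hasCompactSupport_cutoff.mul_left
  have h2 := hconv cutoff continuous_cutoff hasCompactSupport_cutoff
  have hψμ : ∫ z, ψ z ∂μ = ∫ z, φ (t * z) ∂μ := by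
    refine integral_congr_ae ?_
    filter_upwards [hμ] with z hz
    simp [hψ, cutoff_eq_one hz]
  have hcμ : ∫ z, cutoff z ∂μ = 1 := by
    rw [integral_congr_ae (g := fun _ => (1 : ℝ))
      (by filter_upwards [hμ] with z hz using cutoff_eq_one hz)]
    simp
  rw [hψμ] at h1
  rw [hcμ] at h2
  simp only [integral_zeroMeasure] at h1 h2
  rw [tendstoInMeasure_iff_norm] at h1 h2 ⊢
  intro ε hε
  have h3 := (h1 (ε / 4) (by linarith)).add (h2 (ε / 4 / (M + 1)) (by positivity))
  rw [add_zero] at h3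
  have hunif : ∀ᶠ n in atTop, ∀ z : ℂ, ‖z‖ ≤ 2 → |φ (s n * z) - φ (t * z)| ≤ ε / 4 := by
    obtain ⟨r, hr, h⟩ := Metric.uniformContinuous_iff.1
      (hφc.uniformContinuous_of_continuous hφ) (ε / 4) (by linarith)
    filter_upwards [(Metric.tendsto_nhds.1 hs) (r / 4) (by linarith)] with n hn z hz
    have := h (a := s n * z) (b := t * z) (by
      rw [dist_eq_norm, ← sub_mul, norm_mul, ← Complex.ofReal_sub, Complex.norm_real,
        ← dist_eq_norm]
      have : dist (s n) t * ‖z‖ ≤ r / 4 * 2 := by gcongr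
      linarith)
    rw [Real.dist_eq] at this
    exact this.le
  refine tendsto_of_tendsto_of_tendsto_of_le_of_le' tendsto_const_nhds h3
    (Eventually.of_forall fun _ => zero_le) ?_
  filter_upwards [hunif] with n hn
  refine (measure_mono ?_).trans (measure_union_le _ _)
  intro ω hω
  by_contra hcon
  simp only [Set.mem_union, Set.mem_ofPred_eq, not_or, not_le] at hcon hω
  obtain ⟨hc1, hc2⟩ := hcon
  set m := (p n ω).roots with hm
  set d := (D n : ℝ)⁻¹ with hd
  have hd0 : 0 ≤ d := by positivity
  have hcard : d * m.card ≤ 1 := by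
    have hc : (m.card : ℝ) ≤ D n := by exact_mod_cast (Polynomial.card_roots' _).trans (hdeg n ω)
    calc d * m.card ≤ d * D n := by gcongr
      _ ≤ 1 := inv_mul_le_one
  have hpt : ∀ z : ℂ, |φ (s n * z) - ψ z| ≤ ε / 4 + M * (1 - cutoff z) := by
    intro z
    have e1 : φ (s n * z) - ψ z = (φ (s n * z) - φ (t * z)) * cutoff z +
        φ (s n * z) * (1 - cutoff z) := by simp only [hψ]; ring
    rw [e1]
    have hc0 := cutoff_nonneg z
    have hc1 := cutoff_le_one z
    refine (abs_add_le _ _).trans (add_le_add ?_ ?_)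
    · rw [abs_mul, abs_of_nonneg hc0]
      rcases le_or_gt ‖z‖ 2 with hz | hz
      · calc _ ≤ ε / 4 * 1 := mul_le_mul (hn z hz) hc1 hc0 (by linarith)
          _ = ε / 4 := mul_one _
      · rw [cutoff_eq_zero hz.le, mul_zero]
        linarith
    · rw [abs_mul, abs_of_nonneg (by linarith : 0 ≤ 1 - cutoff z)]
      exact mul_le_mul_of_nonneg_right (hM _) (by linarith)
  have hsum : |(m.map fun z => φ (s n * z)).sum - (m.map ψ).sum| ≤
      m.card * (ε / 4) + M * (m.card - (m.map cutoff).sum) := by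
    induction m using Multiset.induction_on with
    | empty => simp
    | cons z m ih =>
      simp only [Multiset.map_cons, Multiset.sum_cons, Multiset.card_cons, Nat.cast_add,
        Nat.cast_one]
      have e2 : φ (s n * z) + (m.map fun z => φ (s n * z)).sum - (ψ z + (m.map ψ).sum) =
        (φ (s n * z) - ψ z) + ((m.map fun z => φ (s n * z)).sum - (m.map ψ).sum) := by ring
      rw [e2]
      refine (abs_add_le _ _).trans ?_
      have := hpt z
      have ih' := ih
      nlinarith
  have hdiff : |d * (m.map fun z => φ (s n * z)).sum - d * (m.map ψ).sum| ≤
      ε / 4 + M * (1 - d * (m.map cutoff).sum) := by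
    rw [← mul_sub, abs_mul, abs_of_nonneg hd0]
    calc _ ≤ d * (m.card * (ε / 4) + M * (m.card - (m.map cutoff).sum)) := by gcongr
      _ = (d * m.card) * (ε / 4) + M * (d * m.card - d * (m.map cutoff).sum) := by ring
      _ ≤ 1 * (ε / 4) + M * (1 - d * (m.map cutoff).sum) := by gcongr
      _ = _ := by rw [one_mul]
  have hlast : M * (1 - d * (m.map cutoff).sum) ≤ ε / 4 := by
    have h4 : 1 - d * (m.map cutoff).sum ≤ ε / 4 / (M + 1) := by
      have := neg_abs_le (d * (m.map cutoff).sum - 1)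
      rw [Real.norm_eq_abs] at hc2
      linarith
    calc _ ≤ M * (ε / 4 / (M + 1)) := by gcongr
      _ ≤ (M + 1) * (ε / 4 / (M + 1)) := by gcongr; linarith
      _ = ε / 4 := by field_simp
  have e3 : d * (m.map fun z => φ (s n * z)).sum - ∫ z, φ (t * z) ∂μ =
      (d * (m.map fun z => φ (s n * z)).sum - d * (m.map ψ).sum) +
        (d * (m.map ψ).sum - ∫ z, φ (t * z) ∂μ) := by ring
  rw [e3] at hω
  have := norm_add_le (d * (m.map fun z => φ (s n * z)).sum - d * (m.map ψ).sum)
    (d * (m.map ψ).sum - ∫ z, φ (t * z) ∂μ)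
  rw [Real.norm_eq_abs (d * (m.map fun z => φ (s n * z)).sum - d * (m.map ψ).sum)] at this
  linarith

/-! ### Profiles of the limits -/

lemma map_mul_limitRadius (a b : ℝ) :
    (radialMeasure (limitRadius a)).map (fun z => (b : ℂ) * z) =
      radialMeasure fun s => b * limitRadius a s := by
  rw [radialMeasure, Measure.map_map (by fun_prop) (by fun_prop), radialMeasure]
  congr 1
  ext p
  simp only [Function.comp_apply, Complex.ofReal_mul]
  ring

lemma isRadialWithProfile_circle :
    IsRadialWithProfile (radialMeasure fun s => (1 - 0) * limitRadius 0 s) circleProfile := by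
  refine radialMeasure_isRadialWithProfile (by fun_prop) fun r hr => ?_
  have h : ∀ s ∈ Set.Ioc (0 : ℝ) 1, |(1 - 0) * limitRadius 0 s| = 1 := by
    intro s hs
    simp [limitRadius, div_self hs.1.ne']
  unfold circleProfile
  split_ifs with h1
  · rw [ENNReal.ofReal_zero]
    convert measure_empty (μ := (volume : Measure ℝ))
    ext s
    simp only [Set.mem_inter_iff, Set.mem_ofPred_eq, Set.mem_empty_iff_false, iff_false, not_and,
      not_lt]
    intro hs
    rw [h s hs]
    exact h1
  · have : Set.Ioc (0 : ℝ) 1 ∩ {s | |(1 - 0) * limitRadius 0 s| < r} = Set.Ioc 0 1 := by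
      refine Set.inter_eq_left.2 fun s hs => ?_
      simp only [Set.mem_ofPred_eq]
      rw [h s hs]
      linarith
    rw [this]
    simp

lemma volume_eq_one_of_subset {S : Set ℝ} (h1 : Set.Ioo (0 : ℝ) 1 ⊆ S) (h2 : S ⊆ Set.Ioc 0 1) :
    volume S = 1 := by
  refine le_antisymm ((measure_mono h2).trans (by simp)) ?_
  calc (1 : ℝ≥0∞) = volume (Set.Ioo (0 : ℝ) 1) := by simp
    _ ≤ _ := measure_mono h1

lemma isRadialWithProfile_mid {a : ℝ} (ha : 0 < a) (ha1 : a < 1) :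
    IsRadialWithProfile (radialMeasure fun s => (1 - a) * limitRadius a s) (midProfile a) := by
  refine radialMeasure_isRadialWithProfile (by fun_prop) fun r hr => ?_
  have h1a : 0 < 1 - a := by linarith
  -- Clearing the denominator gives a condition linear in s. For r < 1 it reads s < ar/((1-a)(1-r)),
  -- the claimed profile.
  have habs : ∀ s ∈ Set.Ioc (0 : ℝ) 1,
      (|(1 - a) * limitRadius a s| < r ↔ s * ((1 - a) * (1 - r)) < a * r) := by
    intro s hs
    have hd := limitRadius_denom_pos ha.le ha1.le hs.1
    rw [abs_of_pos (mul_pos h1a (limitRadius_pos ha.le ha1.le hs)), limitRadius, ← mul_div_assoc,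
      div_lt_iff₀ hd]
    constructor <;> intro h <;> nlinarith
  unfold midProfile
  split_ifs with h
  · have hr1 : 0 < 1 - r := by linarith
    have hden : 0 < (1 - a) * (1 - r) := mul_pos h1a hr1
    have hlt : a * r / ((1 - a) * (1 - r)) < 1 := by
      rw [div_lt_one hden]; nlinarith
    have : Set.Ioc (0 : ℝ) 1 ∩ {s | |(1 - a) * limitRadius a s| < r} =
        Set.Ioo 0 (a * r / ((1 - a) * (1 - r))) := by
      ext s
      simp only [Set.mem_inter_iff, Set.mem_ofPred_eq, Set.mem_Ioo]
      constructor
      · rintro ⟨hs, h2⟩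
        exact ⟨hs.1, (lt_div_iff₀ hden).2 ((habs s hs).1 h2)⟩
      · rintro ⟨h2, h3⟩
        have hs : s ∈ Set.Ioc (0 : ℝ) 1 := ⟨h2, (h3.trans hlt).le⟩
        exact ⟨hs, (habs s hs).2 ((lt_div_iff₀ hden).1 h3)⟩
    rw [this]
    simp
  · rw [ENNReal.ofReal_one]
    refine volume_eq_one_of_subset (fun s hs => ⟨⟨hs.1, hs.2.le⟩, ?_⟩) Set.inter_subset_left
    refine (habs s ⟨hs.1, hs.2.le⟩).2 ?_
    push Not at h
    rcases le_or_gt 1 r with h1 | h1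
    · have : s * ((1 - a) * (1 - r)) ≤ 0 :=
        mul_nonpos_of_nonneg_of_nonpos hs.1.le
          (mul_nonpos_of_nonneg_of_nonpos h1a.le (by linarith))
      have : 0 < a * r := mul_pos ha hr
      linarith
    · have h2 : 0 < (1 - a) * (1 - r) := mul_pos h1a (by linarith)
      have h3 : s * ((1 - a) * (1 - r)) < (1 - a) * (1 - r) := by nlinarith [hs.2]
      nlinarith

lemma isRadialWithProfile_disk :
    IsRadialWithProfile (radialMeasure (limitRadius 1)) diskProfile := by
  refine radialMeasure_isRadialWithProfile (by fun_prop) fun r hr => ?_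
  have h : ∀ s ∈ Set.Ioc (0 : ℝ) 1, |limitRadius 1 s| = s := by
    intro s hs
    simp [limitRadius, abs_of_pos hs.1]
  unfold diskProfile
  split_ifs with h1
  · have : Set.Ioc (0 : ℝ) 1 ∩ {s | |limitRadius 1 s| < r} = Set.Ioo 0 r := by
      ext s
      simp only [Set.mem_inter_iff, Set.mem_ofPred_eq, Set.mem_Ioo]
      constructor
      · rintro ⟨hs, h2⟩
        rw [h s hs] at h2
        exact ⟨hs.1, h2⟩
      · rintro ⟨h2, h3⟩
        have hs : s ∈ Set.Ioc (0 : ℝ) 1 := ⟨h2, (h3.trans h1).le⟩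
        exact ⟨hs, by rwa [h s hs]⟩
    rw [this]
    simp
  · rw [ENNReal.ofReal_one]
    refine volume_eq_one_of_subset (fun s hs => ⟨⟨hs.1, hs.2.le⟩, ?_⟩) Set.inter_subset_left
    simp only [Set.mem_ofPred_eq]
    rw [h s ⟨hs.1, hs.2.le⟩]
    linarith [hs.2]

lemma circleProfile_le_one (r : ℝ) : circleProfile r ≤ 1 := by
  unfold circleProfile; split_ifs <;> norm_num

lemma diskProfile_le_one (r : ℝ) : diskProfile r ≤ 1 := by
  unfold diskProfile; split_ifs with h
  · exact h.le
  · exact le_rfl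

lemma midProfile_le_one {a : ℝ} (ha : 0 < a) (ha1 : a < 1) (r : ℝ) : midProfile a r ≤ 1 := by
  unfold midProfile
  split_ifs with h
  · rw [div_le_one (mul_pos (by linarith) (by linarith))]
    nlinarith
  · exact le_rfl

/-- The zeros of the derivatives themselves, for every limit `a ∈ [0, 1]` of `N / n`. -/
theorem tendstoInMeasure_kacDeriv {Ω : Type*} [MeasurableSpace Ω] {P : Measure Ω}
    [IsProbabilityMeasure P] {ξ : ℕ → Ω → ℂ} (hmeas : ∀ k, Measurable (ξ k))
    (hindep : iIndepFun ξ P) (hident : ∀ k, IdentDistrib (ξ k) (ξ 0) P P)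
    (hnondeg : ¬ ∃ c : ℂ, ∀ᵐ ω ∂P, ξ 0 ω = c)
    (hlog : Integrable (fun ω => Real.log (1 + ‖ξ 0 ω‖)) P)
    {N D : ℕ → ℕ} (hND : ∀ n, N n + D n = n) (hDtop : Tendsto D atTop atTop) {a : ℝ} (ha : 0 ≤ a)
    (ha1 : a ≤ 1) (hN : Tendsto (fun n => (N n : ℝ) / n) atTop (𝓝 a)) :
    ConvergesInProbability P (fun n ω => (D n : ℝ≥0∞)⁻¹ •
        zeroMeasure (kacDeriv (fun k => ξ k ω) n (N n)))
      ((radialMeasure (limitRadius a)).map fun z => ((1 - a : ℝ) : ℂ) * z) := by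
  intro φ hφ hφc
  have hφ' : Continuous φ := hφ.continuous
  have hprob := isProbabilityMeasure_radialMeasure (measurable_limitRadius a)
  have hN' : Tendsto (fun n => (N n : ℝ) / (N n + D n : ℕ)) atTop (𝓝 a) := by
    simpa only [hND] using hN
  -- The factor by which the rescaled zeros are multiplied to recover the original ones.
  have hs : Tendsto (fun n => (D n : ℝ) / (N n + D n : ℕ)) atTop (𝓝 (1 - a)) := by
    refine (hN'.const_sub 1).congr' ?_
    filter_upwards [hDtop.eventually_ge_atTop 1] with n hn
    have : (0 : ℝ) < (N n + D n : ℕ) := by exact_mod_cast (by omega : 0 < N n + D n)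
    field_simp
    push_cast
    ring
  have hμ := ae_radialMeasure_norm_le (measurable_limitRadius a) fun s hs => by
    rw [abs_of_pos (limitRadius_pos ha ha1 hs)]
    exact limitRadius_le_one ha ha1 hs
  have key := tendstoInMeasure_scaled_roots
    (p := fun n ω => scaledKac (fun k => ξ k ω) (N n) (D n))
    (fun n ω => natDegree_scaledKac_le _ _ _) hμ
    (fun ψ h1 h2 => tendstoInMeasure_scaledKac hmeas hindep hident hnondeg hlog hDtop ha ha1 hN' h1 h2)
    hs hφ' hφc
  rw [integral_map (by fun_prop) hφ'.aestronglyMeasurable]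
  intro ε hε
  refine (key ε hε).congr' ?_
  filter_upwards [hDtop.eventually_ge_atTop 1] with n hn
  congr 1
  ext ω
  simp only [Set.mem_ofPred_eq]
  rw [integral_zeroMeasure, ← sum_map_roots_kacDeriv (fun k => ξ k ω) (N n) hn φ, hND n]

end KacZeros

theorem theorem3 {Ω : Type*} [MeasurableSpace Ω] (P : Measure Ω) [IsProbabilityMeasure P]
    (ξ : ℕ → Ω → ℂ) (hmeas : ∀ k, Measurable (ξ k))
    (hindep : iIndepFun ξ P) (hident : ∀ k, IdentDistrib (ξ k) (ξ 0) P P)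
    (hnondeg : ¬ ∃ c : ℂ, ∀ᵐ ω ∂P, ξ 0 ω = c)
    (hzero : P {ω | ξ 0 ω = 0} = 0)
    (hlog : Integrable (fun ω => Real.log (1 + ‖ξ 0 ω‖)) P)
    (N : ℕ → ℕ) (hN : ∀ n, N n ≤ n)
    (D : ℕ → ℕ) (hD : ∀ n, D n = n - N n) (hDtop : Tendsto D atTop atTop) :
    (Tendsto (fun n => (N n : ℝ) / n) atTop (𝓝 0) →
      KacZeros.IsTheRadialMeasure KacZeros.circleUniform KacZeros.circleProfile ∧
      KacZeros.ConvergesInProbability P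
        (fun n ω => (D n : ℝ≥0∞)⁻¹ •
          KacZeros.zeroMeasure (KacZeros.kacDeriv (fun k => ξ k ω) n (N n)))
        KacZeros.circleUniform) ∧
    (∀ a : ℝ, 0 < a → a < 1 → Tendsto (fun n => (N n : ℝ) / n) atTop (𝓝 a) →
      ∃ μ : Measure ℂ,
        KacZeros.IsTheRadialMeasure μ (KacZeros.midProfile a) ∧
        KacZeros.ConvergesInProbability P
          (fun n ω => (D n : ℝ≥0∞)⁻¹ •
            KacZeros.zeroMeasure (KacZeros.kacDeriv (fun k => ξ k ω) n (N n)))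
          μ) ∧
    (Tendsto (fun n => (N n : ℝ) / n) atTop (𝓝 1) →
      KacZeros.ConvergesInProbability P
        (fun n ω => (D n : ℝ≥0∞)⁻¹ •
          KacZeros.zeroMeasure (KacZeros.kacDeriv (fun k => ξ k ω) n (N n)))
        (Measure.dirac 0) ∧
      (∀ n, 0 < D n → ∀ ω,
        KacZeros.zeroMeasure (KacZeros.rescalePoly ((n : ℝ) / D n)
            (KacZeros.kacDeriv (fun k => ξ k ω) n (N n))) =
          KacZeros.scaleMeasure ((n : ℝ) / D n)
            (KacZeros.zeroMeasure (KacZeros.kacDeriv (fun k => ξ k ω) n (N n)))) ∧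
      ∃ μ : Measure ℂ,
        KacZeros.IsTheRadialMeasure μ KacZeros.diskProfile ∧
        μ = volume.withDensity (fun z => ENNReal.ofReal (KacZeros.diskDensity z)) ∧
        KacZeros.ConvergesInProbability P
          (fun n ω => (D n : ℝ≥0∞)⁻¹ •
            KacZeros.zeroMeasure (KacZeros.rescalePoly ((n : ℝ) / D n)
              (KacZeros.kacDeriv (fun k => ξ k ω) n (N n))))
          μ) := by
  have hND : ∀ n, N n + D n = n := fun n => by rw [hD n]; have := hN n; omega
  have key := fun {a : ℝ} (ha : 0 ≤ a) (ha1 : a ≤ 1) =>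
    KacZeros.tendstoInMeasure_kacDeriv hmeas hindep hident hnondeg hlog hND hDtop ha ha1
  refine ⟨fun h => ?_, fun a ha ha1 h => ?_, fun h => ⟨?_, fun n hn ω => ?_, ?_⟩⟩
  · have hc := KacZeros.circleUniform_isRadialWithProfile.isTheRadialMeasure
      fun r _ => KacZeros.circleProfile_le_one r
    refine ⟨hc, ?_⟩
    have h1 := key le_rfl zero_le_one h
    -- Uniqueness of the radial measure identifies the limit at a = 0 with the uniform law on the
    -- circle.
    rwa [KacZeros.map_mul_limitRadius, hc.2 _ KacZeros.isRadialWithProfile_circle] at h1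
  · refine ⟨_, (KacZeros.isRadialWithProfile_mid ha ha1).isTheRadialMeasure
      fun r _ => KacZeros.midProfile_le_one ha ha1 r, ?_⟩
    have h1 := key ha.le ha1.le h
    rwa [KacZeros.map_mul_limitRadius] at h1
  · have h1 := key zero_le_one le_rfl h
    have hprob := KacZeros.isProbabilityMeasure_radialMeasure (KacZeros.measurable_limitRadius 1)
    -- At a = 1 the scaling factor 1 - a vanishes and collapses the limit to the origin.
    have h2 : (KacZeros.radialMeasure (KacZeros.limitRadius 1)).map
        (fun z => ((1 - 1 : ℝ) : ℂ) * z) = Measure.dirac 0 := by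
      simp only [sub_self, Complex.ofReal_zero, zero_mul, Measure.map_const, measure_univ, one_smul]
    rwa [h2] at h1
  · refine KacZeros.zeroMeasure_rescalePoly ?_ _
    have h1 : (0 : ℝ) < D n := by exact_mod_cast hn
    have h2 : (0 : ℝ) < n := by exact_mod_cast (by have := hND n; omega : 0 < n)
    positivity
  · have hd := KacZeros.isRadialWithProfile_disk.isTheRadialMeasure
      fun r _ => KacZeros.diskProfile_le_one r
    refine ⟨_, hd, (hd.2 _ KacZeros.withDensity_diskDensity_isRadialWithProfile).symm, ?_⟩
    intro φ hφ hφc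
    have hN' : Tendsto (fun n => (N n : ℝ) / (N n + D n : ℕ)) atTop (𝓝 1) := by
      simpa only [hND] using h
    have h1 := KacZeros.tendstoInMeasure_scaledKac hmeas hindep hident hnondeg hlog hDtop zero_le_one
      le_rfl hN' hφ.continuous hφc
    refine h1.congr_left fun n => Eventually.of_forall fun ω => ?_
    have h2 := KacZeros.zeroMeasure_rescalePoly_kacDeriv (fun k => ξ k ω) (N n) (D n)
    rw [hND n] at h2
    simp only [h2]
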